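/- Let $E$ be a Lusin topological space (homeomorphic to a Borel subset of a compact metric space) with Borel $\sigma$-algebra $\mathcal B(E)$; $p\mathcal B(E)$ denotes the $[0,\infty]$-valued and $bp\mathcal B(E)$ the bounded non-negative Borel functions. Let $\widehat E=\bigcup_{m\ge 0}E^{(m)}$ be the space of finite configurations of $E$, i.e. of finite sums $\mu=\sum_{k}\delta_{x_k}$ of Dirac measures together with the zero measure $\mathbf 0$, where $E^{(m)}$ is the $m$-th symmetric power; it carries the disjoint union topology and its Borel $\sigma$-algebra. For $f\in p\mathcal B(E)$ put $l_f(\mu)=\int f\,d\mu=\sum_k f(x_k)$ and $e_f=\exp(-l_f)$, and for $\varphi\in p\mathcal B(E)$, $\varphi\le 1$, put $\widehat\varphi(\mu)=\prod_k\varphi(x_k)$, $\widehat\varphi(\mathbf 0)=1$. Identify $x\in E$ with $\delta_x\in\widehat E$. Let $X$ be a Borel right process on $E$ with Markovian transition function $(T_t)_{t\ge0}$. Let $B$ be a kernel from $E$ to $\widehat E$ with $B1=1$ and $\beta_1:=\|Bl_1\|_\infty=\sup_{x\in E} Bl_1(x)<\infty$; assume $\beta_1>1$. Let $c:E\to[0,\infty)$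 be Borel with $c<\frac{\beta_1}{\beta_1-1}$ on $E$. For a bounded Borel function $a\ge0$ let $T^a_tf(x)=E^x\big(e^{-\int_0^t a(X_s)\,ds}f(X_t)\big)$. A branching kernel on $\widehat E$ is a sub-Markovian kernel $N$ with $N_{\mu+\nu}=N_\mu*N_\nu$ for all $\mu,\nu\in\widehat E$. Let $(\widehat{\mathbf H}_t)_{t\ge0}$ be the branching kernels on $\widehat E$ such that for all $\varphi\in p\mathcal B(E)$, $\varphi\le1$, the functions $H_t\varphi:=\widehat{\mathbf H}_t\widehat\varphi|_E$ are jointly measurable in $(t,x)$ and satisfy $$H_t\varphi(x)=T^c_t\varphi(x)+\int_0^tT^c_{t-s}\big(c\,B\widehat{H_s\varphi}\big)(x)\,ds,\qquad t\ge0,\ x\in E.$$ Let $Kf:=\frac{c}{c+\beta_1}B(l_f)$, and let $(Q_t)_{t\ge0}$ be the sub-Markovian kernels on $E$ such that for all $f\in bp\mathcal B(E)$ the function $(t,x)\mapsto Q_tf(x)$ is measurable and $$Q_tf(x)=T^{c+\beta_1}_tf(x)+\int_0^tT^{c+\beta_1}_{t-s}\big((c+\beta_1)KQ_sf\big)(x)\,ds,\qquad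 t\ge0,\ x\in E.$$ Let $\mathcal U^o=(U^o_\alpha)_{\alpha>0}$, $U^o_\alpha=\int_0^\infty e^{-\alpha t}Q_t\,dt$, and $\widehat{\mathcal U}=(\widehat U_\alpha)_{\alpha>0}$, $\widehat U_\alpha=\int_0^\infty e^{-\alpha t}\widehat{\mathbf H}_t\,dt$. For a resolvent $\mathcal V=(V_\alpha)_{\alpha>0}$ and $\beta>0$, a measurable $[0,\infty]$-valued function $u$ is $\mathcal V_\beta$-excessive, $u\in\mathcal E(\mathcal V_\beta)$, if $\alpha V_{\beta+\alpha}u\le u$ for all $\alpha>0$ and $\alpha V_{\beta+\alpha}u\to u$ pointwise as $\alpha\to\infty$; it is a compact Lyapunov function if moreover $[u\le n]$ is relatively compact for every $n\in\mathbb N$. Then families $(\widehat{\mathbf H}_t)$ and $(Q_t)$ as described exist, and for any such families the following assertions hold. (i) If $f\in bp\mathcal B(E)$ and $t>0$, then $e^{-\beta_1t}\,\widehat{\mathbf H}_t(l_f)=l_{Q_tf}$ on $\widehat E$. (ii) If $\beta>0$ and $\beta':=\beta_1+\beta$, then for every $u\in bp\mathcal B(E)$ the following are equivalent: (a) $u\in\mathcal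 E(\mathcal U^o_\beta)$; (b) $l_u\in\mathcal E(\widehat{\mathcal U}_{\beta'})$; (c) $1-e_{\alpha u}\in\mathcal E(\widehat{\mathcal U}_{\beta'})$ for every $\alpha>0$. (iii) If $\beta>0$, $\beta':=\beta_1+\beta$ and $u\in\mathcal E(\mathcal U^o_\beta)$ is a compact Lyapunov function on $E$, then $l_{1+u}\in\mathcal E(\widehat{\mathcal U}_{\beta'})$ is a compact Lyapunov function on $\widehat E$, and $l_{1+u}(\mu)<\infty$ for every $\mu\in\widehat E$ with $l_u(\mu)<\infty$. -/

import Mathlib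

open MeasureTheory ProbabilityTheory Filter Topology
open scoped NNReal ENNReal

/-- A Lusin topological space: a space homeomorphic to a Borel subset of a compact metric space. -/
class LusinSpace (E : Type*) [TopologicalSpace E] : Prop where
  exists_embedding : ∃ (K : Type) (_ : MetricSpace K) (_ : CompactSpace K) (j : E → K),
    IsEmbedding j ∧ MeasurableSet[borel K] (Set.range j)

/-- `f ∈ bp𝓑(E)`: a bounded, positive, Borel measurable function. -/
def IsBoundedPosMeasurable {S : Type*} [MeasurableSpace S] (f : S → ℝ≥0∞) : Prop :=
  Measurable f ∧ ∃ M : ℝ≥0, ∀ x, f x ≤ M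

/-! ### Finite configurations -/

/-- The space `Ê` of finite configurations of `E`: a finite sum `δ_{x₁} + ⋯ + δ_{xₘ}` of Dirac
measures is the multiset `{x₁, …, xₘ}`, and the zero measure is the empty multiset. -/
def FinConf (E : Type*) : Type _ := Multiset E

namespace FinConf

variable {E : Type*}

noncomputable instance : AddCommMonoid (FinConf E) := inferInstanceAs (AddCommMonoid (Multiset E))

/-- The configuration `δ_{x₁} + ⋯ + δ_{xₘ}` of an `m`-tuple. -/
def ofTuple (m : ℕ) (x : Fin m → E) : FinConf E := (List.ofFn x : Multiset E)

/-- The configuration `δ_x`; the map `dirac` identifies `E` with the set of one-point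
configurations. -/
def dirac (x : E) : FinConf E := ({x} : Multiset E)

/-- The disjoint union topology of the symmetric powers `E^(m) = E^m / σ^m`, `m ≥ 0`: the quotient
topology of `⨆ₘ E^m`, i.e. the finest topology for which all the maps `ofTuple m` are continuous. -/
instance [TopologicalSpace E] : TopologicalSpace (FinConf E) :=
  ⨆ m : ℕ, TopologicalSpace.coinduced (ofTuple (E := E) m) inferInstance

/-- The Borel `σ`-algebra of `Ê`. -/
instance [TopologicalSpace E] : MeasurableSpace (FinConf E) := borel (FinConf E)

instance [TopologicalSpace E] : BorelSpace (FinConf E) := ⟨rfl⟩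

/-- The linear function `l_f(μ) = ∫ f dμ = ∑ₖ f(xₖ)`. -/
noncomputable def lin (f : E → ℝ≥0∞) (μ : FinConf E) : ℝ≥0∞ := (Multiset.map f μ).sum

/-- The exponential function `e_f = exp(-l_f)`, with `exp(-∞) = 0`. -/
noncomputable def expLin (f : E → ℝ≥0∞) (μ : FinConf E) : ℝ≥0∞ :=
  EReal.exp (-((lin f μ : ℝ≥0∞) : EReal))

/-- The multiplicative function `φ̂(μ) = ∏ₖ φ(xₖ)`, equal to `1` at the zero measure. -/
noncomputable def mult (φ : E → ℝ≥0∞) (μ : FinConf E) : ℝ≥0∞ := (Multiset.map φ μ).prod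

end FinConf

/-! ### Resolvents and excessive functions -/

section Potential

variable {S : Type*} [MeasurableSpace S]

/-- The resolvent `V_α = ∫₀^∞ e^{-αt} P_t dt` of a family of kernels `(P_t)_{t ≥ 0}`, as operators
on positive numerical functions. -/
noncomputable def kernelResolvent (P : ℝ≥0 → Kernel S S) (α : ℝ≥0) (f : S → ℝ≥0∞) (x : S) : ℝ≥0∞ :=
  ∫⁻ t in Set.Ici (0 : ℝ),
    ENNReal.ofReal (Real.exp (-((α : ℝ) * t))) * ∫⁻ y, f y ∂(P t.toNNReal x)

/-- `u` is `𝓥_β`-excessive, where `𝓥 = (V_α)` is the resolvent of `(P_t)` and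
`𝓥_β = (V_{β+α})_{α > 0}`: `u` is positive, numerical and measurable, `α V_{β+α} u ≤ u` for all
`α > 0`, and `α V_{β+α} u → u` pointwise as `α → ∞`. -/
def IsExcessive (P : ℝ≥0 → Kernel S S) (β : ℝ≥0) (u : S → ℝ≥0∞) : Prop :=
  Measurable u ∧
  (∀ α : ℝ≥0, 0 < α → ∀ x, (α : ℝ≥0∞) * kernelResolvent P (β + α) u x ≤ u x) ∧
  ∀ x, Tendsto (fun α : ℝ≥0 => (α : ℝ≥0∞) * kernelResolvent P (β + α) u x) atTop (𝓝 (u x))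

/-- A compact Lyapunov function for `𝓥_β`: an excessive function whose level sets `[u ≤ n]` are
relatively compact. -/
def IsCompactLyapunov [TopologicalSpace S] (P : ℝ≥0 → Kernel S S) (β : ℝ≥0) (u : S → ℝ≥0∞) :
    Prop :=
  IsExcessive P β u ∧ ∀ n : ℕ, IsCompact (closure {x | u x ≤ (n : ℝ≥0∞)})

end Potential

/-! ### The base process -/

/-- A Borel right process with state space `E` whose transition function `(T_t)` is Markovian
(so that the life time is infinite and no cemetery point is needed). -/
structure BorelRightProcess (E : Type*) [TopologicalSpace E] [MeasurableSpace E]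
    (Ω : Type*) [mΩ : MeasurableSpace Ω] where
  /-- the filtration -/
  filt : Filtration ℝ≥0 mΩ
  /-- the trajectories -/
  X : ℝ≥0 → Ω → E
  /-- the shifts -/
  θ : ℝ≥0 → Ω → Ω
  /-- the laws -/
  P : E → Measure Ω
  /-- the transition function -/
  T : ℝ≥0 → Kernel E E
  markov : ∀ t, IsMarkovKernel (T t)
  prob : ∀ x, IsProbabilityMeasure (P x)
  adapted : ∀ t, Measurable[filt t] (X t)
  shift : ∀ s t ω, X s (θ t ω) = X (s + t) ω
  start : ∀ x, ∀ᵐ ω ∂(P x), X 0 ω = x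
  /-- the simple Markov property `P^x(X_{s+t} ∈ A | 𝓕_s) = T_t(X_s, A)` -/
  markov_property : ∀ x s t (G : Set Ω) (A : Set E), MeasurableSet[filt s] G → MeasurableSet A →
    P x (G ∩ X (s + t) ⁻¹' A) = ∫⁻ ω in G, T t (X s ω) A ∂(P x)
  right_continuous : ∀ ω t, ContinuousWithinAt (fun s => X s ω) (Set.Ici t) t
  /-- excessive functions are almost surely right continuous along the trajectories -/
  excessive_right_continuous : ∀ γ : ℝ≥0, 0 < γ → ∀ u : E → ℝ≥0∞, IsExcessive T γ u →
    ∀ x, ∀ᵐ ω ∂(P x), ∀ t, ContinuousWithinAt (fun s => u (X s ω)) (Set.Ici t) t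

section Branching

variable {E : Type*} [TopologicalSpace E] [MeasurableSpace E] {Ω : Type*} [MeasurableSpace Ω]

/-- The Feynman-Kac semigroup `T_t^c f(x) = E^x (exp(-∫₀^t c(X_s) ds) f(X_t))`. -/
noncomputable def BorelRightProcess.killed (X : BorelRightProcess E Ω) (c : E → ℝ≥0) (t : ℝ≥0)
    (f : E → ℝ≥0∞) (x : E) : ℝ≥0∞ :=
  ∫⁻ ω, EReal.exp (-((∫⁻ s in Set.Icc (0 : ℝ) t, (c (X.X s.toNNReal ω) : ℝ≥0∞) : ℝ≥0∞) : EReal)) *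
    f (X.X t ω) ∂(X.P x)

/-- A branching kernel on `Ê`: a sub-Markovian kernel with `N_{μ+ν} = N_μ * N_ν`. -/
def IsBranchingKernel (N : Kernel (FinConf E) (FinConf E)) : Prop :=
  (∀ μ, N μ Set.univ ≤ 1) ∧ ∀ μ ν, N (μ + ν) = Measure.conv (N μ) (N ν)

/-- `(Ĥ_t)` is the family of branching kernels of the branching process with base process `X`,
killing rate `c` and branching kernel `B`: for every measurable `φ` with `0 ≤ φ ≤ 1` the functions
`H_t φ = Ĥ_t φ̂ |_E` (which take their values in `[0,1]`) are jointly measurable in `(t,x)` and solve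
`H_t φ = T_t^c φ + ∫₀^t T_{t-s}^c (c B (H_s φ)^) ds`. -/
structure IsBranchingSemigroup (X : BorelRightProcess E Ω) (c : E → ℝ≥0)
    (B : Kernel E (FinConf E)) (H : ℝ≥0 → Kernel (FinConf E) (FinConf E)) : Prop where
  branching : ∀ t, IsBranchingKernel (H t)
  measurable : ∀ φ : E → ℝ≥0∞, Measurable φ → (∀ x, φ x ≤ 1) →
    Measurable fun p : ℝ≥0 × E => ∫⁻ μ, FinConf.mult φ μ ∂(H p.1 (FinConf.dirac p.2))
  equation : ∀ φ : E → ℝ≥0∞, Measurable φ → (∀ x, φ x ≤ 1) → ∀ (t : ℝ≥0) (x : E),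
    ∫⁻ μ, FinConf.mult φ μ ∂(H t (FinConf.dirac x)) =
      X.killed c t φ x +
        ∫⁻ s in Set.Icc (0 : ℝ) t, X.killed c (t - s.toNNReal) (fun y => (c y : ℝ≥0∞) *
          ∫⁻ ν, FinConf.mult (fun z =>
            ∫⁻ μ, FinConf.mult φ μ ∂(H s.toNNReal (FinConf.dirac z))) ν ∂(B y)) x

/-- `(Q_t)` is the linear semigroup obtained by perturbing `(T_t^c)` with the kernel `cK`: the `Q_t`
are sub-Markovian kernels, and for every `f ∈ bp𝓑(E)` the function `(t,x) ↦ Q_t f(x)` is measurable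
and solves `Q_t f = T_t^c f + ∫₀^t T_{t-s}^c (c K Q_s f) ds`. -/
structure IsPerturbedSemigroup (X : BorelRightProcess E Ω) (c : E → ℝ≥0)
    (K : (E → ℝ≥0∞) → E → ℝ≥0∞) (Q : ℝ≥0 → Kernel E E) : Prop where
  subMarkov : ∀ t x, Q t x Set.univ ≤ 1
  measurable : ∀ f : E → ℝ≥0∞, IsBoundedPosMeasurable f →
    Measurable fun p : ℝ≥0 × E => ∫⁻ y, f y ∂(Q p.1 p.2)
  equation : ∀ f : E → ℝ≥0∞, IsBoundedPosMeasurable f → ∀ (t : ℝ≥0) (x : E),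
    ∫⁻ y, f y ∂(Q t x) =
      X.killed c t f x +
        ∫⁻ s in Set.Icc (0 : ℝ) t, X.killed c (t - s.toNNReal) (fun y => (c y : ℝ≥0∞) *
          K (fun z => ∫⁻ w, f w ∂(Q s.toNNReal z)) y) x

/-- The kernel `K f = c / (c + β₁) · B(l_f)` on `E`. -/
noncomputable def meanKernel (c : E → ℝ≥0) (β₁ : ℝ≥0) (B : Kernel E (FinConf E))
    (f : E → ℝ≥0∞) (x : E) : ℝ≥0∞ :=
  ((c x / (c x + β₁) : ℝ≥0) : ℝ≥0∞) * ∫⁻ μ, FinConf.lin f μ ∂(B x)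

end Branching

/-! Everything rests on one linear identity: the first moments of the branching kernels, damped by
`exp (-β₁ t)`, are the kernels `Q_t`.

Existence. Conditioning on the first branching time turns the equation for `H_t` into a fixed point
problem for kernels from `ℝ≥0 × E` to the configurations. Picard iteration from the zero kernel
increases, and every iterate is sub-Markovian because a particle is either killed before `t` or
alive at `t` (`killed_one_add_lintegral`). Extending the limit by convolution gives branching
kernels, and the limit equation (`branching_limit_equation`) holds for every positive measurable
integrand, not only for multiplicative ones. The integrand `lin f` then yields the linear equation
of `Q_t`, once `exp (-β₁ t)` is absorbed into the killing rate. The bound on `c` says `c β₁ ≤ c +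
β₁`, which is exactly what makes the damped moments sub-Markovian.

Uniqueness. A product of numbers in `[0,1]` varies by at most the sum of the variations, so the
difference of two solutions obeys a linear inequality with mean offspring at most `β₁`; iteration
produces `tⁿ/n!` (`eq_zero_of_le_duhamel`). Comparison with the constant solution `1` shows that no
mass is lost. Generating functionals determine linear moments, since `n (1 - exp (-r/n))` tends to
`r`. Hence (i) passes from the constructed kernels to arbitrary ones.

Excessive functions. By (i) the resolvents are intertwined by `lin`, so (a) and (b) are equivalent.
For (a) ⇒ (c), the supermedian inequality is Jensen's for the concave function `1 - exp (-r)`. Its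
limit at infinity needs `H_t φ → φ` as `t → 0` for `φ = exp (-αu)`: a bounded excessive `u` of `Q`
is excessive for the base process at a higher level, hence right continuous along trajectories. For
(c) ⇒ (b), write `lin u` as the limit of `n (1 - exp (-lin u / n))` and use Fatou. In (iii), the
constant `1` is excessive, and `lin (1 + u) ≤ n` bounds the number of points as well as `u` at each
of them. -/

/-! ### Lusin spaces -/

namespace LusinSpace

variable (E : Type*) [TopologicalSpace E] [LusinSpace E]

theorem secondCountableTopology : SecondCountableTopology E := by
  obtain ⟨K, _, _, j, hj, _⟩ := LusinSpace.exists_embedding (E := E)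
  exact hj.secondCountableTopology

theorem metrizableSpace : TopologicalSpace.MetrizableSpace E := by
  obtain ⟨K, _, _, j, hj, _⟩ := LusinSpace.exists_embedding (E := E)
  exact hj.metrizableSpace

theorem standardBorelSpace [MeasurableSpace E] [BorelSpace E] : StandardBorelSpace E := by
  obtain ⟨K, _, _, j, hj, hr⟩ := LusinSpace.exists_embedding (E := E)
  borelize K
  have : StandardBorelSpace (Set.range j) := hr.standardBorel
  let e : E ≃ᵐ Set.range j := (hj.toHomeomorph).toMeasurableEquiv
  obtain ⟨τ, hτ, _⟩ := this.polish
  -- The Polish topology on the range may be finer than the subspace topology. Only its Borel sets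
  -- are transported to `E`, where they are the given ones.
  refine ⟨⟨τ.induced e, @BorelSpace.mk _ (τ.induced e) _ ?_, e.toEquiv.polishSpace_induced⟩⟩
  have key : ∀ f : E → Set.range j,
      MeasurableSpace.comap f inferInstance = @borel E (τ.induced f) :=
    fun f => by rw [hτ.measurable_eq, borel_comap]
  exact e.measurableEmbedding.comap_eq.symm.trans (key e)

end LusinSpace

theorem countablySeparated_of_injective {α β : Type*} [MeasurableSpace α] [MeasurableSpace β]
    [MeasurableSpace.CountablySeparated β] {f : α → β} (hf : Measurable f)
    (hi : Function.Injective f) : MeasurableSpace.CountablySeparated α := by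
  obtain ⟨S, hS, hm, hs⟩ := exists_countable_separating β MeasurableSet Set.univ
  refine ⟨⟨(f ⁻¹' ·) '' S, hS.image _, ?_, fun x _ y _ h => hi (hs _ trivial _ trivial ?_)⟩⟩
  · rintro _ ⟨s, hs, rfl⟩
    exact hf (hm s hs)
  · exact fun s hs => h _ ⟨s, hs, rfl⟩

/-- Lets the surjection criterion for measurability be applied to products with the configuration
space. -/
instance countablySeparated_prod {α β : Type*} [MeasurableSpace α] [MeasurableSpace β]
    [MeasurableSpace.CountablySeparated α] [MeasurableSpace.CountablySeparated β] :
    MeasurableSpace.CountablySeparated (α × β) := by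
  obtain ⟨f, hf, hfi⟩ := MeasurableSpace.measurable_injection_nat_bool_of_countablySeparated α
  obtain ⟨g, hg, hgi⟩ := MeasurableSpace.measurable_injection_nat_bool_of_countablySeparated β
  exact countablySeparated_of_injective (hf.prodMap hg) (hfi.prodMap hgi)

/-! ### Algebra of configurations -/

namespace FinConf

section Algebra

variable {E : Type*}

theorem induction {p : FinConf E → Prop} (zero : p 0) (add : ∀ x μ, p μ → p (dirac x + μ))
    (μ : FinConf E) : p μ :=
  Multiset.induction (p := p) zero (fun x μ h => add x μ h) μ

@[simp] theorem lin_zero (f : E → ℝ≥0∞) : lin f 0 = 0 := Multiset.sum_zero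

@[simp] theorem lin_add (f : E → ℝ≥0∞) (μ ν : FinConf E) : lin f (μ + ν) = lin f μ + lin f ν :=
  (congrArg Multiset.sum (Multiset.map_add f μ ν)).trans (Multiset.sum_add _ _)

@[simp] theorem lin_dirac (f : E → ℝ≥0∞) (x : E) : lin f (dirac x) = f x := by
  simp [lin, dirac]

@[simp] theorem mult_zero (φ : E → ℝ≥0∞) : mult φ 0 = 1 := Multiset.prod_zero

@[simp] theorem mult_add (φ : E → ℝ≥0∞) (μ ν : FinConf E) :
    mult φ (μ + ν) = mult φ μ * mult φ ν :=
  (congrArg Multiset.prod (Multiset.map_add φ μ ν)).trans (Multiset.prod_add _ _)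

@[simp] theorem mult_dirac (φ : E → ℝ≥0∞) (x : E) : mult φ (dirac x) = φ x := by
  simp [mult, dirac]

theorem ofTuple_zero (x : Fin 0 → E) : ofTuple 0 x = 0 := by
  simp only [ofTuple, List.ofFn_zero]; rfl

theorem ofTuple_succ (m : ℕ) (x : Fin (m + 1) → E) :
    ofTuple (m + 1) x = dirac (x 0) + ofTuple m (fun i => x i.succ) := by
  simp only [ofTuple, List.ofFn_succ]; rfl

theorem ofTuple_append {m n : ℕ} (x : Fin m → E) (y : Fin n → E) :
    ofTuple (m + n) (Fin.append x y) = ofTuple m x + ofTuple n y := by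
  simp only [ofTuple, List.ofFn_fin_append]; rfl

theorem dirac_eq_ofTuple (x : E) : dirac x = ofTuple 1 fun _ => x := by
  simp only [ofTuple, List.ofFn_succ, List.ofFn_zero]; rfl

theorem exists_ofTuple (μ : FinConf E) : ∃ m x, ofTuple m x = μ := by
  induction μ using induction with
  | zero => exact ⟨0, Fin.elim0, ofTuple_zero _⟩
  | add x μ ih =>
    obtain ⟨m, y, rfl⟩ := ih
    exact ⟨m + 1, Fin.cons x y, by simp [ofTuple_succ]⟩

theorem lin_ofTuple (f : E → ℝ≥0∞) (m : ℕ) (x : Fin m → E) :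
    lin f (ofTuple m x) = ∑ i, f (x i) := by
  induction m with
  | zero => simp [ofTuple_zero]
  | succ m ih => simp [ofTuple_succ, ih, Fin.sum_univ_succ]

theorem mult_ofTuple (φ : E → ℝ≥0∞) (m : ℕ) (x : Fin m → E) :
    mult φ (ofTuple m x) = ∏ i, φ (x i) := by
  induction m with
  | zero => simp [ofTuple_zero]
  | succ m ih => simp [ofTuple_succ, ih, Fin.prod_univ_succ]

theorem lin_mono {f g : E → ℝ≥0∞} (h : ∀ x, f x ≤ g x) (μ : FinConf E) : lin f μ ≤ lin g μ := by
  induction μ using induction with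
  | zero => simp
  | add x μ ih => simpa using add_le_add (h x) ih

theorem mult_mono {f g : E → ℝ≥0∞} (h : ∀ x, f x ≤ g x) (μ : FinConf E) :
    mult f μ ≤ mult g μ := by
  induction μ using induction with
  | zero => simp
  | add x μ ih => simpa using mul_le_mul' (h x) ih

@[simp] theorem mult_one (μ : FinConf E) : mult (fun _ => 1) μ = 1 := by
  induction μ using induction with
  | zero => simp
  | add x μ ih => simpa using ih

theorem mult_le_one {φ : E → ℝ≥0∞} (h : ∀ x, φ x ≤ 1) (μ : FinConf E) : mult φ μ ≤ 1 :=
  (mult_mono h μ).trans (mult_one μ).le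

theorem lin_add_fun (f g : E → ℝ≥0∞) (μ : FinConf E) :
    lin (fun x => f x + g x) μ = lin f μ + lin g μ := by
  induction μ using induction with
  | zero => simp
  | add x μ ih => simp [ih]; ring

theorem lin_const_mul (a : ℝ≥0∞) (f : E → ℝ≥0∞) (μ : FinConf E) :
    lin (fun x => a * f x) μ = a * lin f μ := by
  induction μ using induction with
  | zero => simp
  | add x μ ih => simp [ih, mul_add]

theorem lin_one_ne_top (μ : FinConf E) : lin (fun _ => 1) μ ≠ ∞ := by
  induction μ using induction with
  | zero => simp
  | add x μ ih => simpa using ih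

theorem lin_le_of_bound {f : E → ℝ≥0∞} {M : ℝ≥0∞} (h : ∀ x, f x ≤ M) (μ : FinConf E) :
    lin f μ ≤ M * lin (fun _ => 1) μ := by
  rw [← lin_const_mul]
  exact lin_mono (by simpa using h) μ

theorem lin_ne_top_of_bound {f : E → ℝ≥0∞} {M : ℝ≥0} (h : ∀ x, f x ≤ M) (μ : FinConf E) :
    lin f μ ≠ ∞ :=
  ne_top_of_le_ne_top (ENNReal.mul_ne_top ENNReal.coe_ne_top (lin_one_ne_top μ))
    (lin_le_of_bound h μ)

/-- The increment of a product of numbers in `[0,1]` is at most the sum of the increments. -/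
theorem mult_le_mult_add_lin {f g : E → ℝ≥0∞} (hf : ∀ x, f x ≤ 1) (hg : ∀ x, g x ≤ 1)
    (μ : FinConf E) : mult f μ ≤ mult g μ + lin (fun x => f x - g x) μ := by
  induction μ using induction with
  | zero => simp
  | add x μ ih =>
    simp only [mult_add, mult_dirac, lin_add, lin_dirac]
    calc f x * mult f μ ≤ (g x + (f x - g x)) * mult f μ := by gcongr; exact le_add_tsub
      _ = g x * mult f μ + (f x - g x) * mult f μ := add_mul _ _ _
      _ ≤ g x * (mult g μ + lin (fun x => f x - g x) μ) + (f x - g x) * 1 := by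
          gcongr; exact mult_le_one hf μ
      _ ≤ g x * mult g μ + 1 * lin (fun x => f x - g x) μ + (f x - g x) * 1 := by
          rw [mul_add]; gcongr; exact hg x
      _ = _ := by ring

end Algebra

/-! ### The Borel structure of the configuration space -/

section Borel

theorem continuous_ofTuple {E : Type*} [TopologicalSpace E] (m : ℕ) :
    Continuous (ofTuple (E := E) m) :=
  continuous_iff_coinduced_le.2 (le_iSup (fun m => TopologicalSpace.coinduced
    (ofTuple (E := E) m) inferInstance) m)

theorem isOpen_iff {E : Type*} [TopologicalSpace E] {s : Set (FinConf E)} :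
    IsOpen s ↔ ∀ m, IsOpen (ofTuple m ⁻¹' s) := by
  refine (isOpen_iSup_iff (t := fun m => TopologicalSpace.coinduced
    (ofTuple (E := E) m) inferInstance)).trans ?_
  exact forall_congr' fun m => isOpen_coinduced

variable {E : Type*} [TopologicalSpace E] [LusinSpace E] [MeasurableSpace E] [BorelSpace E]

theorem measurable_ofTuple (m : ℕ) : Measurable (ofTuple (E := E) m) := by
  have := LusinSpace.secondCountableTopology E
  exact (continuous_ofTuple m).measurable

theorem measurable_dirac : Measurable (dirac (E := E)) := by
  simp_rw [funext dirac_eq_ofTuple]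
  exact (measurable_ofTuple 1).comp (measurable_pi_lambda _ fun _ => measurable_id)

/-- Counting the points in an open set is lower semicontinuous on each power of `E`. These sets
serve as separating sets. -/
theorem isOpen_lt_lin {E : Type*} [TopologicalSpace E] {U : Set E} (hU : IsOpen U) (k : ℝ≥0∞) :
    IsOpen {μ : FinConf E | k < lin (U.indicator 1) μ} := by
  refine isOpen_iff.2 fun m => ?_
  have : LowerSemicontinuous fun x : Fin m → E => ∑ i, U.indicator (1 : E → ℝ≥0∞) (x i) :=
    lowerSemicontinuous_sum fun i _ =>
      LowerSemicontinuous.comp (hU.lowerSemicontinuous_indicator zero_le_one) (continuous_apply i)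
  simpa [lin_ofTuple, Set.preimage] using this.isOpen_preimage k

theorem lin_indicator_eq_count {E : Type*} [DecidableEq E] {U : Set E} {a : E}
    (μ : FinConf E) (ha : a ∈ U)
    (h : ∀ x ∈ (show Multiset E from μ), x ∈ U → x = a) :
    lin (U.indicator 1) μ = ((show Multiset E from μ).count a : ℝ≥0∞) := by
  induction μ using induction with
  | zero => exact (lin_zero _).trans (by simp [show (0 : FinConf E) = (0 : Multiset E) from rfl])
  | add x μ ih =>
    have e : (show Multiset E from (dirac x + μ)) = x ::ₘ (show Multiset E from μ) := rfl
    rw [e] at h ⊢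
    rw [lin_add, ih fun y hy => h y (Multiset.mem_cons_of_mem hy), lin_dirac, Multiset.count_cons]
    by_cases hx : x = a
    · subst hx; simp [ha, add_comm]
    · have : x ∉ U := fun hU => hx (h x (Multiset.mem_cons_self _ _) hU)
      simp [this, Ne.symm hx]

/-- Two distinct configurations give some point `a` different multiplicities. A basic open set
containing `a` and no other point of either configuration reads off both multiplicities, so the sets
`{μ(U) > k}`, with `U` in a countable basis, separate. -/
instance : MeasurableSpace.CountablySeparated (FinConf E) := by
  classical
  have := LusinSpace.secondCountableTopology E
  have := LusinSpace.metrizableSpace E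
  let b := TopologicalSpace.countableBasis E
  refine ⟨⟨(fun p : Set E × ℕ => {μ : FinConf E | (p.2 : ℝ≥0∞) < lin (p.1.indicator 1) μ}) ''
    (b ×ˢ Set.univ), ((TopologicalSpace.countable_countableBasis E).prod
      Set.countable_univ).image _, ?_, ?_⟩⟩
  · rintro _ ⟨p, hp, rfl⟩
    exact (isOpen_lt_lin (TopologicalSpace.isOpen_of_mem_countableBasis hp.1) _).measurableSet
  · intro μ _ ν _ h
    by_contra hne
    obtain ⟨a, ha⟩ : ∃ a, (show Multiset E from μ).count a ≠ (show Multiset E from ν).count a := by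
      by_contra! hc
      exact hne (Multiset.ext.2 hc)
    let F : Set E := {x | x ∈ (show Multiset E from μ + ν) ∧ x ≠ a}
    have hF : F.Finite :=
      (Multiset.finite_toSet (show Multiset E from μ + ν)).subset fun x hx => hx.1
    obtain ⟨U, hU, haU, hUF⟩ :=
      (TopologicalSpace.isBasis_countableBasis E).exists_subset_of_mem_open
      (show a ∈ Fᶜ from fun h => h.2 rfl) hF.isClosed.isOpen_compl
    have key : ∀ ρ : FinConf E, (∀ x ∈ (show Multiset E from ρ), x ∈ (show Multiset E from μ + ν)) →
        lin (U.indicator 1) ρ = ((show Multiset E from ρ).count a : ℝ≥0∞) := fun ρ hρ =>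
      lin_indicator_eq_count ρ haU fun x hx hxU => by
        by_contra hxa
        exact hUF hxU ⟨hρ x hx, hxa⟩
    have hk : ∀ k : ℕ, k < (show Multiset E from μ).count a ↔
        k < (show Multiset E from ν).count a := fun k => by
      have := h _ ⟨(U, k), ⟨hU, trivial⟩, rfl⟩
      simp only [Set.mem_ofPred_eq] at this
      rw [key μ fun x hx => Multiset.mem_add.2 (.inl hx),
        key ν fun x hx => Multiset.mem_add.2 (.inr hx)] at this
      exact_mod_cast this
    exact ha (eq_of_forall_lt_iff hk)

/-- A configuration encoded by its number of points and a sequence. -/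
def ofSeq {E : Type*} (p : ℕ × (ℕ → E)) : FinConf E := ofTuple p.1 fun i => p.2 i

theorem measurable_ofSeq : Measurable (ofSeq (E := E)) :=
  measurable_from_prod_countable_right fun m =>
    (measurable_ofTuple m).comp (measurable_pi_lambda _ fun _ => measurable_pi_apply _)

theorem surjective_ofSeq {E : Type*} [Nonempty E] :
    Function.Surjective (ofSeq (E := E)) := fun μ => by
  obtain ⟨m, x, rfl⟩ := exists_ofTuple μ
  -- The values from index `m` on are ignored by `ofSeq`; padding them is what requires a point of
  -- `E`.
  refine ⟨(m, fun i => if h : i < m then x ⟨i, h⟩ else Classical.arbitrary E), ?_⟩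
  simp [ofSeq]

/-- A map on `Y × Ê` is measurable as soon as it is so on the spaces `Y × E^m`. -/
theorem measurable_prod_of_ofTuple [Nonempty E] {Y Z : Type*} [MeasurableSpace Y]
    [StandardBorelSpace Y] [MeasurableSpace Z] {g : Y × FinConf E → Z}
    (h : ∀ m, Measurable fun p : Y × (Fin m → E) => g (p.1, ofTuple m p.2)) : Measurable g := by
  have := LusinSpace.standardBorelSpace E
  have hs : Function.Surjective (Prod.map id (ofSeq (E := E)) : Y × ℕ × (ℕ → E) → Y × FinConf E) :=
    Function.surjective_id.prodMap surjective_ofSeq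
  -- Measurability descends along a measurable surjection from a standard Borel space onto a
  -- countably separated one. This avoids any finer analysis of the quotient topology.
  rw [← (measurable_id.prodMap measurable_ofSeq).measurable_comp_iff_of_surjective hs]
  have : Measurable fun p : ℕ × (Y × (ℕ → E)) => g (p.2.1, ofSeq (p.1, p.2.2)) :=
    measurable_from_prod_countable_right fun m => (h m).comp
      (measurable_fst.prodMk (measurable_pi_lambda _ fun i =>
        (measurable_pi_apply _).comp measurable_snd))
  exact this.comp ((measurable_fst.comp measurable_snd).prodMk
    (measurable_fst.prodMk (measurable_snd.comp measurable_snd)))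

theorem measurable_of_ofTuple [Nonempty E] {Z : Type*} [MeasurableSpace Z] {g : FinConf E → Z}
    (h : ∀ m, Measurable fun x : Fin m → E => g (ofTuple m x)) : Measurable g := by
  have : Measurable fun p : Unit × FinConf E => g p.2 :=
    measurable_prod_of_ofTuple fun m => (h m).comp measurable_snd
  exact this.comp (measurable_const.prodMk measurable_id : Measurable fun μ => ((), μ))

theorem measurable_lin [Nonempty E] {f : E → ℝ≥0∞} (hf : Measurable f) : Measurable (lin f) :=
  measurable_of_ofTuple fun m => by
    simp only [lin_ofTuple]
    fun_prop

theorem measurable_mult [Nonempty E] {f : E → ℝ≥0∞} (hf : Measurable f) : Measurable (mult f) :=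
  measurable_of_ofTuple fun m => by
    simp only [mult_ofTuple]
    fun_prop

theorem measurable_prod_lin [Nonempty E] {Y : Type*} [MeasurableSpace Y]
    [StandardBorelSpace Y] {f : Y → E → ℝ≥0∞} (hf : Measurable (Function.uncurry f)) :
    Measurable fun p : Y × FinConf E => lin (f p.1) p.2 :=
  measurable_prod_of_ofTuple fun m => by
    simp only [lin_ofTuple]
    exact Finset.measurable_sum _ fun i _ =>
      hf.comp (measurable_fst.prodMk ((measurable_pi_apply i).comp measurable_snd))

theorem measurable_prod_mult [Nonempty E] {Y : Type*} [MeasurableSpace Y]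
    [StandardBorelSpace Y] {f : Y → E → ℝ≥0∞} (hf : Measurable (Function.uncurry f)) :
    Measurable fun p : Y × FinConf E => mult (f p.1) p.2 :=
  measurable_prod_of_ofTuple fun m => by
    simp only [mult_ofTuple]
    exact Finset.measurable_prod _ fun i _ =>
      hf.comp (measurable_fst.prodMk ((measurable_pi_apply i).comp measurable_snd))

/-- On encodings by tuples, addition is concatenation, which is measurable coordinate by coordinate.
-/
theorem measurableAdd₂ [Nonempty E] : MeasurableAdd₂ (FinConf E) := by
  have := LusinSpace.standardBorelSpace E
  refine ⟨?_⟩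
  have hs : Function.Surjective (Prod.map (ofSeq (E := E)) (ofSeq (E := E))) :=
    surjective_ofSeq.prodMap surjective_ofSeq
  rw [← (measurable_ofSeq.prodMap measurable_ofSeq).measurable_comp_iff_of_surjective hs]
  have : Measurable fun p : (ℕ × ℕ) × ((ℕ → E) × (ℕ → E)) =>
      ofSeq (p.1.1, p.2.1) + ofSeq (p.1.2, p.2.2) :=
    measurable_from_prod_countable_right fun ⟨m, n⟩ => by
      simp only [ofSeq, ← ofTuple_append]
      refine (measurable_ofTuple _).comp (measurable_pi_lambda _ fun i => ?_)
      refine Fin.addCases (fun i => ?_) (fun i => ?_) i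
      · simp only [Fin.append_left]; fun_prop
      · simp only [Fin.append_right]; fun_prop
  exact this.comp (by fun_prop : Measurable fun p : (ℕ × (ℕ → E)) × (ℕ × (ℕ → E)) =>
    ((p.1.1, p.2.1), (p.1.2, p.2.2)))

end Borel

end FinConf

/-! ### Increasing limits of measures -/

/-- The measures `m n` increase to `M`, in the sense of integrals of positive functions. -/
structure IsIncreasingLimit {S : Type*} [MeasurableSpace S] (m : ℕ → Measure S) (M : Measure S) :
    Prop where
  mono : ∀ F : S → ℝ≥0∞, Measurable F → Monotone fun n => ∫⁻ x, F x ∂(m n)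
  lintegral_eq : ∀ F : S → ℝ≥0∞, Measurable F → ∫⁻ x, F x ∂M = ⨆ n, ∫⁻ x, F x ∂(m n)

/-- The setwise supremum is countably additive because increasing suprema commute with sums. The
formula for integrals then extends from indicators by monotone class. -/
theorem exists_isIncreasingLimit {S : Type*} [MeasurableSpace S] (m : ℕ → Measure S)
    (h : ∀ F : S → ℝ≥0∞, Measurable F → Monotone fun n => ∫⁻ x, F x ∂(m n)) :
    ∃ M, IsIncreasingLimit m M := by
  have hset : ∀ s, MeasurableSet s → Monotone fun n => m n s := fun s hs => by
    simpa [lintegral_indicator_one hs] using h (s.indicator 1) (measurable_one.indicator hs)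
  let M : Measure S := Measure.ofMeasurable (fun s _ => ⨆ n, m n s) (by simp) (by
    intro f hf hd
    simp_rw [measure_iUnion hd hf, ENNReal.tsum_eq_iSup_sum]
    rw [iSup_comm]
    refine iSup_congr fun s => ?_
    rw [ENNReal.finsetSum_iSup_of_monotone fun i => hset _ (hf i)])
  have hM : ∀ s, MeasurableSet s → M s = ⨆ n, m n s := fun s hs =>
    Measure.ofMeasurable_apply s hs
  refine ⟨M, h, fun F hF => ?_⟩
  refine Measurable.ennreal_induction (motive := fun F => ∫⁻ x, F x ∂M = ⨆ n, ∫⁻ x, F x ∂(m n))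
    (fun c s hs => ?_) (fun f g _ hf hg ihf ihg => ?_) (fun f hf hm ih => ?_) hF
  · simp_rw [lintegral_indicator_const hs, hM _ hs, ENNReal.mul_iSup]
  · simp only [Pi.add_apply]
    simp_rw [lintegral_add_left hf, ihf, ihg]
    exact ENNReal.iSup_add_iSup_of_monotone (h _ hf) (h _ hg)
  · simp_rw [lintegral_iSup hf hm, ih]
    exact iSup_comm

/-- Joint monotone convergence of the integrands and of the measures. -/
theorem IsIncreasingLimit.lintegral_iSup {S : Type*} [MeasurableSpace S] {m : ℕ → Measure S}
    {M : Measure S} (h : IsIncreasingLimit m M) {F : ℕ → S → ℝ≥0∞} (hF : ∀ n, Measurable (F n))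
    (hm : Monotone F) : ∫⁻ x, ⨆ n, F n x ∂M = ⨆ n, ∫⁻ x, F n x ∂(m n) := by
  rw [MeasureTheory.lintegral_iSup hF hm]
  simp_rw [fun n => h.lintegral_eq _ (hF n)]
  apply le_antisymm
  · refine iSup_le fun i => iSup_le fun j => le_iSup_of_le (max i j) ?_
    exact (h.mono _ (hF i) (le_max_right i j)).trans
      (lintegral_mono (hm (le_max_left i j)))
  · exact iSup_le fun n => le_iSup_of_le n (le_iSup (fun j => ∫⁻ x, F n x ∂(m j)) n)

namespace FinConf

variable {E : Type*} [TopologicalSpace E] [LusinSpace E] [MeasurableSpace E] [BorelSpace E]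
  [Nonempty E]

theorem _root_.IsIncreasingLimit.conv {m m' : ℕ → Measure (FinConf E)} {M M' : Measure (FinConf E)}
    [∀ n, IsFiniteMeasure (m' n)] [IsFiniteMeasure M']
    (h : IsIncreasingLimit m M) (h' : IsIncreasingLimit m' M') :
    IsIncreasingLimit (fun n => (m n).conv (m' n)) (M.conv M') := by
  have := measurableAdd₂ (E := E)
  have hm : ∀ F : FinConf E → ℝ≥0∞, Measurable F →
      Monotone fun n a => ∫⁻ b, F (a + b) ∂(m' n) := fun F hF i j hij a =>
    h'.mono (fun b => F (a + b)) (by fun_prop) hij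
  have hmeas : ∀ F : FinConf E → ℝ≥0∞, Measurable F → ∀ n,
      Measurable fun a => ∫⁻ b, F (a + b) ∂(m' n) := fun F hF n =>
    Measurable.lintegral_prod_right' (f := fun p : FinConf E × FinConf E => F (p.1 + p.2))
      (by fun_prop)
  constructor
  · intro F hF i j hij
    simp_rw [Measure.lintegral_conv hF]
    exact (h.mono _ (hmeas F hF i) hij).trans (lintegral_mono (hm F hF hij))
  · intro F hF
    simp_rw [Measure.lintegral_conv hF]
    rw [← h.lintegral_iSup (hmeas F hF) (hm F hF)]
    exact lintegral_congr fun a => h'.lintegral_eq (fun b => F (a + b)) (by fun_prop)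

/-! ### The branching kernel generated by a kernel from `E` to `Ê` -/

/-- Finite measures on `Ê`, as a monoid under convolution. -/
def ConvMeasure (E : Type*) [TopologicalSpace E] : Type _ :=
  {m : Measure (FinConf E) // IsFiniteMeasure m}

/-- Commutativity makes the product over an unordered configuration well defined. -/
noncomputable instance : CommMonoid (ConvMeasure E) where
  mul m n := ⟨m.1.conv n.1, by have := m.2; have := n.2; infer_instance⟩
  one := ⟨Measure.dirac 0, inferInstance⟩
  mul_assoc a b c := by
    have := measurableAdd₂ (E := E)
    have := a.2; have := b.2; have := c.2
    exact Subtype.ext (Measure.conv_assoc _ _ _)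
  one_mul a := by
    have := measurableAdd₂ (E := E)
    have := a.2
    exact Subtype.ext (Measure.dirac_zero_conv _)
  mul_one a := by
    have := measurableAdd₂ (E := E)
    have := a.2
    exact Subtype.ext (Measure.conv_dirac_zero _)
  mul_comm a b := by
    have := measurableAdd₂ (E := E)
    have := a.2; have := b.2
    exact Subtype.ext (Measure.conv_comm _ _)

/-- A family of finite measures, as a map to the convolution monoid. -/
def toConvMeasure (h : E → Measure (FinConf E)) [∀ x, IsFiniteMeasure (h x)] (x : E) :
    ConvMeasure E := ⟨h x, inferInstance⟩

/-- The convolution product of the measures `h x`, where `x` runs through a configuration. -/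
noncomputable def branchExt (h : E → Measure (FinConf E)) [∀ x, IsFiniteMeasure (h x)]
    (μ : FinConf E) : Measure (FinConf E) :=
  (Multiset.map (toConvMeasure h) μ).prod.1

variable (h : E → Measure (FinConf E)) [∀ x, IsFiniteMeasure (h x)]

instance (μ : FinConf E) : IsFiniteMeasure (branchExt h μ) :=
  (Multiset.map (toConvMeasure h) μ).prod.2

theorem branchExt_zero : branchExt h 0 = Measure.dirac 0 :=
  congrArg Subtype.val (Multiset.prod_zero (M := ConvMeasure E))

theorem branchExt_dirac (x : E) : branchExt h (dirac x) = h x :=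
  congrArg Subtype.val ((congrArg Multiset.prod (Multiset.map_singleton (toConvMeasure h) x)).trans
    (Multiset.prod_singleton (toConvMeasure h x)))

theorem branchExt_add (μ ν : FinConf E) :
    branchExt h (μ + ν) = (branchExt h μ).conv (branchExt h ν) :=
  congrArg Subtype.val ((congrArg Multiset.prod
    (Multiset.map_add (toConvMeasure h) μ ν)).trans (Multiset.prod_add _ _))

theorem measure_univ_conv (m n : Measure (FinConf E)) [SFinite n] :
    m.conv n Set.univ = m Set.univ * n Set.univ := by
  have := measurableAdd₂ (E := E)
  rw [← setLIntegral_one, setLIntegral_univ, Measure.lintegral_conv measurable_const]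
  simp [mul_comm]

theorem branchExt_univ_le_one (h1 : ∀ x, h x Set.univ ≤ 1) (μ : FinConf E) :
    branchExt h μ Set.univ ≤ 1 := by
  induction μ using induction with
  | zero => simp [branchExt_zero]
  | add x μ ih =>
    rw [branchExt_add, branchExt_dirac, measure_univ_conv]
    exact mul_le_one' (h1 x) ih

/-- `mult φ` is a character of the monoid of configurations, so its integral turns convolutions into
products. -/
theorem lintegral_mult_branchExt {φ : E → ℝ≥0∞} (hφ : Measurable φ) (μ : FinConf E) :
    ∫⁻ ν, mult φ ν ∂(branchExt h μ) = mult (fun x => ∫⁻ ν, mult φ ν ∂(h x)) μ := by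
  have := measurableAdd₂ (E := E)
  have hm := measurable_mult hφ
  induction μ using induction with
  | zero => simp [branchExt_zero, lintegral_dirac' _ hm]
  | add x μ ih =>
    rw [branchExt_add, branchExt_dirac, Measure.lintegral_conv hm]
    simp_rw [mult_add, lintegral_const_mul _ hm, lintegral_mul_const _ hm, ih, mult_dirac]

theorem lintegral_lin_conv {f : E → ℝ≥0∞} (hf : Measurable f) (m n : Measure (FinConf E))
    [SFinite n] : ∫⁻ ν, lin f ν ∂(m.conv n) =
      (∫⁻ ν, lin f ν ∂m) * n Set.univ + m Set.univ * ∫⁻ ν, lin f ν ∂n := by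
  have := measurableAdd₂ (E := E)
  have hm := measurable_lin hf
  rw [Measure.lintegral_conv hm]
  simp_rw [lin_add, lintegral_add_right _ hm, lintegral_const]
  rw [lintegral_add_right _ measurable_const, lintegral_mul_const _ hm, lintegral_const, mul_comm
    (∫⁻ ν, lin f ν ∂n)]

/-- Each point contributes its moment times the masses of the other factors, all at most `1`. The
inequality suffices for the Picard iterates, whose masses may be smaller than `1`. -/
theorem lintegral_lin_branchExt_le (h1 : ∀ x, h x Set.univ ≤ 1) {f : E → ℝ≥0∞} (hf : Measurable f)
    (μ : FinConf E) :
    ∫⁻ ν, lin f ν ∂(branchExt h μ) ≤ lin (fun x => ∫⁻ ν, lin f ν ∂(h x)) μ := by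
  induction μ using induction with
  | zero => simp [branchExt_zero, lintegral_dirac' _ (measurable_lin hf)]
  | add x μ ih =>
    rw [branchExt_add, branchExt_dirac, lintegral_lin_conv hf, lin_add, lin_dirac]
    refine add_le_add (mul_le_of_le_one_right' (branchExt_univ_le_one h h1 μ)) ?_
    exact (mul_le_of_le_one_left' (h1 x)).trans ih

theorem isIncreasingLimit_branchExt {m : ℕ → E → Measure (FinConf E)}
    [∀ n x, IsFiniteMeasure (m n x)] (hl : ∀ x, IsIncreasingLimit (fun n => m n x) (h x))
    (μ : FinConf E) : IsIncreasingLimit (fun n => branchExt (m n) μ) (branchExt h μ) := by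
  induction μ using induction with
  | zero =>
    simp only [branchExt_zero]
    exact ⟨fun _ _ => monotone_const, fun _ _ => by simp⟩
  | add x μ ih =>
    simp only [branchExt_add, branchExt_dirac]
    exact (hl x).conv ih

theorem measurable_conv {α : Type*} [MeasurableSpace α] {f g : α → Measure (FinConf E)}
    (hf : Measurable f) (hg : Measurable g) (hf1 : ∀ a, f a Set.univ ≤ 1)
    (hg1 : ∀ a, g a Set.univ ≤ 1) : Measurable fun a => (f a).conv (g a) := by
  have := measurableAdd₂ (E := E)
  let K : Kernel α (FinConf E) := ⟨f, hf⟩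
  let L : Kernel α (FinConf E) := ⟨g, hg⟩
  have : IsFiniteKernel K := ⟨1, ENNReal.one_lt_top, hf1⟩
  have : IsFiniteKernel L := ⟨1, ENNReal.one_lt_top, hg1⟩
  convert ((K ×ₖ L).map fun p => p.1 + p.2).measurable using 2 with a
  rw [Kernel.map_apply _ measurable_add, Kernel.prod_apply]
  rfl

/-- The branching kernel generated by a sub-Markovian kernel, depending on a parameter. -/
noncomputable def branchKernel {Y : Type*} [MeasurableSpace Y] [StandardBorelSpace Y]
    (κ : Kernel (Y × E) (FinConf E)) [IsFiniteKernel κ] (h1 : ∀ p, κ p Set.univ ≤ 1) :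
    Kernel (Y × FinConf E) (FinConf E) where
  toFun p := branchExt (fun x => κ (p.1, x)) p.2
  measurable' := by
    refine measurable_prod_of_ofTuple fun m => ?_
    induction m with
    | zero => simp [ofTuple_zero, branchExt_zero]
    | succ m ih =>
      simp only [ofTuple_succ, branchExt_add, branchExt_dirac]
      refine measurable_conv ?_ ?_ (fun _ => h1 _)
        fun _ => branchExt_univ_le_one _ (fun _ => h1 _) _
      · exact κ.measurable.comp (by fun_prop)
      · exact ih.comp (f := fun p : Y × (Fin (m + 1) → E) => (p.1, fun i : Fin m => p.2 i.succ))
          (by fun_prop)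

end FinConf

/-! ### The exponential of an additive functional -/

/-- `exp(-r)` for `r ∈ [0,∞]`, with `exp(-∞) = 0`. -/
noncomputable def expNeg (r : ℝ≥0∞) : ℝ≥0∞ := EReal.exp (-((r : ℝ≥0∞) : EReal))

theorem measurable_expNeg : Measurable expNeg :=
  (EReal.measurable_exp.comp measurable_neg).comp measurable_coe_ennreal_ereal

theorem continuous_expNeg : Continuous expNeg :=
  (ENNReal.continuous_exp.comp continuous_neg).comp continuous_coe_ennreal_ereal

@[simp] theorem expNeg_zero : expNeg 0 = 1 := by simp [expNeg]

@[simp] theorem expNeg_top : expNeg ∞ = 0 := by simp [expNeg]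

theorem expNeg_add (r s : ℝ≥0∞) : expNeg (r + s) = expNeg r * expNeg s := by
  simp only [expNeg, ← EReal.exp_add, EReal.coe_ennreal_add]
  congr 1
  rw [EReal.neg_add (by simp) (by simp), sub_eq_add_neg]

theorem expNeg_antitone : Antitone expNeg := fun _ _ h =>
  EReal.exp_monotone (EReal.neg_le_neg_iff.2 (EReal.coe_ennreal_le_coe_ennreal_iff.2 h))

theorem expNeg_le_one (r : ℝ≥0∞) : expNeg r ≤ 1 :=
  (expNeg_antitone zero_le).trans expNeg_zero.le

theorem expNeg_ofReal {r : ℝ} (hr : 0 ≤ r) :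
    expNeg (ENNReal.ofReal r) = ENNReal.ofReal (Real.exp (-r)) := by
  rw [expNeg, EReal.coe_ennreal_ofReal, max_eq_left hr, ← EReal.coe_neg, EReal.exp_coe]

theorem expNeg_coe (r : ℝ≥0) : expNeg r = ENNReal.ofReal (Real.exp (-(r : ℝ))) := by
  rw [← expNeg_ofReal r.coe_nonneg, ENNReal.ofReal_coe_nnreal]

/-- The fundamental theorem of calculus for `exp (-∫ a)`, where `a` is bounded and measurable. -/
theorem integral_mul_exp_neg_integral {a : ℝ → ℝ} (ha : Measurable a) {M : ℝ}
    (h0 : ∀ s, 0 ≤ a s) (hM : ∀ s, a s ≤ M) {t : ℝ} (ht : 0 ≤ t) :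
    ∫ r in 0..t, a r * Real.exp (-∫ s in 0..r, a s) = 1 - Real.exp (-∫ s in 0..t, a s) := by
  have hint : ∀ x y, IntervalIntegrable a volume x y := fun x y =>
    (intervalIntegrable_const (c := M)).mono_fun ha.aestronglyMeasurable
      (Eventually.of_forall fun s => by
        simp only [Real.norm_eq_abs]
        exact abs_le_abs_of_nonneg (h0 s) (hM s))
  have hLip : ∀ x y, |(∫ s in 0..x, a s) - ∫ s in 0..y, a s| ≤ M * |x - y| := fun x y => by
    rw [intervalIntegral.integral_interval_sub_left (hint _ _) (hint _ _)]
    exact intervalIntegral.norm_integral_le_of_norm_le_const fun s _ => by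
      rw [Real.norm_eq_abs, abs_of_nonneg (h0 s)]; exact hM s
  have hexp : ∀ u v : ℝ, 0 ≤ u → 0 ≤ v → |Real.exp (-u) - Real.exp (-v)| ≤ |u - v| := by
    have : ∀ u v : ℝ, 0 ≤ u → u ≤ v → |Real.exp (-u) - Real.exp (-v)| ≤ |u - v| :=
      fun u v hu huv => by
        rw [abs_of_nonneg (by simpa using huv), abs_of_nonpos (by linarith)]
        have h1 : Real.exp (-v) = Real.exp (-u) * Real.exp (u - v) := by
          rw [← Real.exp_add]; ring_nf
        have h2 := Real.add_one_le_exp (u - v)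
        have h3 : Real.exp (-u) ≤ 1 := by simpa using hu
        have h4 := Real.exp_pos (-u)
        rw [h1]
        nlinarith
    intro u v hu hv
    rcases le_total u v with h | h
    · exact this u v hu h
    · rw [abs_sub_comm, abs_sub_comm u]; exact this v u hv h
  have hA0 : ∀ x, 0 ≤ x → 0 ≤ ∫ s in 0..x, a s := fun x hx =>
    intervalIntegral.integral_nonneg hx fun s _ => h0 s
  have hM0 : 0 ≤ M := (h0 0).trans (hM 0)
  -- Since `a` is merely measurable, the derivative exists only almost everywhere. The bound on `a`
  -- makes the exponential Lipschitz on `[0,t]`, hence absolutely continuous.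
  have hac : AbsolutelyContinuousOnInterval (fun r => Real.exp (-∫ s in 0..r, a s)) 0 t := by
    refine LipschitzOnWith.absolutelyContinuousOnInterval (K := M.toNNReal)
      (LipschitzOnWith.of_dist_le_mul fun x hx y hy => ?_)
    rw [Set.uIcc_of_le ht] at hx hy
    rw [Real.dist_eq, Real.dist_eq, Real.coe_toNNReal _ hM0]
    exact (hexp _ _ (hA0 x hx.1) (hA0 y hy.1)).trans (hLip x y)
  have hFTC := hac.integral_deriv_eq_sub
  have hderiv : ∫ x in 0..t, deriv (fun r => Real.exp (-∫ s in 0..r, a s)) x =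
      ∫ r in 0..t, -(a r * Real.exp (-∫ s in 0..r, a s)) := by
    refine intervalIntegral.integral_congr_ae ?_
    filter_upwards [(hint 0 t).ae_hasDerivAt_integral] with x hx hxt
    have := (hx (Set.uIoc_subset_uIcc hxt) 0 Set.left_mem_uIcc).neg.exp
    exact this.deriv.trans (by simp [mul_comm])
  rw [hderiv, intervalIntegral.integral_neg] at hFTC
  simp only [intervalIntegral.integral_same, neg_zero, Real.exp_zero] at hFTC
  linarith

/-- Pathwise conservation of mass: the survival probability at `t` plus the integrated killing
density. -/
theorem expNeg_add_lintegral_mul_expNeg {a : ℝ → ℝ≥0} (ha : Measurable a) {M : ℝ≥0}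
    (hM : ∀ s, a s ≤ M) (t : ℝ≥0) :
    expNeg (∫⁻ s in Set.Icc (0 : ℝ) t, a s) +
      ∫⁻ r in Set.Icc (0 : ℝ) t, expNeg (∫⁻ s in Set.Icc (0 : ℝ) r, a s) * a r = 1 := by
  have hint : ∀ x y, IntervalIntegrable (fun s => (a s : ℝ)) volume x y := fun x y =>
    (intervalIntegrable_const (c := (M : ℝ))).mono_fun
      (measurable_coe_nnreal_real.comp ha).aestronglyMeasurable
      (Eventually.of_forall fun s => by
        simp only [Real.norm_eq_abs]
        exact abs_le_abs_of_nonneg (a s).coe_nonneg (hM s))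
  have hA : ∀ r : ℝ, 0 ≤ r → ∫⁻ s in Set.Icc (0 : ℝ) r, (a s : ℝ≥0∞) =
      ENNReal.ofReal (∫ s in 0..r, (a s : ℝ)) := fun r hr => by
    rw [intervalIntegral.integral_of_le hr, ← restrict_Ioc_eq_restrict_Icc,
      ofReal_integral_eq_lintegral_ofReal (hint 0 r).1
        (Eventually.of_forall fun s => (a s).coe_nonneg)]
    simp
  have hA0 : ∀ r : ℝ, 0 ≤ r → 0 ≤ ∫ s in 0..r, (a s : ℝ) := fun x hx =>
    intervalIntegral.integral_nonneg hx fun s _ => (a s).coe_nonneg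
  have ht := t.coe_nonneg
  have key := integral_mul_exp_neg_integral (measurable_coe_nnreal_real.comp ha)
    (fun s => (a s).coe_nonneg) (M := M) (fun s => hM s) ht
  have h2 : ∫⁻ r in Set.Icc (0 : ℝ) t, expNeg (∫⁻ s in Set.Icc (0 : ℝ) r, a s) * a r =
      ENNReal.ofReal (∫ r in 0..(t : ℝ), (a r : ℝ) * Real.exp (-∫ s in 0..r, (a s : ℝ))) := by
    have hcont : Continuous fun r => ∫ s in 0..r, (a s : ℝ) :=
      intervalIntegral.continuous_primitive hint 0
    rw [intervalIntegral.integral_of_le ht, ofReal_integral_eq_lintegral_ofReal,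
      ← restrict_Ioc_eq_restrict_Icc]
    · refine setLIntegral_congr_fun measurableSet_Ioc fun r hr => ?_
      rw [hA r hr.1.le, expNeg_ofReal (hA0 r hr.1.le), ENNReal.ofReal_mul (a r).coe_nonneg,
        ENNReal.ofReal_coe_nnreal, mul_comm]
    · exact ((hint 0 t).mul_continuousOn (by fun_prop)).1
    · exact Eventually.of_forall fun r => mul_nonneg (a r).coe_nonneg (Real.exp_pos _).le
  rw [h2, hA t ht, expNeg_ofReal (hA0 t ht), ← ENNReal.ofReal_add (Real.exp_pos _).le]
  · simp only [Function.comp_apply] at key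
    rw [key]; simp
  · simp only [Function.comp_apply] at key
    rw [key]; simpa using hA0 t ht

/-! ### The law of the trajectories as a kernel -/

namespace BorelRightProcess

section Path

variable {E : Type*} [TopologicalSpace E] [MeasurableSpace E] {Ω : Type*} [MeasurableSpace Ω]
  (X : BorelRightProcess E Ω)

/-- The sample space, equipped with the `σ`-algebra generated by the process. -/
def Path (_ : BorelRightProcess E Ω) : Type _ := Ω

instance : MeasurableSpace X.Path := ⨆ s, MeasurableSpace.comap (X.X s) inferInstance

/-- The trajectories as functions on `X.Path`. -/
def coord (s : ℝ≥0) (ω : X.Path) : E := X.X s ω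

theorem measurable_coord (s : ℝ≥0) : Measurable (X.coord s) :=
  Measurable.mono (comap_measurable (X.X s))
    (le_iSup (fun s => MeasurableSpace.comap (X.X s) inferInstance) s) le_rfl

theorem measurable_X (s : ℝ≥0) : Measurable (X.X s) := (X.adapted s).mono (X.filt.le s) le_rfl

/-- The identity from the sample space to `X.Path`. -/
def toPath (ω : Ω) : X.Path := ω

theorem measurable_toPath : Measurable X.toPath := by
  refine Measurable.of_le_map (iSup_le fun s => ?_)
  rintro _ ⟨A, hA, rfl⟩
  exact X.measurable_X s hA

theorem markov_lintegral (x : E) (s t : ℝ≥0) {G : Set Ω} (hG : MeasurableSet[X.filt s] G)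
    {g : E → ℝ≥0∞} (hg : Measurable g) :
    ∫⁻ ω in G, g (X.X (s + t) ω) ∂(X.P x) =
      ∫⁻ ω in G, ∫⁻ y, g y ∂(X.T t (X.X s ω)) ∂(X.P x) := by
  have hm : ((X.P x).restrict G).map (X.X (s + t)) =
      (((X.P x).restrict G).map (X.X s)).bind (X.T t) := by
    ext A hA
    rw [Measure.map_apply (X.measurable_X _) hA, Measure.bind_apply hA (X.T t).aemeasurable,
      lintegral_map ((X.T t).measurable_coe hA) (X.measurable_X s), Measure.restrict_apply
      (X.measurable_X _ hA), Set.inter_comm, X.markov_property x s t G A hG hA]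
  rw [← lintegral_map hg (X.measurable_X _), hm, Measure.lintegral_bind (X.T t).aemeasurable
    hg.aemeasurable, lintegral_map hg.lintegral_kernel (X.measurable_X s)]

theorem lintegral_start (x : E) {g : E → ℝ≥0∞} : ∫⁻ ω, g (X.X 0 ω) ∂(X.P x) = g x := by
  have := X.prob x
  have h : (fun ω => g (X.X 0 ω)) =ᵐ[X.P x] fun _ => g x :=
    (X.start x).mono fun ω h => congrArg g h
  simp [lintegral_congr_ae h]

theorem lintegral_X (x : E) (t : ℝ≥0) {g : E → ℝ≥0∞} (hg : Measurable g) :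
    ∫⁻ ω, g (X.X t ω) ∂(X.P x) = ∫⁻ y, g y ∂(X.T t x) := by
  have := X.markov_lintegral x 0 t MeasurableSet.univ hg
  rw [zero_add, Measure.restrict_univ] at this
  rw [this]
  exact X.lintegral_start x (g := fun z => ∫⁻ y, g y ∂(X.T t z))

/-- The laws `P^x` are not assumed measurable in `x`. The Markov property at the latest time `a` of
the cylinder replaces `g` by the indicator of `A a` times `T_{r-a} g` and removes `a` from the set
of times. -/
theorem measurable_lintegral_cylinder (A : ℝ≥0 → Set E) (hA : ∀ t, MeasurableSet (A t))
    (I : Finset ℝ≥0) : ∀ r : ℝ≥0, (∀ t ∈ I, t ≤ r) → ∀ g : E → ℝ≥0∞, Measurable g →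
      Measurable fun x => ∫⁻ ω in ⋂ t ∈ I, X.X t ⁻¹' A t, g (X.X r ω) ∂(X.P x) := by
  induction I using Finset.induction_on_max with
  | empty =>
    intro r _ g hg
    simp only [Finset.notMem_empty, Set.iInter_of_empty, Set.iInter_univ, Measure.restrict_univ]
    simp_rw [X.lintegral_X _ r hg]
    exact hg.lintegral_kernel
  | insert a I hI ih =>
    intro r hr g hg
    have ha : a ≤ r := hr a (Finset.mem_insert_self _ _)
    have hmeas : ∀ t ≤ a, MeasurableSet[X.filt a] (X.X t ⁻¹' A t) := fun t ht =>
      X.filt.mono ht _ (X.adapted t (hA t))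
    have hG : MeasurableSet[X.filt a] (⋂ t ∈ I, X.X t ⁻¹' A t) :=
      MeasurableSet.biInter (Finset.countable_toSet I) fun t ht => hmeas t (hI t ht).le
    have hTg : Measurable fun y => ∫⁻ z, g z ∂(X.T (r - a) y) := hg.lintegral_kernel
    convert ih a (fun t ht => (hI t ht).le) _ (hTg.indicator (hA a)) using 2 with x
    rw [Finset.set_biInter_insert, ← add_tsub_cancel_of_le ha,
      X.markov_lintegral x a (r - a) ((hmeas a le_rfl).inter hG) hg, add_tsub_cancel_left,
      ← Measure.restrict_restrict (X.measurable_X a (hA a)),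
      ← lintegral_indicator (X.measurable_X a (hA a))]
    rfl

/-- The law of the process started at `x`, on the `σ`-algebra generated by the process. -/
noncomputable def pathKernel : Kernel E X.Path where
  toFun x := (X.P x).map X.toPath
  measurable' := by
    have := X.prob
    have : ∀ x, IsProbabilityMeasure ((X.P x).map X.toPath) := fun x =>
      Measure.isProbabilityMeasure_map X.measurable_toPath.aemeasurable
    let π : ℝ≥0 → Set (Set X.Path) := fun t =>
      {s | MeasurableSet[MeasurableSpace.comap (X.X t) inferInstance] s}
    refine Measurable.measure_of_isPiSystem_of_isProbabilityMeasure (S := piiUnionInter π Set.univ)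
      ?_ (isPiSystem_piiUnionInter _
        (fun t => @MeasurableSpace.isPiSystem_measurableSet _ (MeasurableSpace.comap (X.X t) _)) _) ?_
    · refine Eq.trans ?_ (generateFrom_piiUnionInter_measurableSet
        (fun t => MeasurableSpace.comap (X.X t) inferInstance) Set.univ).symm
      simp only [Set.mem_univ, iSup_pos]
      rfl
    · rintro _ ⟨I, -, f, hf, rfl⟩
      choose! A hA using hf
      -- The choice of `A` says nothing off `I`; the empty set restores measurability at all times.
      let A' : ℝ≥0 → Set E := fun t => if t ∈ I then A t else ∅
      have hA' : ∀ t, MeasurableSet (A' t) := fun t => by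
        by_cases ht : t ∈ I
        · simpa [A', ht] using (hA t ht).1
        · simp [A', ht]
      have hS : ⋂ t ∈ I, f t = ⋂ t ∈ I, X.coord t ⁻¹' A' t :=
        Set.iInter₂_congr fun t ht => by rw [← (hA t ht).2]; simp [A', ht]; rfl
      have hSm : MeasurableSet (⋂ t ∈ I, X.coord t ⁻¹' A' t) :=
        MeasurableSet.biInter (Finset.countable_toSet I) fun t _ => X.measurable_coord t (hA' t)
      obtain ⟨r, hr⟩ := I.exists_le
      convert X.measurable_lintegral_cylinder A' hA' I r hr 1 measurable_one using 2 with x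
      rw [hS, Measure.map_apply X.measurable_toPath hSm]
      simp only [Pi.one_apply, lintegral_one, Measure.restrict_apply_univ]
      rfl

instance : IsMarkovKernel X.pathKernel :=
  ⟨fun x => by
    have := X.prob x
    exact Measure.isProbabilityMeasure_map X.measurable_toPath.aemeasurable⟩

theorem lintegral_pathKernel (x : E) {F : X.Path → ℝ≥0∞} (hF : Measurable F) :
    ∫⁻ ω, F ω ∂(X.pathKernel x) = ∫⁻ ω, F (X.toPath ω) ∂(X.P x) :=
  lintegral_map hF X.measurable_toPath

/-- The weight `exp(-∫₀^t c(X_s) ds)`. -/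
noncomputable def weight (c : E → ℝ≥0) (t : ℝ≥0) (ω : X.Path) : ℝ≥0∞ :=
  expNeg (∫⁻ s in Set.Icc (0 : ℝ) t, (c (X.coord s.toNNReal ω) : ℝ≥0∞))

theorem killed_eq (c : E → ℝ≥0) (t : ℝ≥0) (f : E → ℝ≥0∞) (x : E) :
    X.killed c t f x = ∫⁻ ω, X.weight c t (X.toPath ω) * f (X.X t ω) ∂(X.P x) := rfl

variable {c : E → ℝ≥0}

theorem killed_mono {f g : E → ℝ≥0∞} (h : ∀ y, f y ≤ g y) (t : ℝ≥0) (x : E) :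
    X.killed c t f x ≤ X.killed c t g x :=
  lintegral_mono fun _ => mul_le_mul_right (h _) _

theorem killed_le_of_bound {f : E → ℝ≥0∞} {M : ℝ≥0∞} (h : ∀ y, f y ≤ M) (t : ℝ≥0) (x : E) :
    X.killed c t f x ≤ M := by
  have := X.prob x
  calc X.killed c t f x ≤ ∫⁻ _, 1 * M ∂(X.P x) :=
        lintegral_mono fun _ => mul_le_mul' (expNeg_le_one _) (h _)
    _ = M := by simp

end Path

/-! ### The Feynman-Kac semigroup as a kernel -/

section Killed

variable {E : Type*} [TopologicalSpace E] [LusinSpace E] [MeasurableSpace E] [BorelSpace E]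
  {Ω : Type*} [MeasurableSpace Ω] (X : BorelRightProcess E Ω)

/-- By right continuity the process is the limit of its values at the grid times `(⌊(n+1)s⌋ +
1)/(n+1)`, which approach `s` from the right and take countably many values for each `n`. -/
theorem measurable_uncurry_coord : Measurable fun p : ℝ≥0 × X.Path => X.coord p.1 p.2 := by
  have := LusinSpace.metrizableSpace E
  let g : ℕ → ℕ → ℝ≥0 := fun n k => ((k + 1 : ℕ) : ℝ≥0) / (n + 1 : ℝ≥0)
  let q : ℕ → ℝ≥0 → ℝ≥0 := fun n s => g n ⌊(n + 1 : ℝ≥0) * s⌋₊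
  refine measurable_of_tendsto_metrizable
    (f := fun n (p : ℝ≥0 × X.Path) => X.coord (q n p.1) p.2) (fun n => ?_) ?_
  · have h : Measurable fun p : ℕ × X.Path => X.coord (g n p.1) p.2 :=
      measurable_from_prod_countable_right fun k => X.measurable_coord (g n k)
    have h1 : Measurable fun p : ℝ≥0 × X.Path => (⌊(n + 1 : ℝ≥0) * p.1⌋₊, p.2) :=
      (Nat.measurable_floor.comp (measurable_fst.const_mul (n + 1 : ℝ≥0))).prodMk measurable_snd
    exact Measurable.comp (f := fun p : ℝ≥0 × X.Path => (⌊(n + 1 : ℝ≥0) * p.1⌋₊, p.2)) h h1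
  · refine tendsto_pi_nhds.2 fun p => ?_
    have hle : ∀ n, p.1 ≤ q n p.1 := fun n => by
      simp only [q, g]
      rw [le_div_iff₀ (by positivity), mul_comm]
      exact_mod_cast (Nat.lt_floor_add_one _).le
    have hub : ∀ n, q n p.1 ≤ p.1 + 1 / ((n : ℝ≥0) + 1) := fun n => by
      simp only [q, g]
      have hn : (n + 1 : ℝ≥0) ≠ 0 := by positivity
      rw [div_le_iff₀ (by positivity), show (p.1 + 1 / ((n : ℝ≥0) + 1)) * ((n : ℝ≥0) + 1) =
        (n + 1 : ℝ≥0) * p.1 + 1 by field_simp]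
      push_cast
      gcongr
      exact Nat.floor_le zero_le
    have hlim : Tendsto (fun n : ℕ => p.1 + 1 / ((n : ℝ≥0) + 1)) atTop (𝓝 p.1) := by
      simpa using (tendsto_one_div_add_atTop_nhds_zero_nat (𝕜 := ℝ≥0)).const_add p.1
    have hq : Tendsto (fun n => q n p.1) atTop (𝓝[Set.Ici p.1] p.1) :=
      tendsto_nhdsWithin_iff.2 ⟨tendsto_of_tendsto_of_tendsto_of_le_of_le tendsto_const_nhds hlim
        hle hub, Eventually.of_forall hle⟩
    exact (X.right_continuous p.2 p.1).tendsto.comp hq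

variable {c : E → ℝ≥0} (hc : Measurable c)

include hc in
theorem measurable_weight : Measurable fun p : ℝ≥0 × X.Path => X.weight c p.1 p.2 := by
  refine measurable_expNeg.comp ?_
  simp_rw [← lintegral_indicator measurableSet_Icc]
  refine Measurable.lintegral_prod_right' (f := fun q : (ℝ≥0 × X.Path) × ℝ =>
    (Set.Icc (0 : ℝ) q.1.1).indicator (fun s => (c (X.coord s.toNNReal q.1.2) : ℝ≥0∞)) q.2) ?_
  have hset : MeasurableSet {q : (ℝ≥0 × X.Path) × ℝ | q.2 ∈ Set.Icc (0 : ℝ) q.1.1} :=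
    (measurableSet_le measurable_const measurable_snd).inter
      (measurableSet_le measurable_snd
        (measurable_coe_nnreal_real.comp (measurable_fst.comp measurable_fst)))
  have hf : Measurable fun q : (ℝ≥0 × X.Path) × ℝ => (c (X.coord q.2.toNNReal q.1.2) : ℝ≥0∞) :=
    measurable_coe_nnreal_ennreal.comp (hc.comp (X.measurable_uncurry_coord.comp
      ((measurable_real_toNNReal.comp measurable_snd).prodMk (measurable_snd.comp measurable_fst))))
  exact hf.indicator hset

/-- The Feynman-Kac semigroup as a kernel, jointly in time and space. -/
noncomputable def killedKernel : Kernel (ℝ≥0 × E) E where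
  toFun p := ((X.pathKernel p.2).withDensity (X.weight c p.1)).map (X.coord p.1)
  measurable' := by
    refine Measure.measurable_of_measurable_coe _ fun A hA => ?_
    have hw : ∀ t, Measurable (X.weight c t) := fun t =>
      (X.measurable_weight hc).comp measurable_prodMk_left
    have h1 : ∀ p : ℝ≥0 × E, ((X.pathKernel p.2).withDensity (X.weight c p.1)).map (X.coord p.1) A
        = ∫⁻ ω, X.weight c p.1 ω * A.indicator 1 (X.coord p.1 ω)
          ∂((X.pathKernel.comap Prod.snd measurable_snd : Kernel (ℝ≥0 × E) X.Path) p) := fun p => by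
      rw [← lintegral_indicator_one hA, lintegral_map (measurable_one.indicator hA)
        (X.measurable_coord _), lintegral_withDensity_eq_lintegral_mul _ (hw _)
        (g := fun ω => A.indicator 1 (X.coord p.1 ω))
        ((measurable_one.indicator hA).comp (X.measurable_coord _))]
      rfl
    simp_rw [h1]
    refine Measurable.lintegral_kernel_prod_right (f := fun (p : ℝ≥0 × E) ω =>
      X.weight c p.1 ω * A.indicator 1 (X.coord p.1 ω)) ?_
    have hp : Measurable fun q : (ℝ≥0 × E) × X.Path => (q.1.1, q.2) := by fun_prop
    exact ((X.measurable_weight hc).comp hp).mul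
      ((measurable_one.indicator hA).comp (X.measurable_uncurry_coord.comp hp))

theorem lintegral_killedKernel (t : ℝ≥0) (x : E) {f : E → ℝ≥0∞} (hf : Measurable f) :
    ∫⁻ y, f y ∂(X.killedKernel hc (t, x)) = X.killed c t f x := by
  have hw : Measurable (X.weight c t) := (X.measurable_weight hc).comp measurable_prodMk_left
  have : X.killedKernel hc (t, x) =
    ((X.pathKernel x).withDensity (X.weight c t)).map (X.coord t) := rfl
  rw [this, lintegral_map hf (X.measurable_coord t)]
  refine (lintegral_withDensity_eq_lintegral_mul (X.pathKernel x) hw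
    (hf.comp (X.measurable_coord t))).trans ?_
  rw [X.lintegral_pathKernel x (hw.mul (hf.comp (X.measurable_coord t)))]
  rfl

include hc in
/-- The process is killed before time `t` or alive at time `t`. -/
theorem killed_one_add_lintegral {M : ℝ≥0} (hM : ∀ x, c x ≤ M) (t : ℝ≥0) (x : E) :
    X.killed c t (fun _ => 1) x +
      ∫⁻ s in Set.Icc (0 : ℝ) t, X.killed c (t - s.toNNReal) (fun y => c y) x = 1 := by
  have := X.prob x
  -- Reflection `s ↦ t - s` of the interval, so that the killing density is evaluated at its own
  -- time.
  have hsub : ∫⁻ s in Set.Icc (0 : ℝ) t, X.killed c (t - s.toNNReal) (fun y => c y) x =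
      ∫⁻ s in Set.Icc (0 : ℝ) t, X.killed c s.toNNReal (fun y => c y) x := by
    rw [← lintegral_indicator measurableSet_Icc, ← lintegral_indicator measurableSet_Icc,
      ← lintegral_sub_left_eq_self _ (t : ℝ)]
    refine lintegral_congr fun s => ?_
    by_cases hs : s ∈ Set.Icc (0 : ℝ) t
    · have hs' : (t : ℝ) - s ∈ Set.Icc (0 : ℝ) t := ⟨by linarith [hs.2], by linarith [hs.1]⟩
      rw [Set.indicator_of_mem hs, Set.indicator_of_mem hs']
      congr 1
      apply NNReal.eq
      rw [NNReal.coe_sub (Real.toNNReal_le_iff_le_coe.2 hs'.2)]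
      rw [Real.coe_toNNReal _ hs'.1, Real.coe_toNNReal _ hs.1]
      ring
    · have hs' : (t : ℝ) - s ∉ Set.Icc (0 : ℝ) t := fun h =>
        hs ⟨by linarith [h.2], by linarith [h.1]⟩
      rw [Set.indicator_of_notMem hs, Set.indicator_of_notMem hs']
  have hjm : Measurable fun p : ℝ × X.Path =>
      X.weight c p.1.toNNReal p.2 * c (X.coord p.1.toNNReal p.2) := by
    have hp : Measurable fun p : ℝ × X.Path => (p.1.toNNReal, p.2) := by fun_prop
    exact ((X.measurable_weight hc).comp hp).mul
      (measurable_coe_nnreal_ennreal.comp (hc.comp (X.measurable_uncurry_coord.comp hp)))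
  have hjm' : Measurable fun p : ℝ × Ω =>
      X.weight c p.1.toNNReal (X.toPath p.2) * c (X.X p.1.toNNReal p.2) :=
    hjm.comp (measurable_fst.prodMk (X.measurable_toPath.comp measurable_snd))
  have hswap : ∫⁻ s in Set.Icc (0 : ℝ) t, X.killed c s.toNNReal (fun y => c y) x =
      ∫⁻ ω, (∫⁻ s in Set.Icc (0 : ℝ) t,
        X.weight c s.toNNReal (X.toPath ω) * c (X.X s.toNNReal ω)) ∂(X.P x) := by
    simp_rw [killed_eq]
    exact lintegral_lintegral_swap hjm'.aemeasurable
  rw [hsub, hswap, killed_eq]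
  rw [← lintegral_add_right _ (Measurable.lintegral_prod_left' hjm')]
  have h1 : ∀ ω, X.weight c t (X.toPath ω) * 1 + ∫⁻ s in Set.Icc (0 : ℝ) t,
      X.weight c s.toNNReal (X.toPath ω) * c (X.X s.toNNReal ω) = 1 := fun ω => by
    have hm : Measurable fun s : ℝ => c (X.X s.toNNReal ω) :=
      hc.comp (X.measurable_uncurry_coord.comp (measurable_real_toNNReal.prodMk measurable_const :
        Measurable fun s : ℝ => (s.toNNReal, X.toPath ω)))
    rw [mul_one, ← expNeg_add_lintegral_mul_expNeg hm (fun s => hM _) t]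
    congr 1
    refine setLIntegral_congr_fun measurableSet_Icc fun s hs => ?_
    simp only [weight, Real.coe_toNNReal _ hs.1]
    rfl
  simp_rw [h1]
  simp

include hc in
theorem killed_add_const (b t : ℝ≥0) (f : E → ℝ≥0∞) (hf : Measurable f) (x : E) :
    X.killed (fun y => c y + b) t f x =
      ENNReal.ofReal (Real.exp (-((b : ℝ) * t))) * X.killed c t f x := by
  have hw : Measurable fun ω => X.weight c t (X.toPath ω) * f (X.X t ω) :=
    (((X.measurable_weight hc).comp measurable_prodMk_left).comp X.measurable_toPath).mul
      (hf.comp (X.measurable_X t))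
  rw [killed_eq, killed_eq, ← lintegral_const_mul _ hw]
  refine lintegral_congr fun ω => ?_
  rw [← mul_assoc]
  congr 1
  simp only [weight, ENNReal.coe_add]
  rw [lintegral_add_right _ measurable_const, expNeg_add, mul_comm]
  congr 1
  have : ∫⁻ _ in Set.Icc (0 : ℝ) t, (b : ℝ≥0∞) = ((b * t : ℝ≥0) : ℝ≥0∞) := by simp
  rw [this, expNeg_coe]
  simp

end Killed

end BorelRightProcess

namespace BorelRightProcess

/-! ### The Duhamel operator and uniqueness -/

section Duhamel

variable {E : Type*} [TopologicalSpace E] [MeasurableSpace E] {Ω : Type*} [MeasurableSpace Ω]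
  (X : BorelRightProcess E Ω)

/-- The operator `g ↦ ∫₀^t T^c_{t-s} g_s ds`. -/
noncomputable def duhamel (c : E → ℝ≥0) (g : ℝ≥0 → E → ℝ≥0∞) (t : ℝ≥0) (x : E) : ℝ≥0∞ :=
  ∫⁻ s in Set.Icc (0 : ℝ) t, X.killed c (t - s.toNNReal) (g s.toNNReal) x

theorem duhamel_mono (c : E → ℝ≥0) {g g' : ℝ≥0 → E → ℝ≥0∞} (h : ∀ s y, g s y ≤ g' s y) (t : ℝ≥0)
    (x : E) : X.duhamel c g t x ≤ X.duhamel c g' t x :=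
  lintegral_mono fun s => X.killed_mono (h s.toNNReal) _ _

/-- A bounded solution of the linear homogeneous inequality vanishes. -/
theorem eq_zero_of_le_duhamel {B : Kernel E (FinConf E)} {β₁ M K : ℝ≥0} {a k : E → ℝ≥0}
    (hlin : Measurable (FinConf.lin (E := E) fun _ => 1))
    (hβ₁ : ∀ x, ∫⁻ μ, FinConf.lin (fun _ => 1) μ ∂(B x) ≤ β₁) (hM : ∀ x, a x ≤ M)
    {w : ℝ≥0 → E → ℝ≥0∞} (hK : ∀ t x, w t x ≤ K)
    (hw : ∀ t x, w t x ≤ X.duhamel k (fun s y => a y * ∫⁻ μ, FinConf.lin (w s) μ ∂(B y)) t x)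
    (t : ℝ≥0) (x : E) : w t x = 0 := by
  -- Iterating the inequality `n` times, as in Gronwall's lemma. Only upper bounds of integrals
  -- enter, so `w` need not be measurable.
  have bound : ∀ n : ℕ, ∀ t x,
      w t x ≤ ENNReal.ofReal (K * ((M * β₁ * t : ℝ) ^ n / n.factorial)) := by
    intro n
    induction n with
    | zero => simpa using hK
    | succ n ih =>
      intro t x
      refine (hw t x).trans ?_
      let b : ℝ → ℝ := fun s => M * β₁ * (K * ((M * β₁ * s : ℝ) ^ n / n.factorial))
      have hb : ∀ s : ℝ, 0 ≤ s → 0 ≤ b s := fun s hs => by positivity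
      have hle : ∀ s : ℝ, 0 ≤ s → ∀ y,
          (a y : ℝ≥0∞) * ∫⁻ μ, FinConf.lin (w s.toNNReal) μ ∂(B y) ≤ ENNReal.ofReal (b s) := by
        intro s hs y
        calc (a y : ℝ≥0∞) * ∫⁻ μ, FinConf.lin (w s.toNNReal) μ ∂(B y)
            ≤ M * ∫⁻ μ, ENNReal.ofReal (K * ((M * β₁ * s : ℝ) ^ n / n.factorial)) *
                FinConf.lin (fun _ => 1) μ ∂(B y) := by
              gcongr with μ
              · exact hM y
              · refine FinConf.lin_le_of_bound (fun z => ?_) μ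
                simpa [Real.coe_toNNReal _ hs] using ih s.toNNReal z
          _ ≤ M * (ENNReal.ofReal (K * ((M * β₁ * s : ℝ) ^ n / n.factorial)) * β₁) := by
              rw [lintegral_const_mul _ hlin]
              gcongr
              exact hβ₁ y
          _ = ENNReal.ofReal (b s) := by
              simp only [b]
              rw [mul_comm (ENNReal.ofReal _), ← mul_assoc,
                ENNReal.ofReal_mul (p := (M : ℝ) * β₁) (by positivity),
                ENNReal.ofReal_mul (p := (M : ℝ)) (by positivity), ENNReal.ofReal_coe_nnreal,
                ENNReal.ofReal_coe_nnreal]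
      have ht := t.coe_nonneg
      have hcont : Continuous b := by fun_prop
      calc X.duhamel k _ t x ≤ ∫⁻ s in Set.Icc (0 : ℝ) t, ENNReal.ofReal (b s) :=
            setLIntegral_mono' measurableSet_Icc fun s hs => X.killed_le_of_bound (hle s hs.1) _ _
        _ = ENNReal.ofReal (∫ s in (0 : ℝ)..t, b s) := by
            rw [intervalIntegral.integral_of_le ht, ← restrict_Ioc_eq_restrict_Icc,
              ofReal_integral_eq_lintegral_ofReal (hcont.intervalIntegrable 0 t).1]
            filter_upwards [self_mem_ae_restrict measurableSet_Ioc] with s hs using hb s hs.1.le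
        _ = _ := by
            congr 1
            have : ∀ s, b s = (M * β₁ * K * (M * β₁ : ℝ) ^ n / n.factorial) * s ^ n := fun s => by
              simp only [b, mul_pow]; ring
            simp_rw [this, intervalIntegral.integral_const_mul, integral_pow, Nat.factorial_succ]
            push_cast
            have h1 : (n.factorial : ℝ) ≠ 0 := by positivity
            have h2 : (n + 1 : ℝ) ≠ 0 := by positivity
            field_simp
            ring
  have hlim : Tendsto (fun n : ℕ => ENNReal.ofReal (K * ((M * β₁ * t : ℝ) ^ n / n.factorial)))
      atTop (𝓝 0) := by
    have := (FloorSemiring.tendsto_pow_div_factorial_atTop (M * β₁ * t : ℝ)).const_mul (K : ℝ)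
    simpa using ENNReal.tendsto_ofReal this
  exact le_antisymm (ge_of_tendsto' hlim fun n => bound n t x) zero_le

theorem measurable_branching {E : Type*} [TopologicalSpace E] [MeasurableSpace E]
    {c : E → ℝ≥0} (hc : Measurable c) (B : Kernel E (FinConf E)) [IsFiniteKernel B]
    {F : ℝ≥0 × FinConf E → ℝ≥0∞} (hF : Measurable F) :
    Measurable (Function.uncurry fun (s : ℝ≥0) y => (c y : ℝ≥0∞) * ∫⁻ μ, F (s, μ) ∂(B y)) := by
  have h : Measurable fun p : ℝ≥0 × E => ∫⁻ μ, F (p.1, μ) ∂(B.comap Prod.snd measurable_snd p) :=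
    Measurable.lintegral_kernel_prod_right (f := fun (p : ℝ≥0 × E) μ => F (p.1, μ))
      (hF.comp (by fun_prop))
  exact (measurable_coe_nnreal_ennreal.comp (hc.comp measurable_snd)).mul h

end Duhamel

section Uniqueness

variable {E : Type*} [TopologicalSpace E] [LusinSpace E] [MeasurableSpace E] [BorelSpace E]
  {Ω : Type*} [MeasurableSpace Ω] (X : BorelRightProcess E Ω) {c : E → ℝ≥0} (hc : Measurable c)

instance : IsFiniteKernel (X.killedKernel hc) := by
  refine ⟨1, ENNReal.one_lt_top, fun p => ?_⟩
  rw [← lintegral_one, X.lintegral_killedKernel hc p.1 p.2 measurable_const]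
  exact X.killed_le_of_bound (fun _ => le_rfl) _ _

include hc

theorem killed_add (t : ℝ≥0) (x : E) {f g : E → ℝ≥0∞} (hf : Measurable f) (hg : Measurable g) :
    X.killed c t (fun y => f y + g y) x = X.killed c t f x + X.killed c t g x := by
  rw [← X.lintegral_killedKernel hc t x hf, ← X.lintegral_killedKernel hc t x hg,
    ← lintegral_add_left hf]
  exact (X.lintegral_killedKernel hc t x (hf.add hg)).symm

theorem killed_const_mul (t : ℝ≥0) (x : E) (a : ℝ≥0∞) {f : E → ℝ≥0∞} (hf : Measurable f) :
    X.killed c t (fun y => a * f y) x = a * X.killed c t f x := by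
  rw [← X.lintegral_killedKernel hc t x hf, ← X.lintegral_killedKernel hc t x (hf.const_mul a),
    lintegral_const_mul _ hf]

theorem killed_iSup (t : ℝ≥0) (x : E) {f : ℕ → E → ℝ≥0∞} (hf : ∀ n, Measurable (f n))
    (hm : Monotone f) : X.killed c t (fun y => ⨆ n, f n y) x = ⨆ n, X.killed c t (f n) x := by
  rw [← X.lintegral_killedKernel hc t x (Measurable.iSup hf), lintegral_iSup hf hm]
  exact iSup_congr fun n => X.lintegral_killedKernel hc t x (hf n)

theorem measurable_killed {α : Type*} [MeasurableSpace α] {τ : α → ℝ≥0} {ξ : α → E}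
    {g : α → E → ℝ≥0∞} (hτ : Measurable τ) (hξ : Measurable ξ)
    (hg : Measurable (Function.uncurry g)) :
    Measurable fun a => X.killed c (τ a) (g a) (ξ a) := by
  have h : ∀ a, X.killed c (τ a) (g a) (ξ a) =
      ∫⁻ y, g a y ∂((X.killedKernel hc).comap (fun a => (τ a, ξ a)) (hτ.prodMk hξ) a) := fun a =>
    (X.lintegral_killedKernel hc _ _ hg.of_uncurry_left).symm
  simp_rw [h]
  exact hg.lintegral_kernel_prod_right

theorem measurable_killed_duhamel {g : ℝ≥0 → E → ℝ≥0∞} (hg : Measurable (Function.uncurry g)) :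
    Measurable fun q : (ℝ≥0 × E) × ℝ => X.killed c (q.1.1 - q.2.toNNReal) (g q.2.toNNReal) q.1.2 :=
  X.measurable_killed hc (by fun_prop) (by fun_prop)
    (hg.comp (by fun_prop : Measurable fun r : ((ℝ≥0 × E) × ℝ) × E => (r.1.2.toNNReal, r.2)))

theorem measurable_killed_time {g : ℝ≥0 → E → ℝ≥0∞} (hg : Measurable (Function.uncurry g))
    (t : ℝ≥0) (x : E) :
    Measurable fun s : ℝ => X.killed c (t - s.toNNReal) (g s.toNNReal) x :=
  (X.measurable_killed_duhamel hc hg).comp (measurable_prodMk_left (x := (t, x)))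

theorem duhamel_add {g g' : ℝ≥0 → E → ℝ≥0∞} (hg : Measurable (Function.uncurry g))
    (hg' : ∀ s, Measurable (g' s)) (t : ℝ≥0) (x : E) :
    X.duhamel c (fun s y => g s y + g' s y) t x = X.duhamel c g t x + X.duhamel c g' t x := by
  simp only [duhamel]
  simp_rw [fun s : ℝ => X.killed_add hc (t - s.toNNReal) x
    (hg.of_uncurry_left (x := s.toNNReal)) (hg' s.toNNReal)]
  exact lintegral_add_left (X.measurable_killed_time hc hg t x) _

theorem duhamel_iSup {g : ℕ → ℝ≥0 → E → ℝ≥0∞} (hg : ∀ n, Measurable (Function.uncurry (g n)))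
    (hm : Monotone g) (t : ℝ≥0) (x : E) :
    X.duhamel c (fun s y => ⨆ n, g n s y) t x = ⨆ n, X.duhamel c (g n) t x := by
  simp only [duhamel]
  simp_rw [fun s : ℝ => X.killed_iSup hc (t - s.toNNReal) x
    (fun n => (hg n).of_uncurry_left (x := s.toNNReal)) fun i j hij => hm hij s.toNNReal]
  exact lintegral_iSup (fun n => X.measurable_killed_time hc (hg n) t x) fun i j hij s =>
    X.killed_mono (fun y => hm hij s.toNNReal y) _ _

/-- Extra killing at constant rate `b` multiplies by an exponential, and `exp (-b(t-s)) * exp (-bs)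
= exp (-bt)`. This passes from the rate `c` to the rate `c + β₁`. -/
theorem duhamel_exp (b : ℝ≥0) {g : ℝ≥0 → E → ℝ≥0∞} (hg : Measurable (Function.uncurry g))
    (t : ℝ≥0) (x : E) :
    X.duhamel (fun y => c y + b)
        (fun s y => ENNReal.ofReal (Real.exp (-((b : ℝ) * s))) * g s y) t x =
      ENNReal.ofReal (Real.exp (-((b : ℝ) * t))) * X.duhamel c g t x := by
  simp only [duhamel]
  rw [← lintegral_const_mul _ (X.measurable_killed_time hc hg t x)]
  refine setLIntegral_congr_fun measurableSet_Icc fun s hs => ?_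
  have hgs : Measurable (g s.toNNReal) := hg.of_uncurry_left
  have hst : s.toNNReal ≤ t := Real.toNNReal_le_iff_le_coe.2 hs.2
  rw [X.killed_add_const hc b _ _ (hgs.const_mul _), X.killed_const_mul hc _ _ _ hgs, ← mul_assoc,
    ← ENNReal.ofReal_mul (Real.exp_pos _).le, ← Real.exp_add, NNReal.coe_sub hst]
  ring_nf

variable [Nonempty E] (B : Kernel E (FinConf E)) [IsFiniteKernel B] {β₁ M : ℝ≥0}
  (hβ₁ : ∀ x, ∫⁻ μ, FinConf.lin (fun _ => 1) μ ∂(B x) ≤ β₁) (hM : ∀ x, c x ≤ M)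

include hβ₁ hM

/-- Comparison of two solutions of the nonlinear equation. -/
theorem le_of_branching_equation {φ : E → ℝ≥0∞} {h h' : ℝ≥0 → E → ℝ≥0∞}
    (hm' : Measurable (Function.uncurry h')) (hm : Measurable (Function.uncurry h))
    (h1 : ∀ t x, h t x ≤ 1) (h1' : ∀ t x, h' t x ≤ 1)
    (he : ∀ t x, h t x = X.killed c t φ x +
      X.duhamel c (fun s y => c y * ∫⁻ μ, FinConf.mult (h s) μ ∂(B y)) t x)
    (he' : ∀ t x, h' t x = X.killed c t φ x +
      X.duhamel c (fun s y => c y * ∫⁻ μ, FinConf.mult (h' s) μ ∂(B y)) t x)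
    (t : ℝ≥0) (x : E) : h t x ≤ h' t x := by
  -- The truncated difference `h - h'` stands in for an absolute value: it vanishes exactly when `h
  -- ≤ h'`, and exchanging the solutions gives equality.
  have hw := X.eq_zero_of_le_duhamel (K := 1) (k := c)
    (FinConf.measurable_lin measurable_const) hβ₁ hM (w := fun t x => h t x - h' t x)
    (fun t x => by simpa using tsub_le_self.trans (h1 t x)) ?_ t x
  · exact tsub_eq_zero_iff_le.1 hw
  · intro t x
    rw [tsub_le_iff_left]
    have hlin := measurable_branching hc B
      (FinConf.measurable_prod_lin (f := fun s x => h s x - h' s x) (hm.sub hm'))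
    have hmult := measurable_branching hc B (FinConf.measurable_prod_mult hm')
    conv_rhs => rw [he' t x]
    rw [he t x, add_assoc, ← X.duhamel_add hc hmult fun s => hlin.of_uncurry_left]
    gcongr
    refine X.duhamel_mono c (fun s y => ?_) t x
    rw [← mul_add, ← lintegral_add_left (FinConf.measurable_mult hm'.of_uncurry_left)]
    gcongr with μ
    exact FinConf.mult_le_mult_add_lin (h1 s) (h1' s) μ

/-- Comparison of two bounded solutions of the linear equation. -/
theorem le_of_linear_equation {k : E → ℝ≥0} (hk : Measurable k) {f : E → ℝ≥0∞} {K : ℝ≥0}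
    {h h' : ℝ≥0 → E → ℝ≥0∞} (hm' : Measurable (Function.uncurry h'))
    (hm : Measurable (Function.uncurry h)) (h1 : ∀ t x, h t x ≤ K)
    (he : ∀ t x, h t x = X.killed k t f x +
      X.duhamel k (fun s y => c y * ∫⁻ μ, FinConf.lin (h s) μ ∂(B y)) t x)
    (he' : ∀ t x, h' t x = X.killed k t f x +
      X.duhamel k (fun s y => c y * ∫⁻ μ, FinConf.lin (h' s) μ ∂(B y)) t x)
    (t : ℝ≥0) (x : E) : h t x ≤ h' t x := by
  have hw := X.eq_zero_of_le_duhamel (K := K) (k := k)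
    (FinConf.measurable_lin measurable_const) hβ₁ hM (w := fun t x => h t x - h' t x)
    (fun t x => tsub_le_self.trans (h1 t x)) ?_ t x
  · exact tsub_eq_zero_iff_le.1 hw
  · intro t x
    rw [tsub_le_iff_left]
    have hlin := measurable_branching hc B
      (FinConf.measurable_prod_lin (f := fun s x => h s x - h' s x) (hm.sub hm'))
    have hlin' := measurable_branching hc B (FinConf.measurable_prod_lin hm')
    conv_rhs => rw [he' t x]
    rw [he t x, add_assoc, ← X.duhamel_add hk hlin' fun s => hlin.of_uncurry_left]
    gcongr
    refine X.duhamel_mono k (fun s y => ?_) t x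
    rw [← mul_add, ← lintegral_add_left (FinConf.measurable_lin hm'.of_uncurry_left)]
    gcongr with μ
    rw [← FinConf.lin_add_fun]
    exact FinConf.lin_mono (fun z => le_add_tsub) μ

end Uniqueness

end BorelRightProcess

/-- A sub-Markovian kernel. -/
structure SubMarkovKernel (α β : Type*) [MeasurableSpace α] [MeasurableSpace β] where
  /-- the underlying kernel -/
  kernel : Kernel α β
  le_one : ∀ a, kernel a Set.univ ≤ 1

instance {α β : Type*} [MeasurableSpace α] [MeasurableSpace β] (κ : SubMarkovKernel α β) :
    IsFiniteKernel κ.kernel := ⟨1, ENNReal.one_lt_top, κ.le_one⟩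

/-! ### Existence by Picard iteration -/

namespace BorelRightProcess

section Existence

open FinConf

variable {E : Type*} [TopologicalSpace E] [LusinSpace E] [MeasurableSpace E] [BorelSpace E]
  [Nonempty E] {Ω : Type*} [MeasurableSpace Ω] (X : BorelRightProcess E Ω) {c : E → ℝ≥0}
  (hc : Measurable c) (B : Kernel E (FinConf E)) [IsMarkovKernel B]

/-- The offspring of a particle dying in `y` at time `s` evolve according to `κ_s`. -/
noncomputable def offspringKernel (κ : SubMarkovKernel (ℝ≥0 × E) (FinConf E)) :
    Kernel (ℝ≥0 × E) (FinConf E) :=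
  branchKernel κ.kernel κ.le_one ∘ₖ
    (Kernel.deterministic Prod.fst measurable_fst ×ₖ B.comap Prod.snd measurable_snd)

theorem lintegral_offspringKernel (κ : SubMarkovKernel (ℝ≥0 × E) (FinConf E)) (s : ℝ≥0) (y : E)
    {F : FinConf E → ℝ≥0∞} (hF : Measurable F) :
    ∫⁻ μ, F μ ∂(offspringKernel B κ (s, y)) =
      ∫⁻ ν, ∫⁻ μ, F μ ∂(branchExt (fun z => κ.kernel (s, z)) ν) ∂(B y) := by
  rw [offspringKernel, Kernel.lintegral_comp _ _ _ hF,
    Kernel.lintegral_deterministic_prod _ _ _ hF.lintegral_kernel]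
  rfl

/-- The contribution of the first branching event at a given time. -/
noncomputable def firstBranchingKernel (κ : SubMarkovKernel (ℝ≥0 × E) (FinConf E)) :
    Kernel ((ℝ≥0 × E) × ℝ) (FinConf E) :=
  offspringKernel B κ ∘ₖ
    (Kernel.deterministic (fun q : (ℝ≥0 × E) × ℝ => q.2.toNNReal) (by fun_prop) ×ₖ
      Kernel.withDensity ((X.killedKernel hc).comap
        (fun q : (ℝ≥0 × E) × ℝ => (q.1.1 - q.2.toNNReal, q.1.2)) (by fun_prop))
        fun _ y => ((c y : ℝ≥0) : ℝ≥0∞))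

theorem lintegral_firstBranchingKernel (κ : SubMarkovKernel (ℝ≥0 × E) (FinConf E)) (t : ℝ≥0) (x : E)
    (s : ℝ) {F : FinConf E → ℝ≥0∞} (hF : Measurable F) :
    ∫⁻ μ, F μ ∂(X.firstBranchingKernel hc B κ ((t, x), s)) =
      X.killed c (t - s.toNNReal) (fun y => c y *
        ∫⁻ ν, ∫⁻ μ, F μ ∂(branchExt (fun z => κ.kernel (s.toNNReal, z)) ν) ∂(B y)) x := by
  have h1 : Measurable fun p : ℝ≥0 × E => ∫⁻ μ, F μ ∂(offspringKernel B κ p) := hF.lintegral_kernel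
  have h2 : Measurable fun y => ∫⁻ μ, F μ ∂(offspringKernel B κ (s.toNNReal, y)) :=
    h1.comp measurable_prodMk_left
  have hc' : Measurable fun y => (c y : ℝ≥0∞) := measurable_coe_nnreal_ennreal.comp hc
  rw [firstBranchingKernel, Kernel.lintegral_comp _ _ _ hF,
    Kernel.lintegral_deterministic_prod _ _ _ h1, Kernel.lintegral_withDensity _
      (f := fun _ y => ((c y : ℝ≥0) : ℝ≥0∞)) (hc'.comp measurable_snd) _ h2]
  simp_rw [← lintegral_offspringKernel B κ _ _ hF]
  exact X.lintegral_killedKernel hc _ _ (hc'.mul h2)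

/-- The kernel of the decomposition at the first branching time. -/
noncomputable def branchingStep (κ : SubMarkovKernel (ℝ≥0 × E) (FinConf E)) :
    Kernel (ℝ≥0 × E) (FinConf E) :=
  (X.killedKernel hc).map dirac +
    { toFun := fun p => ((volume : Measure ℝ).restrict (Set.Icc (0 : ℝ) p.1)).bind
        fun s => X.firstBranchingKernel hc B κ (p, s)
      measurable' := by
        refine Measure.measurable_of_measurable_coe _ fun A hA => ?_
        have hm : ∀ p : ℝ≥0 × E, Measurable fun s : ℝ => X.firstBranchingKernel hc B κ (p, s) :=
          fun p => (X.firstBranchingKernel hc B κ).measurable.comp measurable_prodMk_left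
        simp_rw [fun p : ℝ≥0 × E => Measure.bind_apply hA (hm p).aemeasurable (m :=
          (volume : Measure ℝ).restrict (Set.Icc (0 : ℝ) p.1)),
          ← lintegral_indicator measurableSet_Icc]
        refine Measurable.lintegral_prod_right' (f := fun q : (ℝ≥0 × E) × ℝ =>
          (Set.Icc (0 : ℝ) q.1.1).indicator
            (fun s => X.firstBranchingKernel hc B κ (q.1, s) A) q.2) ?_
        have hset : MeasurableSet {q : (ℝ≥0 × E) × ℝ | q.2 ∈ Set.Icc (0 : ℝ) q.1.1} :=
          (measurableSet_le measurable_const measurable_snd).inter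
            (measurableSet_le measurable_snd
              (measurable_coe_nnreal_real.comp (measurable_fst.comp measurable_fst)))
        exact ((X.firstBranchingKernel hc B κ).measurable_coe hA).indicator hset }

theorem lintegral_branchingStep (κ : SubMarkovKernel (ℝ≥0 × E) (FinConf E)) (t : ℝ≥0) (x : E)
    {F : FinConf E → ℝ≥0∞} (hF : Measurable F) :
    ∫⁻ μ, F μ ∂(X.branchingStep hc B κ (t, x)) =
      X.killed c t (fun y => F (dirac y)) x + X.duhamel c (fun s y => c y *
        ∫⁻ ν, ∫⁻ μ, F μ ∂(branchExt (fun z => κ.kernel (s, z)) ν) ∂(B y)) t x := by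
  have hm : Measurable fun s : ℝ => X.firstBranchingKernel hc B κ ((t, x), s) :=
    (X.firstBranchingKernel hc B κ).measurable.comp measurable_prodMk_left
  rw [branchingStep, _root_.add_apply, lintegral_add_measure,
    Kernel.map_apply _ measurable_dirac, lintegral_map hF measurable_dirac,
    X.lintegral_killedKernel hc t x (f := fun y => F (dirac y)) (hF.comp measurable_dirac)]
  congr 1
  refine (Measure.lintegral_bind hm.aemeasurable hF.aemeasurable).trans ?_
  exact lintegral_congr fun s => X.lintegral_firstBranchingKernel hc B κ t x s hF

/-- The offspring measures have mass at most `1`, so the branching term is at most the probability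
of being killed before `t`. -/
theorem branchingStep_univ_le_one {M : ℝ≥0} (hM : ∀ x, c x ≤ M)
    (κ : SubMarkovKernel (ℝ≥0 × E) (FinConf E)) (p : ℝ≥0 × E) :
    X.branchingStep hc B κ p Set.univ ≤ 1 := by
  rw [← lintegral_one, X.lintegral_branchingStep hc B κ p.1 p.2 measurable_const]
  refine le_of_le_of_eq (add_le_add le_rfl ?_) (X.killed_one_add_lintegral hc hM p.1 p.2)
  refine X.duhamel_mono c (g' := fun _ y => (c y : ℝ≥0∞)) (fun s y => ?_) _ _
  refine mul_le_of_le_one_right' ?_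
  calc ∫⁻ ν, ∫⁻ _, 1 ∂(branchExt (fun z => κ.kernel (s, z)) ν) ∂(B y) ≤ ∫⁻ _, 1 ∂(B y) :=
        lintegral_mono fun ν => by
          simpa using branchExt_univ_le_one _ (fun z => κ.le_one (s, z)) ν
    _ = 1 := by simp

variable {M : ℝ≥0} (hM : ∀ x, c x ≤ M)

/-- The successive approximations of the branching semigroup. -/
noncomputable def picard : ℕ → SubMarkovKernel (ℝ≥0 × E) (FinConf E)
  -- The zero kernel lies below every kernel, which makes the sequence increasing.
  | 0 => ⟨0, fun _ => by simp⟩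
  | n + 1 => ⟨X.branchingStep hc B (picard n), X.branchingStep_univ_le_one hc B hM _⟩

theorem _root_.FinConf.lintegral_branchExt_mono {h h' : E → Measure (FinConf E)}
    [∀ x, IsFiniteMeasure (h x)] [∀ x, IsFiniteMeasure (h' x)]
    (hle : ∀ x F, Measurable F → ∫⁻ μ, F μ ∂(h x) ≤ ∫⁻ μ, F μ ∂(h' x)) (ν : FinConf E)
    {F : FinConf E → ℝ≥0∞} (hF : Measurable F) :
    ∫⁻ μ, F μ ∂(branchExt h ν) ≤ ∫⁻ μ, F μ ∂(branchExt h' ν) := by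
  have := measurableAdd₂ (E := E)
  induction ν using FinConf.induction generalizing F with
  | zero => simp [branchExt_zero]
  | add x ν ih =>
    simp only [branchExt_add, branchExt_dirac, Measure.lintegral_conv hF]
    refine (hle x _ (Measurable.lintegral_prod_right'
      (f := fun p : FinConf E × FinConf E => F (p.1 + p.2)) (by fun_prop))).trans ?_
    exact lintegral_mono fun a => ih (by fun_prop)

theorem picard_mono (p : ℝ≥0 × E) {F : FinConf E → ℝ≥0∞} (hF : Measurable F) :
    Monotone fun n => ∫⁻ μ, F μ ∂((X.picard hc B hM n).kernel p) := by
  refine monotone_nat_of_le_succ fun n => ?_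
  induction n generalizing p F with
  | zero => simp [picard]
  | succ n ih =>
    have h1 := X.lintegral_branchingStep hc B (X.picard hc B hM n) p.1 p.2 hF
    have h2 := X.lintegral_branchingStep hc B (X.picard hc B hM (n + 1)) p.1 p.2 hF
    refine h1.trans_le (le_trans ?_ h2.ge)
    refine add_le_add le_rfl (X.duhamel_mono c (fun s y => ?_) _ _)
    refine mul_le_mul_right (lintegral_mono fun ν => ?_) _
    exact lintegral_branchExt_mono (fun x F hF => ih (s, x) hF) ν hF

/-- The minimal solution of the branching equation. -/
theorem exists_branching_limit : ∃ κ : SubMarkovKernel (ℝ≥0 × E) (FinConf E),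
    ∀ p, IsIncreasingLimit (fun n => (X.picard hc B hM n).kernel p) (κ.kernel p) := by
  choose m hm using fun p => exists_isIncreasingLimit
    (fun n => (X.picard hc B hM n).kernel p) fun F hF => X.picard_mono hc B hM p hF
  have hA : ∀ p A, MeasurableSet A → m p A = ⨆ n, (X.picard hc B hM n).kernel p A :=
    fun p A hA => by
      simpa [lintegral_indicator_one hA] using
        (hm p).lintegral_eq (A.indicator 1) (measurable_one.indicator hA)
  refine ⟨⟨⟨m, ?_⟩, fun p => ?_⟩, hm⟩
  · refine Measure.measurable_of_measurable_coe _ fun A hA' => ?_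
    simp_rw [fun p => hA p A hA']
    exact Measurable.iSup fun n => (X.picard hc B hM n).kernel.measurable_coe hA'
  · change m p Set.univ ≤ 1
    rw [hA p _ MeasurableSet.univ]
    exact iSup_le fun n => (X.picard hc B hM n).le_one p

theorem measurable_lintegral_branchExt (κ : SubMarkovKernel (ℝ≥0 × E) (FinConf E))
    {F : FinConf E → ℝ≥0∞} (hF : Measurable F) :
    Measurable fun p : ℝ≥0 × FinConf E =>
      ∫⁻ μ, F μ ∂(branchExt (fun z => κ.kernel (p.1, z)) p.2) :=
  hF.lintegral_kernel (κ := branchKernel κ.kernel κ.le_one)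

/-- Monotone convergence, in the convolution powers and in the Duhamel integral at once. The
integrand is arbitrary: multiplicative functions give the branching equation and `lin f` gives the
moment equation. -/
theorem branching_limit_equation {κ : SubMarkovKernel (ℝ≥0 × E) (FinConf E)}
    (hκ : ∀ p, IsIncreasingLimit (fun n => (X.picard hc B hM n).kernel p) (κ.kernel p))
    {F : FinConf E → ℝ≥0∞} (hF : Measurable F) (t : ℝ≥0) (x : E) :
    ∫⁻ μ, F μ ∂(κ.kernel (t, x)) =
      X.killed c t (fun y => F (dirac y)) x + X.duhamel c (fun s y => c y *
        ∫⁻ ν, ∫⁻ μ, F μ ∂(branchExt (fun z => κ.kernel (s, z)) ν) ∂(B y)) t x := by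
  have hlim : ∀ s ν, IsIncreasingLimit
      (fun n => branchExt (fun z => (X.picard hc B hM n).kernel (s, z)) ν)
      (branchExt (fun z => κ.kernel (s, z)) ν) := fun s ν =>
    isIncreasingLimit_branchExt _ (fun z => hκ (s, z)) ν
  have hmeas : ∀ n, Measurable fun p : ℝ≥0 × FinConf E =>
      ∫⁻ μ, F μ ∂(branchExt (fun z => (X.picard hc B hM n).kernel (p.1, z)) p.2) := fun n =>
    measurable_lintegral_branchExt _ hF
  have hsup : (fun (s : ℝ≥0) y => (c y : ℝ≥0∞) *
        ∫⁻ ν, ∫⁻ μ, F μ ∂(branchExt (fun z => κ.kernel (s, z)) ν) ∂(B y)) =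
      fun s y => ⨆ n, (c y : ℝ≥0∞) * ∫⁻ ν, ∫⁻ μ, F μ
        ∂(branchExt (fun z => (X.picard hc B hM n).kernel (s, z)) ν) ∂(B y) := by
    ext s y
    simp_rw [← ENNReal.mul_iSup, (hlim s _).lintegral_eq F hF]
    rw [lintegral_iSup (f := fun n ν => ∫⁻ μ, F μ
      ∂(branchExt (fun z => (X.picard hc B hM n).kernel (s, z)) ν))
      (fun n => (hmeas n).comp measurable_prodMk_left)
      fun i j hij ν => (hlim s ν).mono F hF hij]
  -- Dropping the zeroth iterate leaves the supremum unchanged and aligns both sides of the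
  -- recursion.
  have hshift : ∫⁻ μ, F μ ∂(κ.kernel (t, x)) =
      ⨆ n, ∫⁻ μ, F μ ∂((X.picard hc B hM (n + 1)).kernel (t, x)) :=
    ((hκ (t, x)).lintegral_eq F hF).trans (((hκ (t, x)).mono F hF).iSup_nat_add 1).symm
  rw [hsup, X.duhamel_iSup hc (fun n => measurable_branching hc B (hmeas n))
    (fun i j hij s y => mul_le_mul_right (lintegral_mono fun ν => (hlim s ν).mono F hF hij) _),
    ENNReal.add_iSup, hshift]
  exact iSup_congr fun n => X.lintegral_branchingStep hc B (X.picard hc B hM n) t x hF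

end Existence

end BorelRightProcess

/-! ### Exponentials and linear functions -/

theorem one_sub_expNeg_le (r : ℝ≥0∞) : 1 - expNeg r ≤ r := by
  induction r with
  | top => simp
  | coe r =>
    rw [expNeg_coe, tsub_le_iff_right, ← ENNReal.ofReal_one, ← ENNReal.ofReal_coe_nnreal,
      ← ENNReal.ofReal_add r.coe_nonneg (Real.exp_pos _).le]
    exact ENNReal.ofReal_le_ofReal (by linarith [Real.add_one_le_exp (-(r : ℝ))])

theorem mul_one_sub_expNeg_le (n : ℕ) (r : ℝ≥0∞) :
    ((n : ℝ≥0∞) + 1) * (1 - expNeg (((n : ℝ≥0∞) + 1)⁻¹ * r)) ≤ r := by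
  calc ((n : ℝ≥0∞) + 1) * (1 - expNeg (((n : ℝ≥0∞) + 1)⁻¹ * r))
      ≤ ((n : ℝ≥0∞) + 1) * (((n : ℝ≥0∞) + 1)⁻¹ * r) := by
        gcongr; exact one_sub_expNeg_le _
    _ = r := by
        rw [← mul_assoc, ENNReal.mul_inv_cancel (by simp) (by simp), one_mul]

/-- The derivative at `0` of `ε ↦ 1 - exp (-εr)` along `ε = 1/(n+1)`; the limit remains correct for
`r = ∞`. -/
theorem tendsto_mul_one_sub_expNeg (r : ℝ≥0∞) :
    Tendsto (fun n : ℕ => ((n : ℝ≥0∞) + 1) * (1 - expNeg (((n : ℝ≥0∞) + 1)⁻¹ * r)))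
      atTop (𝓝 r) := by
  induction r with
  | top =>
    have : ∀ n : ℕ, ((n : ℝ≥0∞) + 1)⁻¹ * ∞ = ∞ := fun n => ENNReal.mul_top (by simp)
    simp only [this, expNeg_top, tsub_zero, mul_one]
    exact_mod_cast ENNReal.tendsto_nat_nhds_top.comp (tendsto_add_atTop_nat 1)
  | coe r =>
    have key : ∀ n : ℕ, ((n : ℝ≥0∞) + 1) * (1 - expNeg (((n : ℝ≥0∞) + 1)⁻¹ * r)) =
        ENNReal.ofReal ((n + 1 : ℝ) * (1 - Real.exp (-((n + 1 : ℝ)⁻¹ * r)))) := fun n => by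
      have h1 : ((n : ℝ≥0∞) + 1)⁻¹ * r = (((n + 1 : ℝ≥0)⁻¹ * r : ℝ≥0) : ℝ≥0∞) := by
        rw [ENNReal.coe_mul, ENNReal.coe_inv (by positivity)]; simp
      rw [h1, expNeg_coe, ENNReal.ofReal_mul (by positivity), ENNReal.ofReal_sub _
        (Real.exp_pos _).le, ENNReal.ofReal_one, ENNReal.ofReal_add (by positivity) zero_le_one]
      simp
    simp_rw [key]
    rw [← ENNReal.ofReal_coe_nnreal]
    refine ENNReal.tendsto_ofReal ?_
    have hx : Tendsto (fun n : ℕ => (n + 1 : ℝ)⁻¹) atTop (𝓝 0) := by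
      simpa using tendsto_one_div_add_atTop_nhds_zero_nat (𝕜 := ℝ)
    -- Lower bound from `exp (-x) ≤ 1/(1+x)` at `x = r/(n+1)`.
    have hlow : Tendsto (fun n : ℕ => (r : ℝ) / (1 + (n + 1 : ℝ)⁻¹ * r)) atTop (𝓝 r) := by
      have : Tendsto (fun n : ℕ => 1 + (n + 1 : ℝ)⁻¹ * r) atTop (𝓝 (1 + 0 * r)) :=
        (hx.mul_const _).const_add _
      have h := (tendsto_const_nhds (x := (r : ℝ)) (f := atTop (α := ℕ))).div this (by simp)
      rwa [zero_mul, add_zero, div_one] at h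
    refine tendsto_of_tendsto_of_tendsto_of_le_of_le hlow tendsto_const_nhds (fun n => ?_)
      fun n => ?_
    · have hr := r.coe_nonneg
      set x : ℝ := (n + 1 : ℝ)⁻¹ * r with hxdef
      have hx0 : 0 ≤ x := by positivity
      have hrx : (r : ℝ) = (n + 1 : ℝ) * x := by rw [hxdef]; field_simp
      have h1 : Real.exp (-x) ≤ 1 / (1 + x) := by
        rw [Real.exp_neg, ← one_div]
        exact one_div_le_one_div_of_le (by positivity) (by linarith [Real.add_one_le_exp x])
      have h2 : (r : ℝ) / (1 + x) = (n + 1 : ℝ) * (1 - 1 / (1 + x)) := by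
        rw [hrx]; field_simp; ring
      simp only
      rw [h2]
      gcongr
    · have h1 := Real.add_one_le_exp (-((n + 1 : ℝ)⁻¹ * r))
      have h2 : (n + 1 : ℝ) * ((n + 1 : ℝ)⁻¹ * r) = r := by field_simp
      calc (n + 1 : ℝ) * (1 - Real.exp (-((n + 1 : ℝ)⁻¹ * r)))
          ≤ (n + 1 : ℝ) * ((n + 1 : ℝ)⁻¹ * r) := by gcongr; linarith
        _ = r := h2

namespace FinConf

theorem mult_expNeg {E : Type*} (f : E → ℝ≥0∞) (μ : FinConf E) :
    mult (fun x => expNeg (f x)) μ = expNeg (lin f μ) := by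
  induction μ using induction with
  | zero => simp
  | add x μ ih => simp [ih, expNeg_add]

variable {E : Type*} [TopologicalSpace E] [LusinSpace E] [MeasurableSpace E] [BorelSpace E]
  [Nonempty E]

theorem lintegral_one_sub_expNeg_lin (m : Measure (FinConf E)) [IsProbabilityMeasure m]
    {f : E → ℝ≥0∞} (hf : Measurable f) :
    ∫⁻ μ, (1 - expNeg (lin f μ)) ∂m = 1 - ∫⁻ μ, mult (fun x => expNeg (f x)) μ ∂m := by
  simp_rw [mult_expNeg]
  have hm : Measurable fun μ => expNeg (lin f μ) := measurable_expNeg.comp (measurable_lin hf)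
  have hle : ∫⁻ μ, expNeg (lin f μ) ∂m ≤ 1 :=
    (lintegral_mono fun μ => expNeg_le_one _).trans (by simp)
  rw [lintegral_sub hm (ne_top_of_le_ne_top ENNReal.one_ne_top hle)
    (Eventually.of_forall fun μ => expNeg_le_one _)]
  simp

/-- The integrals of the multiplicative functions determine those of the linear functions. -/
theorem lintegral_lin_le_of_mult (m m' : Measure (FinConf E)) [IsProbabilityMeasure m]
    [IsProbabilityMeasure m']
    (h : ∀ φ : E → ℝ≥0∞, Measurable φ → (∀ x, φ x ≤ 1) →
      ∫⁻ μ, mult φ μ ∂m = ∫⁻ μ, mult φ μ ∂m') {f : E → ℝ≥0∞} (hf : Measurable f) :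
    ∫⁻ μ, lin f μ ∂m ≤ ∫⁻ μ, lin f μ ∂m' := by
  let g : ℕ → E → ℝ≥0∞ := fun n x => ((n : ℝ≥0∞) + 1)⁻¹ * f x
  have hg : ∀ n, Measurable (g n) := fun n => hf.const_mul _
  let F : ℕ → FinConf E → ℝ≥0∞ := fun n μ => ((n : ℝ≥0∞) + 1) * (1 - expNeg (lin (g n) μ))
  have hF : ∀ n, Measurable fun μ => 1 - expNeg (lin (g n) μ) := fun n =>
    measurable_const.sub (measurable_expNeg.comp (measurable_lin (hg n)))
  have heq : ∀ n, ∫⁻ μ, F n μ ∂m = ∫⁻ μ, F n μ ∂m' := fun n => by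
    simp only [F]
    rw [lintegral_const_mul _ (hF n), lintegral_const_mul _ (hF n),
      lintegral_one_sub_expNeg_lin m (hg n), lintegral_one_sub_expNeg_lin m' (hg n),
      h (fun x => expNeg (g n x)) (measurable_expNeg.comp (hg n)) fun x => expNeg_le_one _]
  have hlim : ∀ μ, Tendsto (fun n => F n μ) atTop (𝓝 (lin f μ)) := fun μ => by
    simp only [F, g, lin_const_mul]
    exact tendsto_mul_one_sub_expNeg _
  -- Fatou on one side and `F n ≤ lin f` on the other: no monotonicity in `n` is needed, and
  -- infinite moments are allowed.
  calc ∫⁻ μ, lin f μ ∂m = ∫⁻ μ, liminf (fun n => F n μ) atTop ∂m :=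
        lintegral_congr fun μ => (hlim μ).liminf_eq.symm
    _ ≤ liminf (fun n => ∫⁻ μ, F n μ ∂m) atTop :=
        lintegral_liminf_le fun n => (hF n).const_mul _
    _ ≤ liminf (fun _ : ℕ => ∫⁻ μ, lin f μ ∂m') atTop := by
        refine liminf_le_liminf (Eventually.of_forall fun n => ?_)
        rw [heq]
        refine lintegral_mono fun μ => ?_
        simp only [F, g, lin_const_mul]
        exact mul_one_sub_expNeg_le n _
    _ = _ := by simp

end FinConf

/-! ### Branching kernels -/

namespace IsBranchingKernel

open FinConf

variable {E : Type*} [TopologicalSpace E] [LusinSpace E] [MeasurableSpace E] [BorelSpace E]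
  [Nonempty E] {N : Kernel (FinConf E) (FinConf E)} (hN : IsBranchingKernel N)

include hN

omit [LusinSpace E] [MeasurableSpace E] [BorelSpace E] [Nonempty E] in
theorem isFiniteMeasure (μ : FinConf E) : IsFiniteMeasure (N μ) :=
  ⟨(hN.1 μ).trans_lt ENNReal.one_lt_top⟩

theorem lintegral_mult_add {φ : E → ℝ≥0∞} (hφ : Measurable φ) (μ ν : FinConf E) :
    ∫⁻ ρ, mult φ ρ ∂(N (μ + ν)) = (∫⁻ ρ, mult φ ρ ∂(N μ)) * ∫⁻ ρ, mult φ ρ ∂(N ν) := by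
  have := measurableAdd₂ (E := E)
  have := hN.isFiniteMeasure ν
  have hm := measurable_mult hφ
  rw [hN.2, Measure.lintegral_conv hm]
  simp_rw [mult_add, lintegral_const_mul _ hm, lintegral_mul_const _ hm]

variable (h1 : ∀ x, N (dirac x) Set.univ = 1)

include h1

theorem apply_zero_univ : N 0 Set.univ = 1 := by
  obtain ⟨x⟩ := ‹Nonempty E›
  have := hN.isFiniteMeasure (dirac x)
  have h := measure_univ_conv (N 0) (N (dirac x))
  rw [← hN.2, zero_add, h1, mul_one] at h
  exact h.symm

/-- `N 0` is the Dirac mass at `0`, which the definition of a branching kernel does not impose. The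
integral `g` of `2^(-number of points)` satisfies `g = g²` and `0 < g ≤ 1`, so `g = 1`, and the
integrand equals `1` only at the empty configuration. -/
theorem lintegral_apply_zero (F : FinConf E → ℝ≥0∞) : ∫⁻ μ, F μ ∂(N 0) = F 0 := by
  have hz := hN.apply_zero_univ h1
  have hm : Measurable (mult fun _ : E => (2⁻¹ : ℝ≥0∞)) := measurable_mult measurable_const
  have hle : ∀ x : E, (fun _ : E => (2⁻¹ : ℝ≥0∞)) x ≤ 1 := fun _ => by simp
  have hpos : ∀ μ : FinConf E, mult (fun _ => (2⁻¹ : ℝ≥0∞)) μ ≠ 0 := fun μ => by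
    induction μ using FinConf.induction with
    | zero => simp
    | add x μ ih => simp [ih]
  set g := ∫⁻ μ, mult (fun _ => (2⁻¹ : ℝ≥0∞)) μ ∂(N 0) with hg
  have hgg : g = g * g := by
    conv_lhs => rw [hg, ← add_zero (0 : FinConf E), hN.lintegral_mult_add measurable_const]
  have hg1 : g ≤ 1 := by
    refine (lintegral_mono fun μ => mult_le_one hle μ).trans ?_
    simp [hz]
  have hg0 : g ≠ 0 := fun h => by
    have h' := (lintegral_eq_zero_iff hm).1 h
    have : N 0 = 0 := by
      rw [← ae_eq_bot, ← Filter.eventually_false_iff_eq_bot]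
      filter_upwards [h'] with μ hμ using hpos μ hμ
    simp [this] at hz
  have hg' : g = 1 := by
    have := (ENNReal.mul_right_inj hg0 (ne_top_of_le_ne_top ENNReal.one_ne_top hg1)).1
      (hgg.symm.trans (mul_one g).symm)
    exact this
  have hae : (mult fun _ : E => (2⁻¹ : ℝ≥0∞)) =ᵐ[N 0] fun _ => 1 :=
    ae_eq_of_ae_le_of_lintegral_le (Eventually.of_forall fun μ => mult_le_one hle μ)
      (by rw [← hg, hg']; simp) aemeasurable_const (by rw [← hg, hg']; simp [hz])
  have hzero : ∀ μ : FinConf E, mult (fun _ => (2⁻¹ : ℝ≥0∞)) μ = 1 → μ = 0 := fun μ => by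
    induction μ using FinConf.induction with
    | zero => simp
    | add x μ _ =>
      intro h
      exfalso
      rw [mult_add, mult_dirac] at h
      have : (2⁻¹ : ℝ≥0∞) * mult (fun _ => (2⁻¹ : ℝ≥0∞)) μ ≤ 2⁻¹ * 1 := by
        gcongr; exact mult_le_one hle μ
      rw [h, mul_one] at this
      exact absurd this (by simp)
  have : (fun μ => F μ) =ᵐ[N 0] fun _ => F 0 := by
    filter_upwards [hae] with μ hμ
    rw [hzero μ hμ]
  rw [lintegral_congr_ae this]
  simp [hz]

theorem apply_univ (μ : FinConf E) : N μ Set.univ = 1 := by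
  induction μ using FinConf.induction with
  | zero => exact hN.apply_zero_univ h1
  | add x μ ih =>
    have := hN.isFiniteMeasure μ
    rw [hN.2, measure_univ_conv, h1, ih, mul_one]

theorem isProbabilityMeasure (μ : FinConf E) : IsProbabilityMeasure (N μ) :=
  ⟨hN.apply_univ h1 μ⟩

theorem lintegral_mult {φ : E → ℝ≥0∞} (hφ : Measurable φ) (μ : FinConf E) :
    ∫⁻ ρ, mult φ ρ ∂(N μ) = mult (fun x => ∫⁻ ρ, mult φ ρ ∂(N (dirac x))) μ := by
  induction μ using FinConf.induction with
  | zero => simp [hN.lintegral_apply_zero h1]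
  | add x μ ih => rw [hN.lintegral_mult_add hφ, ih, mult_add, mult_dirac]

/-- Total mass `1` of every factor makes first moments additive under convolution. -/
theorem lintegral_lin {f : E → ℝ≥0∞} (hf : Measurable f) (μ : FinConf E) :
    ∫⁻ ρ, lin f ρ ∂(N μ) = lin (fun x => ∫⁻ ρ, lin f ρ ∂(N (dirac x))) μ := by
  induction μ using FinConf.induction with
  | zero => simp [hN.lintegral_apply_zero h1]
  | add x μ ih =>
    have := hN.isFiniteMeasure μ
    rw [hN.2, lintegral_lin_conv hf, ih, h1, hN.apply_univ h1, lin_add, lin_dirac, one_mul, mul_one]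

end IsBranchingKernel

/-! ### Existence and uniqueness of the semigroups -/

namespace BorelRightProcess

open FinConf

variable {E : Type*} [TopologicalSpace E] [LusinSpace E] [MeasurableSpace E] [BorelSpace E]
  [Nonempty E] {Ω : Type*} [MeasurableSpace Ω] {X : BorelRightProcess E Ω} {c : E → ℝ≥0}
  (hc : Measurable c) {B : Kernel E (FinConf E)} [IsMarkovKernel B] {M : ℝ≥0} (hM : ∀ x, c x ≤ M)

/-- Non-explosion: as `B` is Markovian and killing conserves mass, the constant `1` solves the
equation for `φ = 1`, and by comparison it lies below `H_t 1`. -/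
theorem _root_.IsBranchingSemigroup.apply_dirac_univ {β₁ : ℝ≥0} (hc : Measurable c)
    (hM : ∀ x, c x ≤ M) (hβ₁ : ∀ x, ∫⁻ μ, lin (fun _ => 1) μ ∂(B x) ≤ β₁)
    {H : ℝ≥0 → Kernel (FinConf E) (FinConf E)} (hH : IsBranchingSemigroup X c B H) (t : ℝ≥0)
    (x : E) : H t (dirac x) Set.univ = 1 := by
  refine le_antisymm ((hH.branching t).1 _) ?_
  have h1 : ∀ x : E, (fun _ : E => (1 : ℝ≥0∞)) x ≤ 1 := fun _ => le_rfl
  have := X.le_of_branching_equation hc B hβ₁ hM (φ := fun _ => 1) (h := fun _ _ => 1)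
    (h' := fun t x => ∫⁻ μ, mult (fun _ => 1) μ ∂(H t (dirac x)))
    (hH.measurable _ measurable_const h1) measurable_const (fun _ _ => le_rfl)
    (fun t x => by simpa using (hH.branching t).1 (dirac x))
    (fun t x => by
      simp only [mult_one, lintegral_const, measure_univ, mul_one]
      exact (X.killed_one_add_lintegral hc hM t x).symm)
    (hH.equation _ measurable_const h1) t x
  simpa using this

theorem _root_.IsBranchingSemigroup.lintegral_mult_le {β₁ : ℝ≥0} (hc : Measurable c)
    (hM : ∀ x, c x ≤ M) (hβ₁ : ∀ x, ∫⁻ μ, lin (fun _ => 1) μ ∂(B x) ≤ β₁)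
    {H H' : ℝ≥0 → Kernel (FinConf E) (FinConf E)} (hH : IsBranchingSemigroup X c B H)
    (hH' : IsBranchingSemigroup X c B H') {φ : E → ℝ≥0∞} (hφ : Measurable φ) (h1 : ∀ x, φ x ≤ 1)
    (t : ℝ≥0) (x : E) : ∫⁻ μ, mult φ μ ∂(H t (dirac x)) ≤ ∫⁻ μ, mult φ μ ∂(H' t (dirac x)) := by
  have hle : ∀ {H : ℝ≥0 → Kernel (FinConf E) (FinConf E)}, IsBranchingSemigroup X c B H →
      ∀ t x, ∫⁻ μ, mult φ μ ∂(H t (dirac x)) ≤ 1 := fun hH t x =>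
    (lintegral_mono fun μ => mult_le_one h1 μ).trans (by simpa using (hH.branching t).1 (dirac x))
  exact X.le_of_branching_equation hc B hβ₁ hM
    (h := fun t x => ∫⁻ μ, mult φ μ ∂(H t (dirac x)))
    (h' := fun t x => ∫⁻ μ, mult φ μ ∂(H' t (dirac x)))
    (hH'.measurable _ hφ h1) (hH.measurable _ hφ h1) (hle hH) (hle hH')
    (hH.equation _ hφ h1) (hH'.equation _ hφ h1) t x

/-- The branching kernels extending a kernel from `ℝ≥0 × E` to `Ê`. -/
noncomputable def branchingFamily (κ : SubMarkovKernel (ℝ≥0 × E) (FinConf E)) (t : ℝ≥0) :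
    Kernel (FinConf E) (FinConf E) :=
  (branchKernel κ.kernel κ.le_one).comap (fun ν => (t, ν)) measurable_prodMk_left

omit [IsMarkovKernel B] in
theorem branchingFamily_apply (κ : SubMarkovKernel (ℝ≥0 × E) (FinConf E)) (t : ℝ≥0)
    (ν : FinConf E) : branchingFamily κ t ν = branchExt (fun z => κ.kernel (t, z)) ν := rfl

theorem isBranchingSemigroup_branchingFamily {κ : SubMarkovKernel (ℝ≥0 × E) (FinConf E)}
    (hκ : ∀ p, IsIncreasingLimit (fun n => (X.picard hc B hM n).kernel p) (κ.kernel p)) :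
    IsBranchingSemigroup X c B (branchingFamily κ) where
  branching t := ⟨fun μ => branchExt_univ_le_one _ (fun z => κ.le_one (t, z)) μ,
    fun μ ν => branchExt_add _ μ ν⟩
  measurable φ hφ _ := by
    simp only [branchingFamily_apply, branchExt_dirac]
    exact (measurable_mult hφ).lintegral_kernel
  equation φ hφ _ t x := by
    simp only [branchingFamily_apply, branchExt_dirac]
    rw [X.branching_limit_equation hc B hM hκ (measurable_mult hφ)]
    simp only [mult_dirac, lintegral_mult_branchExt _ hφ]
    rfl

/-! ### First moments and the perturbed semigroup -/

omit [LusinSpace E] [BorelSpace E] [Nonempty E] in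
theorem _root_.coe_mul_meanKernel {β₁ : ℝ≥0} (hβ₁ : 0 < β₁) (c : E → ℝ≥0) (B : Kernel E (FinConf E))
    (f : E → ℝ≥0∞) (y : E) :
    ((c y + β₁ : ℝ≥0) : ℝ≥0∞) * meanKernel c β₁ B f y = c y * ∫⁻ μ, lin f μ ∂(B y) := by
  rw [meanKernel, ← mul_assoc, ← ENNReal.coe_mul, mul_div_cancel₀ _ (by positivity)]

/-- A configuration as a measure on `E`. -/
noncomputable def _root_.FinConf.toMeasure (μ : FinConf E) : Measure E :=
  (Multiset.map Measure.dirac μ).sum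

omit [TopologicalSpace E] [LusinSpace E] [BorelSpace E] [Nonempty E] in
theorem _root_.FinConf.toMeasure_add (x : E) (μ : FinConf E) :
    toMeasure (dirac x + μ) = Measure.dirac x + toMeasure μ :=
  (congrArg Multiset.sum (Multiset.map_cons Measure.dirac x μ)).trans (Multiset.sum_cons _ _)

omit [TopologicalSpace E] [LusinSpace E] [BorelSpace E] [Nonempty E] in
theorem _root_.FinConf.lintegral_toMeasure {f : E → ℝ≥0∞} (hf : Measurable f)
    (μ : FinConf E) : ∫⁻ x, f x ∂(toMeasure μ) = lin f μ := by
  induction μ using FinConf.induction with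
  | zero => exact lintegral_zero_measure _
  | add x μ ih =>
    rw [toMeasure_add, lintegral_add_measure, lintegral_dirac' _ hf, ih, lin_add, lin_dirac]

/-- The kernel `μ ↦ μ` from configurations to measures on `E`. -/
noncomputable def _root_.FinConf.toMeasureKernel : Kernel (FinConf E) E where
  toFun := toMeasure
  measurable' := by
    refine Measure.measurable_of_measurable_coe _ fun A hA => ?_
    simp_rw [← lintegral_indicator_one hA, lintegral_toMeasure (measurable_one.indicator hA)]
    exact measurable_lin (measurable_one.indicator hA)

theorem _root_.FinConf.lintegral_toMeasureKernel {f : E → ℝ≥0∞} (hf : Measurable f)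
    (μ : FinConf E) : ∫⁻ x, f x ∂(toMeasureKernel μ) = lin f μ := lintegral_toMeasure hf μ

/-- The first moment kernels `f ↦ e^{-bt} ∫ l_f dκ_t`. -/
noncomputable def momentFamily (κ : SubMarkovKernel (ℝ≥0 × E) (FinConf E)) (b t : ℝ≥0) :
    Kernel E E where
  toFun x := ENNReal.ofReal (Real.exp (-((b : ℝ) * t))) •
    (toMeasureKernel ∘ₖ κ.kernel) (t, x)
  measurable' := by
    refine Measure.measurable_of_measurable_coe _ fun A hA => ?_
    simp only [Measure.smul_apply, smul_eq_mul]
    exact (((toMeasureKernel ∘ₖ κ.kernel).measurable_coe hA).comp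
      measurable_prodMk_left).const_mul _

theorem lintegral_momentFamily (κ : SubMarkovKernel (ℝ≥0 × E) (FinConf E)) (b t : ℝ≥0) (x : E)
    {f : E → ℝ≥0∞} (hf : Measurable f) :
    ∫⁻ y, f y ∂(momentFamily κ b t x) =
      ENNReal.ofReal (Real.exp (-((b : ℝ) * t))) * ∫⁻ μ, lin f μ ∂(κ.kernel (t, x)) := by
  have : momentFamily κ b t x = ENNReal.ofReal (Real.exp (-((b : ℝ) * t))) •
    (toMeasureKernel ∘ₖ κ.kernel) (t, x) := rfl
  rw [this, lintegral_smul_measure, Kernel.lintegral_comp _ _ _ hf, smul_eq_mul]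
  simp_rw [lintegral_toMeasureKernel hf]

include hc in
-- The damped moment obeys the equation with killing rate `c + β₁`, and by induction its source is
-- at most `c * β₁ ≤ c + β₁`. Conservation of mass for that rate closes the induction. Working with
-- the iterates avoids assuming that the moments of the limit are finite.
theorem exp_mul_picard_lin_le_one {β₁ : ℝ≥0}
    (hβ₁ : ∀ x, ∫⁻ μ, lin (fun _ => 1) μ ∂(B x) ≤ β₁)
    (hcβ : ∀ x, c x * β₁ ≤ c x + β₁) (n : ℕ) (t : ℝ≥0) (x : E) :
    ENNReal.ofReal (Real.exp (-((β₁ : ℝ) * t))) *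
      ∫⁻ μ, lin (fun _ => 1) μ ∂((X.picard hc B hM n).kernel (t, x)) ≤ 1 := by
  induction n generalizing t x with
  | zero => simp [picard]
  | succ n ih =>
    have hlin : Measurable (lin (E := E) fun _ => 1) := measurable_lin measurable_const
    have hG := measurable_branching hc B
      (measurable_lintegral_branchExt (X.picard hc B hM n) hlin)
    refine le_of_eq_of_le (congrArg _ (X.lintegral_branchingStep hc B (X.picard hc B hM n) t x
      hlin)) ?_
    simp only [lin_dirac]
    rw [mul_add, ← X.duhamel_exp hc β₁ hG, ← X.killed_add_const hc β₁ t _ measurable_const]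
    refine le_of_le_of_eq (add_le_add le_rfl ?_) (X.killed_one_add_lintegral
      (c := fun x => c x + β₁) (M := M + β₁) (hc.add_const _) (fun x => by gcongr; exact hM x) t x)
    refine X.duhamel_mono _ (g' := fun _ y => ((c y + β₁ : ℝ≥0) : ℝ≥0∞)) (fun s y => ?_) t x
    calc ENNReal.ofReal (Real.exp (-((β₁ : ℝ) * s))) * (c y * ∫⁻ ν, ∫⁻ μ, lin (fun _ => 1) μ
          ∂(branchExt (fun z => (X.picard hc B hM n).kernel (s, z)) ν) ∂(B y))
        = c y * ∫⁻ ν, ENNReal.ofReal (Real.exp (-((β₁ : ℝ) * s))) * ∫⁻ μ, lin (fun _ => 1) μ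
          ∂(branchExt (fun z => (X.picard hc B hM n).kernel (s, z)) ν) ∂(B y) := by
          rw [lintegral_const_mul' _ _ ENNReal.ofReal_ne_top]; ring
      _ ≤ c y * ∫⁻ ν, lin (fun _ => 1) ν ∂(B y) := by
          gcongr with ν
          refine (mul_le_mul_right (lintegral_lin_branchExt_le _
            (fun z => (X.picard hc B hM n).le_one (s, z)) measurable_const ν) _).trans ?_
          rw [← lin_const_mul]
          exact lin_mono (fun z => ih s z) ν
      _ ≤ c y * β₁ := by gcongr; exact hβ₁ y
      _ ≤ _ := by exact_mod_cast hcβ y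

theorem isPerturbedSemigroup_momentFamily {β₁ : ℝ≥0} (hpos : 0 < β₁)
    (hβ₁ : ∀ x, ∫⁻ μ, lin (fun _ => 1) μ ∂(B x) ≤ β₁) (hcβ : ∀ x, c x * β₁ ≤ c x + β₁)
    {κ : SubMarkovKernel (ℝ≥0 × E) (FinConf E)}
    (hκ : ∀ p, IsIncreasingLimit (fun n => (X.picard hc B hM n).kernel p) (κ.kernel p)) :
    IsPerturbedSemigroup X (fun x => c x + β₁) (meanKernel c β₁ B) (momentFamily κ β₁) where
  subMarkov t x := by
    rw [← lintegral_one, lintegral_momentFamily _ _ _ _ measurable_const,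
      (hκ (t, x)).lintegral_eq _ (measurable_lin measurable_const), ENNReal.mul_iSup]
    exact iSup_le fun n => exp_mul_picard_lin_le_one hc hM hβ₁ hcβ n t x
  measurable f hf := by
    simp_rw [lintegral_momentFamily _ _ _ _ hf.1]
    have h1 : Measurable fun t : ℝ≥0 => ENNReal.ofReal (Real.exp (-((β₁ : ℝ) * t))) := by fun_prop
    exact (h1.comp measurable_fst).mul (measurable_lin hf.1).lintegral_kernel
  equation f hf t x := by
    have hbr := isBranchingSemigroup_branchingFamily hc hM hκ
    have hlin := measurable_lin hf.1
    have hG := measurable_branching hc B (measurable_lintegral_branchExt κ hlin)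
    rw [lintegral_momentFamily _ _ _ _ hf.1, X.branching_limit_equation hc B hM hκ hlin, mul_add,
      ← X.duhamel_exp hc β₁ hG, X.killed_add_const hc β₁ t _ hf.1]
    simp only [lin_dirac]
    congr 1
    refine lintegral_congr fun s => ?_
    congr 1
    ext y
    beta_reduce
    rw [coe_mul_meanKernel hpos, ← mul_assoc, mul_comm _ (c y : ℝ≥0∞), mul_assoc,
      ← lintegral_const_mul' _ _ ENNReal.ofReal_ne_top]
    congr 1
    refine lintegral_congr fun ν => ?_
    simp_rw [lintegral_momentFamily _ _ _ _ hf.1, lin_const_mul]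
    congr 1
    -- Mass `1` is what turns the moment of a convolution product into an exact sum, so that the
    -- equation becomes linear.
    have := (hbr.branching s.toNNReal).lintegral_lin
      (fun x => hbr.apply_dirac_univ hc hM hβ₁ s.toNNReal x) hf.1 ν
    simpa only [branchingFamily_apply, branchExt_dirac] using this

/-- Uniqueness of the perturbed semigroup. -/
theorem _root_.IsPerturbedSemigroup.lintegral_le {β₁ : ℝ≥0} (hc : Measurable c)
    (hM : ∀ x, c x ≤ M) (hpos : 0 < β₁) (hβ₁ : ∀ x, ∫⁻ μ, lin (fun _ => 1) μ ∂(B x) ≤ β₁)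
    {Q Q' : ℝ≥0 → Kernel E E}
    (hQ : IsPerturbedSemigroup X (fun x => c x + β₁) (meanKernel c β₁ B) Q)
    (hQ' : IsPerturbedSemigroup X (fun x => c x + β₁) (meanKernel c β₁ B) Q')
    {f : E → ℝ≥0∞} (hf : IsBoundedPosMeasurable f) (t : ℝ≥0) (x : E) :
    ∫⁻ y, f y ∂(Q t x) ≤ ∫⁻ y, f y ∂(Q' t x) := by
  obtain ⟨K, hK⟩ := hf.2
  have heq : ∀ {Q : ℝ≥0 → Kernel E E},
      IsPerturbedSemigroup X (fun x => c x + β₁) (meanKernel c β₁ B) Q → ∀ t x,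
      ∫⁻ y, f y ∂(Q t x) = X.killed (fun x => c x + β₁) t f x +
        X.duhamel (fun x => c x + β₁) (fun s y => c y *
          ∫⁻ μ, lin (fun z => ∫⁻ w, f w ∂(Q s z)) μ ∂(B y)) t x := fun hQ t x => by
    rw [hQ.equation f hf t x]
    simp_rw [coe_mul_meanKernel hpos]
    rfl
  refine X.le_of_linear_equation hc B hβ₁ hM (k := fun x => c x + β₁) (hc.add_const _) (K := K)
    (h := fun t x => ∫⁻ y, f y ∂(Q t x)) (h' := fun t x => ∫⁻ y, f y ∂(Q' t x))
    (hQ'.measurable f hf) (hQ.measurable f hf) (fun t x => ?_) (heq hQ) (heq hQ') t x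
  calc ∫⁻ y, f y ∂(Q t x) ≤ ∫⁻ _, K ∂(Q t x) := lintegral_mono hK
    _ ≤ K * 1 := by rw [lintegral_const]; gcongr; exact hQ.subMarkov t x
    _ = K := mul_one _

theorem _root_.IsPerturbedSemigroup.eq {β₁ : ℝ≥0} (hc : Measurable c)
    (hM : ∀ x, c x ≤ M) (hpos : 0 < β₁) (hβ₁ : ∀ x, ∫⁻ μ, lin (fun _ => 1) μ ∂(B x) ≤ β₁)
    {Q Q' : ℝ≥0 → Kernel E E}
    (hQ : IsPerturbedSemigroup X (fun x => c x + β₁) (meanKernel c β₁ B) Q)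
    (hQ' : IsPerturbedSemigroup X (fun x => c x + β₁) (meanKernel c β₁ B) Q') : Q = Q' := by
  ext t x A hA
  have hf : IsBoundedPosMeasurable (A.indicator (1 : E → ℝ≥0∞)) :=
    ⟨measurable_one.indicator hA, 1, fun x => by
      simpa using Set.indicator_le_self' (s := A) (f := (1 : E → ℝ≥0∞)) (fun _ _ => zero_le) x⟩
  rw [← lintegral_indicator_one hA, ← lintegral_indicator_one hA]
  exact le_antisymm (hQ.lintegral_le hc hM hpos hβ₁ hQ' hf t x)
    (hQ'.lintegral_le hc hM hpos hβ₁ hQ hf t x)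

/-- The first moments of the branching semigroup are given by the perturbed semigroup. -/
theorem exp_mul_lintegral_lin {β₁ : ℝ≥0} (hc : Measurable c) (hM : ∀ x, c x ≤ M) (hpos : 0 < β₁)
    (hβ₁ : ∀ x, ∫⁻ μ, lin (fun _ => 1) μ ∂(B x) ≤ β₁) (hcβ : ∀ x, c x * β₁ ≤ c x + β₁)
    {H : ℝ≥0 → Kernel (FinConf E) (FinConf E)} (hH : IsBranchingSemigroup X c B H)
    {Q : ℝ≥0 → Kernel E E}
    (hQ : IsPerturbedSemigroup X (fun x => c x + β₁) (meanKernel c β₁ B) Q)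
    {f : E → ℝ≥0∞} (hf : Measurable f) (t : ℝ≥0) (μ : FinConf E) :
    ENNReal.ofReal (Real.exp (-((β₁ : ℝ) * t))) * ∫⁻ ν, lin f ν ∂(H t μ) =
      lin (fun x => ∫⁻ y, f y ∂(Q t x)) μ := by
  -- The identity is built into the moments of the constructed `κ`. Uniqueness carries it to the
  -- given `Q`, and to `H` through the multiplicative functions.
  obtain ⟨κ, hκ⟩ := X.exists_branching_limit hc B hM
  have hbr := isBranchingSemigroup_branchingFamily hc hM hκ
  have hQκ := hQ.eq hc hM hpos hβ₁ (isPerturbedSemigroup_momentFamily hc hM hpos hβ₁ hcβ hκ)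
  have h1 := hH.apply_dirac_univ hc hM hβ₁ t
  have h1' := hbr.apply_dirac_univ hc hM hβ₁ t
  have hdirac : ∀ x, ∫⁻ ν, lin f ν ∂(H t (dirac x)) = ∫⁻ ν, lin f ν ∂(κ.kernel (t, x)) := by
    intro x
    have := (hH.branching t).isProbabilityMeasure h1 (dirac x)
    have := (hbr.branching t).isProbabilityMeasure h1' (dirac x)
    have hmult : ∀ φ : E → ℝ≥0∞, Measurable φ → (∀ x, φ x ≤ 1) →
        ∫⁻ μ, mult φ μ ∂(H t (dirac x)) = ∫⁻ μ, mult φ μ ∂(branchingFamily κ t (dirac x)) :=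
      fun φ hφ hφ1 => le_antisymm (hH.lintegral_mult_le hc hM hβ₁ hbr hφ hφ1 t x)
        (hbr.lintegral_mult_le hc hM hβ₁ hH hφ hφ1 t x)
    rw [← branchExt_dirac (fun z => κ.kernel (t, z)) x]
    exact le_antisymm (lintegral_lin_le_of_mult _ _ hmult hf)
      (lintegral_lin_le_of_mult _ _ (fun φ hφ hφ1 => (hmult φ hφ hφ1).symm) hf)
  rw [(hH.branching t).lintegral_lin h1 hf, ← lin_const_mul]
  simp_rw [hdirac, hQκ, lintegral_momentFamily _ _ _ _ hf]

end BorelRightProcess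

/-! ### Laplace transforms -/

theorem lintegral_Ici_comp_mul {a : ℝ} (ha : 0 < a) {F : ℝ → ℝ≥0∞} (hF : Measurable F) :
    ENNReal.ofReal a * ∫⁻ t in Set.Ici (0 : ℝ), F (a * t) = ∫⁻ s in Set.Ici (0 : ℝ), F s := by
  have hG : Measurable ((Set.Ici (0 : ℝ)).indicator F) := hF.indicator measurableSet_Ici
  rw [← lintegral_indicator measurableSet_Ici, ← lintegral_indicator measurableSet_Ici]
  conv_rhs => rw [← Real.smul_map_volume_mul_left ha.ne', lintegral_smul_measure,
    lintegral_map hG (measurable_const_mul a), abs_of_pos ha]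
  rw [smul_eq_mul]
  congr 1
  refine lintegral_congr fun t => ?_
  simp only [Set.indicator, Set.mem_Ici, mul_nonneg_iff_of_pos_left ha]

theorem lintegral_Ici_exp_neg :
    ∫⁻ s in Set.Ici (0 : ℝ), ENNReal.ofReal (Real.exp (-s)) = 1 := by
  rw [← restrict_Ioi_eq_restrict_Ici, ← ofReal_integral_eq_lintegral_ofReal
    (integrableOn_exp_neg_Ioi 0) (Eventually.of_forall fun s => (Real.exp_pos _).le),
    integral_exp_neg_Ioi]
  simp

theorem mul_lintegral_Ici_exp_le_one (β α : ℝ≥0) :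
    (α : ℝ≥0∞) * ∫⁻ t in Set.Ici (0 : ℝ), ENNReal.ofReal (Real.exp (-(((β + α : ℝ≥0) : ℝ) * t)))
      ≤ 1 := by
  rcases eq_or_ne α 0 with rfl | hα
  · simp
  have hα' : (0 : ℝ) < α := by positivity
  have hm : Measurable fun s : ℝ => ENNReal.ofReal (Real.exp (-s)) := by fun_prop
  have := lintegral_Ici_comp_mul hα' hm
  rw [lintegral_Ici_exp_neg, ENNReal.ofReal_coe_nnreal] at this
  rw [← this]
  refine mul_le_mul_right (setLIntegral_mono' measurableSet_Ici fun t ht => ?_) _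
  have ht : (0 : ℝ) ≤ t := ht
  gcongr
  simp

/-- The Abelian theorem for Laplace transforms. -/
theorem tendsto_mul_laplace (β : ℝ≥0) {g : ℝ≥0 → ℝ≥0∞} (hg : Measurable g) {K : ℝ≥0}
    (hK : ∀ t, g t ≤ K) {l : ℝ≥0∞} (hl : Tendsto g (𝓝 0) (𝓝 l)) :
    Tendsto (fun α : ℝ≥0 => (α : ℝ≥0∞) * ∫⁻ t in Set.Ici (0 : ℝ),
      ENNReal.ofReal (Real.exp (-(((β + α : ℝ≥0) : ℝ) * t))) * g t.toNNReal) atTop (𝓝 l) := by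
  -- The substitution `t = s/α` leaves the fixed weight `exp (-s)` as dominating function, while `g`
  -- is evaluated ever closer to `0`.
  let G : ℝ≥0 → ℝ → ℝ≥0∞ := fun α s =>
    ENNReal.ofReal (Real.exp (-(((β : ℝ) / α + 1) * s))) * g (s / α).toNNReal
  have hG : ∀ α, Measurable (G α) := fun α => by
    have : Measurable fun s : ℝ => g (s / α).toNNReal :=
      hg.comp (measurable_real_toNNReal.comp (measurable_id.div_const _))
    fun_prop
  have hlim : Tendsto (fun α => ∫⁻ s in Set.Ici (0 : ℝ), G α s) atTop
      (𝓝 (∫⁻ s in Set.Ici (0 : ℝ), ENNReal.ofReal (Real.exp (-s)) * l)) := by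
    refine tendsto_lintegral_filter_of_dominated_convergence
      (fun s => ENNReal.ofReal (Real.exp (-s)) * K)
      (Eventually.of_forall hG) (Eventually.of_forall fun α => ?_) ?_
      (Eventually.of_forall fun s => ?_)
    · refine (ae_restrict_iff' measurableSet_Ici).2 (Eventually.of_forall fun s hs => ?_)
      have hs : (0 : ℝ) ≤ s := hs
      simp only [G]
      gcongr
      · have : 0 ≤ (β : ℝ) / α * s := by positivity
        linarith
      · exact hK _
    · rw [lintegral_mul_const' _ _ ENNReal.coe_ne_top, lintegral_Ici_exp_neg, one_mul]
      exact ENNReal.coe_ne_top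
    · have hinv : ∀ a : ℝ, Tendsto (fun α : ℝ≥0 => a / (α : ℝ)) atTop (𝓝 0) := fun a =>
        tendsto_const_nhds.div_atTop (NNReal.tendsto_coe_atTop.2 tendsto_id)
      refine ENNReal.Tendsto.mul ?_ (Or.inr ?_) ?_ (Or.inr ENNReal.ofReal_ne_top)
      · refine ENNReal.tendsto_ofReal (Real.continuous_exp.continuousAt.tendsto.comp ?_)
        have := (((hinv β).add_const 1).mul_const s).neg
        simpa using this
      · exact ne_top_of_le_ne_top ENNReal.coe_ne_top (le_of_tendsto hl (Eventually.of_forall hK))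
      · refine hl.comp ?_
        have := (continuous_real_toNNReal.tendsto 0).comp (hinv s)
        simpa [Function.comp_def] using this
  rw [lintegral_mul_const _ (by fun_prop), lintegral_Ici_exp_neg, one_mul] at hlim
  refine hlim.congr' ?_
  filter_upwards [eventually_gt_atTop 0] with α hα
  have hα' : (0 : ℝ) < α := by positivity
  rw [← lintegral_Ici_comp_mul hα' (hG α), ENNReal.ofReal_coe_nnreal]
  congr 1
  refine lintegral_congr fun t => ?_
  simp only [G]
  rw [mul_div_cancel_left₀ _ hα'.ne']
  congr 4
  push_cast
  field_simp

/-! ### Excessive functions -/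

section Potential

variable {S : Type*} [MeasurableSpace S] {P : ℝ≥0 → Kernel S S}

theorem kernelResolvent_mono (α : ℝ≥0) {f g : S → ℝ≥0∞} (h : ∀ x, f x ≤ g x) (x : S) :
    kernelResolvent P α f x ≤ kernelResolvent P α g x :=
  lintegral_mono fun _ => mul_le_mul_right (lintegral_mono h) _

theorem kernelResolvent_const_mul (α : ℝ≥0) {a : ℝ≥0∞} (ha : a ≠ ∞) (f : S → ℝ≥0∞) (x : S) :
    kernelResolvent P α (fun y => a * f y) x = a * kernelResolvent P α f x := by
  rw [kernelResolvent, kernelResolvent, ← lintegral_const_mul' _ _ ha]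
  refine lintegral_congr fun t => ?_
  rw [lintegral_const_mul' _ _ ha, mul_left_comm]

theorem kernelResolvent_add (α : ℝ≥0) {f : S → ℝ≥0∞} (hf : Measurable f) (g : S → ℝ≥0∞) {x : S}
    (hfx : Measurable fun t : ℝ≥0 => ∫⁻ y, f y ∂(P t x)) :
    kernelResolvent P α (fun y => f y + g y) x =
      kernelResolvent P α f x + kernelResolvent P α g x := by
  simp_rw [kernelResolvent, lintegral_add_left hf, mul_add]
  refine lintegral_add_left ?_ _
  have := hfx.comp measurable_real_toNNReal
  fun_prop

theorem IsExcessive.add {β : ℝ≥0} {u v : S → ℝ≥0∞} (hu : IsExcessive P β u)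
    (hv : IsExcessive P β v) (hum : ∀ x, Measurable fun t : ℝ≥0 => ∫⁻ y, u y ∂(P t x)) :
    IsExcessive P β (fun x => u x + v x) := by
  refine ⟨hu.1.add hv.1, fun α hα x => ?_, fun x => ?_⟩
  · rw [kernelResolvent_add _ hu.1 _ (hum x), mul_add]
    exact add_le_add (hu.2.1 α hα x) (hv.2.1 α hα x)
  · simp_rw [kernelResolvent_add _ hu.1 _ (hum x), mul_add]
    exact (hu.2.2 x).add (hv.2.2 x)

/-- An excessive function for a semigroup which is close to `P` for small times. -/
theorem IsExcessive.of_close {P' : ℝ≥0 → Kernel S S} {β C D K : ℝ≥0} {u : S → ℝ≥0∞}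
    (hu : IsExcessive P β u) (hK : ∀ t x, ∫⁻ y, u y ∂(P t x) ≤ K)
    (hle : ∀ (t : ℝ≥0) x,
      ENNReal.ofReal (Real.exp (-((C : ℝ) * t))) * ∫⁻ y, u y ∂(P' t x) ≤ ∫⁻ y, u y ∂(P t x))
    (hge : ∀ (t : ℝ≥0) x, ∫⁻ y, u y ∂(P t x) ≤
      ENNReal.ofReal (Real.exp (-((C : ℝ) * t))) * ∫⁻ y, u y ∂(P' t x) + (D * t : ℝ≥0)) :
    IsExcessive P' (β + C) u := by
  have hexp : ∀ (α : ℝ≥0) (t : ℝ), t ∈ Set.Ici (0 : ℝ) → ∀ x,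
      ENNReal.ofReal (Real.exp (-(((β + C + α : ℝ≥0) : ℝ) * t))) * ∫⁻ y, u y ∂(P' t.toNNReal x) =
      ENNReal.ofReal (Real.exp (-(((β + α : ℝ≥0) : ℝ) * t))) *
        (ENNReal.ofReal (Real.exp (-((C : ℝ) * t.toNNReal))) * ∫⁻ y, u y ∂(P' t.toNNReal x)) := by
    intro α t ht x
    rw [← mul_assoc, ← ENNReal.ofReal_mul (Real.exp_pos _).le, ← Real.exp_add,
      Real.coe_toNNReal t ht]
    congr 3
    push_cast
    ring
  have hmono : ∀ α x, kernelResolvent P' (β + C + α) u x ≤ kernelResolvent P (β + α) u x :=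
    fun α x => setLIntegral_mono' measurableSet_Ici fun t ht => by
      rw [hexp α t ht x]
      gcongr
      exact hle _ _
  refine ⟨hu.1, fun α hα x => (mul_le_mul_right (hmono α x) _).trans (hu.2.1 α hα x),
    fun x => ?_⟩
  -- The error is capped at `K` to be bounded; it still vanishes at time `0`, so the Abelian theorem
  -- makes its contribution negligible.
  let g : ℝ≥0 → ℝ≥0∞ := fun t => min ((D * t : ℝ≥0) : ℝ≥0∞) K
  have hg : Measurable g := by fun_prop
  let R : ℝ≥0 → ℝ≥0∞ := fun α => (α : ℝ≥0∞) * ∫⁻ t in Set.Ici (0 : ℝ),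
      ENNReal.ofReal (Real.exp (-(((β + α : ℝ≥0) : ℝ) * t))) * g t.toNNReal
  have hR : Tendsto R atTop (𝓝 0) := by
    refine tendsto_mul_laplace β hg (K := K) (fun t => min_le_right _ _) ?_
    have : Continuous g := by
      simp only [g]
      exact (ENNReal.continuous_coe.comp (continuous_const_mul D)).min continuous_const
    simpa [g] using this.tendsto 0
  have hbound : ∀ α x, kernelResolvent P (β + α) u x ≤ kernelResolvent P' (β + C + α) u x +
      ∫⁻ t in Set.Ici (0 : ℝ),
        ENNReal.ofReal (Real.exp (-(((β + α : ℝ≥0) : ℝ) * t))) * g t.toNNReal := by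
    intro α x
    have hgm := hg.comp measurable_real_toNNReal
    rw [kernelResolvent, kernelResolvent, ← lintegral_add_right _ (by fun_prop)]
    refine setLIntegral_mono' measurableSet_Ici fun t ht => ?_
    rw [hexp α t ht x, ← mul_add]
    gcongr
    simp only [g]
    rw [← min_add_add_left]
    exact le_min (hge _ _) ((hK _ _).trans le_add_self)
  have hlow : Tendsto (fun α : ℝ≥0 => (α : ℝ≥0∞) * kernelResolvent P (β + α) u x - R α) atTop
      (𝓝 (u x)) := by
    simpa using ENNReal.Tendsto.sub (hu.2.2 x) hR (Or.inr ENNReal.zero_ne_top)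
  refine tendsto_of_tendsto_of_tendsto_of_le_of_le hlow (hu.2.2 x) (fun α => ?_)
    fun α => mul_le_mul_right (hmono α x) _
  simp only [R, tsub_le_iff_right, ← mul_add]
  gcongr
  exact hbound α x

end Potential

/-! ### Limits over configurations, a tangent inequality and measurability -/

open FinConf

theorem FinConf.tendsto_lin {E ι : Type*} {l : Filter ι} {F : ι → E → ℝ≥0∞} {f : E → ℝ≥0∞}
    (h : ∀ x, Tendsto (fun i => F i x) l (𝓝 (f x))) (μ : FinConf E) :
    Tendsto (fun i => lin (F i) μ) l (𝓝 (lin f μ)) := by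
  induction μ using FinConf.induction with
  | zero => simpa using tendsto_const_nhds
  | add x μ ih => simpa using (h x).add ih

theorem FinConf.tendsto_mult {E ι : Type*} {l : Filter ι} {F : ι → E → ℝ≥0∞} {f : E → ℝ≥0∞}
    (hf : ∀ x, f x ≤ 1) (h : ∀ x, Tendsto (fun i => F i x) l (𝓝 (f x))) (μ : FinConf E) :
    Tendsto (fun i => mult (F i) μ) l (𝓝 (mult f μ)) := by
  induction μ using FinConf.induction with
  | zero => simpa using tendsto_const_nhds
  | add x μ ih =>
    simp only [mult_add, mult_dirac]
    exact ENNReal.Tendsto.mul (h x)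
      (Or.inr (ne_top_of_le_ne_top ENNReal.one_ne_top (mult_le_one hf μ))) ih
      (Or.inr (ne_top_of_le_ne_top ENNReal.one_ne_top (hf x)))

theorem FinConf.lintegral_lin_comm {E α : Type*} [MeasurableSpace α] (m : Measure α)
    {F : α → E → ℝ≥0∞} (hF : ∀ x, Measurable fun a => F a x) (μ : FinConf E) :
    ∫⁻ a, lin (F a) μ ∂m = lin (fun x => ∫⁻ a, F a x ∂m) μ := by
  induction μ using FinConf.induction with
  | zero => simp
  | add x μ ih =>
    simp only [lin_add, lin_dirac]
    rw [lintegral_add_left (hF x), ih]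

/-- The tangent inequality for `r ↦ 1 - exp (-r)`. -/
theorem exists_one_sub_expNeg_le (l : ℝ≥0) : ∃ a b : ℝ≥0, (∀ r, 1 - expNeg r ≤ a + b * r) ∧
    ((a + b * l : ℝ≥0) : ℝ≥0∞) = 1 - expNeg l := by
  -- The tangent at `l` has slope `exp (-l)` and this intercept. Its positivity, a form of `1 + l ≤
  -- exp l`, allows both coefficients to be taken in `ℝ≥0`.
  have ha : 0 ≤ 1 - Real.exp (-(l : ℝ)) - Real.exp (-(l : ℝ)) * l := by
    have h1 := Real.add_one_le_exp (l : ℝ)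
    have h2 : Real.exp (-(l : ℝ)) * Real.exp l = 1 := by rw [← Real.exp_add]; simp
    nlinarith [Real.exp_pos (-(l : ℝ))]
  have key : ∀ r : ℝ≥0, 1 - expNeg r = ENNReal.ofReal (1 - Real.exp (-(r : ℝ))) := fun r => by
    rw [expNeg_coe, ENNReal.ofReal_sub _ (Real.exp_pos _).le, ENNReal.ofReal_one]
  obtain ⟨a, ha'⟩ : ∃ a : ℝ≥0, (a : ℝ) = 1 - Real.exp (-(l : ℝ)) - Real.exp (-(l : ℝ)) * l :=
    ⟨⟨_, ha⟩, rfl⟩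
  obtain ⟨b, hb⟩ : ∃ b : ℝ≥0, (b : ℝ) = Real.exp (-(l : ℝ)) :=
    ⟨⟨_, (Real.exp_pos (-(l : ℝ))).le⟩, rfl⟩
  refine ⟨a, b, fun r => ?_, ?_⟩
  · induction r with
    | top =>
      rw [ENNReal.mul_top (by
        rw [Ne, ENNReal.coe_eq_zero, ← NNReal.coe_eq_zero, hb]
        exact (Real.exp_pos _).ne')]
      simp
    | coe r =>
      rw [key, ← ENNReal.coe_mul, ← ENNReal.coe_add]
      refine ENNReal.ofReal_le_of_le_toReal ?_
      rw [ENNReal.coe_toReal]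
      push_cast
      rw [ha', hb]
      have h1 := Real.add_one_le_exp (-((r : ℝ) - l))
      have h2 : Real.exp (-(l : ℝ)) * Real.exp (-((r : ℝ) - l)) = Real.exp (-(r : ℝ)) := by
        rw [← Real.exp_add]; ring_nf
      nlinarith [Real.exp_pos (-(l : ℝ))]
  · rw [key, ← ENNReal.ofReal_coe_nnreal]
    congr 1
    push_cast
    rw [ha', hb]
    ring

section Measurability

variable {E : Type*} [TopologicalSpace E] [LusinSpace E] [MeasurableSpace E] [BorelSpace E]
  [Nonempty E] {Ω : Type*} [MeasurableSpace Ω] {X : BorelRightProcess E Ω} {c k : E → ℝ≥0}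
  {B : Kernel E (FinConf E)} {K : (E → ℝ≥0∞) → E → ℝ≥0∞}

omit [LusinSpace E] [BorelSpace E] [Nonempty E] in
-- Truncation at `n` removes the boundedness, as Lyapunov functions may be unbounded or infinite.
theorem IsPerturbedSemigroup.measurable_lintegral {Q : ℝ≥0 → Kernel E E}
    (hQ : IsPerturbedSemigroup X k K Q) {f : E → ℝ≥0∞} (hf : Measurable f) :
    Measurable fun p : ℝ≥0 × E => ∫⁻ y, f y ∂(Q p.1 p.2) := by
  have : ∀ p : ℝ≥0 × E, ∫⁻ y, f y ∂(Q p.1 p.2) = ⨆ n : ℕ, ∫⁻ y, min (f y) n ∂(Q p.1 p.2) :=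
    fun p => by
      rw [← lintegral_iSup (fun n => hf.min measurable_const)
        fun m n hmn y => min_le_min_left _ (by exact_mod_cast hmn)]
      refine lintegral_congr fun y => ?_
      refine le_antisymm ?_ (iSup_le fun n => min_le_left _ _)
      refine le_of_forall_lt fun a ha => ?_
      obtain ⟨n, hn⟩ := ENNReal.exists_nat_gt ha.ne_top
      exact (lt_min ha hn).trans_le (le_iSup (fun n : ℕ => min (f y) (n : ℝ≥0∞)) n)
  simp_rw [this]
  exact Measurable.iSup fun n => hQ.measurable _
    ⟨hf.min measurable_const, n, fun x => (min_le_right _ _).trans (by simp)⟩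

theorem IsBranchingSemigroup.measurable_lintegral_mult {H : ℝ≥0 → Kernel (FinConf E) (FinConf E)}
    (hH : IsBranchingSemigroup X c B H) (h1 : ∀ t x, H t (dirac x) Set.univ = 1)
    {φ : E → ℝ≥0∞} (hφ : Measurable φ) (hle : ∀ x, φ x ≤ 1) (μ : FinConf E) :
    Measurable fun t : ℝ≥0 => ∫⁻ ν, mult φ ν ∂(H t μ) := by
  simp_rw [fun t => (hH.branching t).lintegral_mult (h1 t) hφ μ]
  induction μ using FinConf.induction with
  | zero => simp
  | add x μ ih =>
    simp only [mult_add, mult_dirac]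
    exact ((hH.measurable φ hφ hle).comp (measurable_id.prodMk measurable_const)).mul ih

end Measurability

/-! ### Small times -/

namespace BorelRightProcess

variable {E : Type*} [TopologicalSpace E] [MeasurableSpace E]
  {Ω : Type*} [MeasurableSpace Ω] {X : BorelRightProcess E Ω} {c : E → ℝ≥0}

theorem expNeg_mul_le_weight {M : ℝ≥0} (hM : ∀ x, c x ≤ M) (t : ℝ≥0) (ω : X.Path) :
    expNeg ((M * t : ℝ≥0) : ℝ≥0∞) ≤ X.weight c t ω := by
  refine expNeg_antitone ?_
  calc ∫⁻ s in Set.Icc (0 : ℝ) t, (c (X.coord s.toNNReal ω) : ℝ≥0∞)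
      ≤ ∫⁻ _ in Set.Icc (0 : ℝ) t, (M : ℝ≥0∞) :=
        lintegral_mono fun s => ENNReal.coe_le_coe.2 (hM _)
    _ = ((M * t : ℝ≥0) : ℝ≥0∞) := by simp

theorem expNeg_mul_le_killed {M : ℝ≥0} (hM : ∀ x, c x ≤ M) (t : ℝ≥0) {f : E → ℝ≥0∞}
    (hf : Measurable f) (x : E) :
    expNeg ((M * t : ℝ≥0) : ℝ≥0∞) * ∫⁻ y, f y ∂(X.T t x) ≤ X.killed c t f x := by
  rw [← X.lintegral_X x t hf, killed_eq, ← lintegral_const_mul' _ _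
    (ne_top_of_le_ne_top ENNReal.one_ne_top (expNeg_le_one _))]
  exact lintegral_mono fun ω => mul_le_mul_left (expNeg_mul_le_weight hM t _) _

theorem killed_le_lintegral (c : E → ℝ≥0) (t : ℝ≥0) {f : E → ℝ≥0∞}
    (hf : Measurable f) (x : E) : X.killed c t f x ≤ ∫⁻ y, f y ∂(X.T t x) := by
  rw [← X.lintegral_X x t hf, killed_eq]
  exact lintegral_mono fun ω => mul_le_of_le_one_left' (expNeg_le_one _)

theorem duhamel_le (c : E → ℝ≥0) {g : ℝ≥0 → E → ℝ≥0∞} {D : ℝ≥0} (h : ∀ s y, g s y ≤ D) (t : ℝ≥0)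
    (x : E) : X.duhamel c g t x ≤ ((D * t : ℝ≥0) : ℝ≥0∞) := by
  calc X.duhamel c g t x ≤ ∫⁻ _ in Set.Icc (0 : ℝ) t, (D : ℝ≥0∞) :=
        lintegral_mono fun s => X.killed_le_of_bound (h _) _ _
    _ = ((D * t : ℝ≥0) : ℝ≥0∞) := by simp

/-- The transition function is right continuous at time zero on bounded continuous functions of
excessive functions. -/
theorem tendsto_lintegral_excessive {γ : ℝ≥0} (hγ : 0 < γ) {u : E → ℝ≥0∞}
    (hu : IsExcessive X.T γ u) {F : ℝ≥0∞ → ℝ≥0∞} (hF : Continuous F) (hF1 : ∀ r, F r ≤ 1) (x : E) :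
    Tendsto (fun t => ∫⁻ y, F (u y) ∂(X.T t x)) (𝓝 0) (𝓝 (F (u x))) := by
  have := X.prob x
  have hFu : Measurable fun y => F (u y) := hF.measurable.comp hu.1
  simp_rw [← fun t => X.lintegral_X x t hFu]
  rw [← X.lintegral_start x (g := fun y => F (u y))]
  refine tendsto_lintegral_filter_of_dominated_convergence (fun _ => 1)
    (Eventually.of_forall fun t => hFu.comp (X.measurable_X t))
    (Eventually.of_forall fun t => Eventually.of_forall fun ω => hF1 _) (by simp) ?_
  filter_upwards [X.excessive_right_continuous γ hγ u hu x] with ω hω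
  have h0 := hω 0
  -- At time `0` right continuity is continuity, the half-line being the whole of `ℝ≥0`.
  rw [← bot_eq_zero, Set.Ici_bot, continuousWithinAt_univ, bot_eq_zero] at h0
  exact (hF.tendsto _).comp h0.tendsto

end BorelRightProcess

theorem tendsto_expNeg_mul (M : ℝ≥0) :
    Tendsto (fun t : ℝ≥0 => expNeg ((M * t : ℝ≥0) : ℝ≥0∞)) (𝓝 0) (𝓝 1) := by
  have : Continuous fun t : ℝ≥0 => expNeg ((M * t : ℝ≥0) : ℝ≥0∞) :=
    continuous_expNeg.comp (ENNReal.continuous_coe.comp (continuous_const_mul M))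
  simpa using this.tendsto 0

/-! ### Small-time continuity and excessive functions on configurations -/

section Excessive

open BorelRightProcess

variable {E : Type*} [TopologicalSpace E] [LusinSpace E] [MeasurableSpace E] [BorelSpace E]
  [Nonempty E] {Ω : Type*} [MeasurableSpace Ω] {X : BorelRightProcess E Ω} {c : E → ℝ≥0}
  {B : Kernel E (FinConf E)} {M β₁ : ℝ≥0}

/-- The generating functionals of the branching semigroup are continuous at time zero. -/
theorem IsBranchingSemigroup.tendsto_lintegral_mult [IsMarkovKernel B]
    {H : ℝ≥0 → Kernel (FinConf E) (FinConf E)}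
    (hH : IsBranchingSemigroup X c B H) (h1 : ∀ t x, H t (dirac x) Set.univ = 1)
    (hM : ∀ x, c x ≤ M) {φ : E → ℝ≥0∞} (hφ : Measurable φ) (hle : ∀ x, φ x ≤ 1)
    (hT : ∀ x, Tendsto (fun t => ∫⁻ y, φ y ∂(X.T t x)) (𝓝 0) (𝓝 (φ x))) (μ : FinConf E) :
    Tendsto (fun t => ∫⁻ ν, mult φ ν ∂(H t μ)) (𝓝 0) (𝓝 (mult φ μ)) := by
  simp_rw [fun t => (hH.branching t).lintegral_mult (h1 t) hφ μ]
  refine tendsto_mult hle (fun x => ?_) μ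
  -- Squeeze between `exp (-Mt) T_t φ` and `T_t φ + M t`: at most the mass `M t` comes from
  -- branching before `t`.
  have hlow : Tendsto (fun t : ℝ≥0 => expNeg ((M * t : ℝ≥0) : ℝ≥0∞) * ∫⁻ y, φ y ∂(X.T t x)) (𝓝 0)
      (𝓝 (φ x)) := by
    simpa using ENNReal.Tendsto.mul (tendsto_expNeg_mul M)
      (Or.inr (ne_top_of_le_ne_top ENNReal.one_ne_top (hle x))) (hT x) (Or.inr ENNReal.one_ne_top)
  have hup : Tendsto (fun t : ℝ≥0 => ∫⁻ y, φ y ∂(X.T t x) + ((M * t : ℝ≥0) : ℝ≥0∞)) (𝓝 0)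
      (𝓝 (φ x)) := by
    have : Continuous fun t : ℝ≥0 => ((M * t : ℝ≥0) : ℝ≥0∞) :=
      ENNReal.continuous_coe.comp (continuous_const_mul M)
    simpa using (hT x).add (this.tendsto 0)
  refine tendsto_of_tendsto_of_tendsto_of_le_of_le hlow hup (fun t => ?_) fun t => ?_
  · simp only
    rw [hH.equation φ hφ hle]
    exact (expNeg_mul_le_killed hM t hφ x).trans le_self_add
  · simp only
    rw [hH.equation φ hφ hle]
    refine add_le_add (killed_le_lintegral c t hφ x) (duhamel_le (X := X) c
      (g := fun s y => (c y : ℝ≥0∞) *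
        ∫⁻ ν, mult (fun z => ∫⁻ μ, mult φ μ ∂(H s (dirac z))) ν ∂(B y))
      (fun s y => ?_) t x)
    calc _ ≤ (M : ℝ≥0∞) * ∫⁻ _, 1 ∂(B y) := by
          gcongr
          · exact hM y
          · refine mult_le_one (fun z => ?_) _
            exact (lintegral_mono fun μ => mult_le_one hle μ).trans
              (by simpa using (hH.branching s).1 (dirac z))
      _ = M := by simp

variable {H : ℝ≥0 → Kernel (FinConf E) (FinConf E)} {Q : ℝ≥0 → Kernel E E}

omit [LusinSpace E] [BorelSpace E] [Nonempty E] in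
/-- The resolvents of the two semigroups are intertwined by `f ↦ lin f`. -/
theorem kernelResolvent_lin
    (h : ∀ f : E → ℝ≥0∞, Measurable f → ∀ (t : ℝ≥0) μ,
      ENNReal.ofReal (Real.exp (-((β₁ : ℝ) * t))) * ∫⁻ ν, lin f ν ∂(H t μ) =
        lin (fun x => ∫⁻ y, f y ∂(Q t x)) μ)
    {k : E → ℝ≥0} {K : (E → ℝ≥0∞) → E → ℝ≥0∞} (hQ : IsPerturbedSemigroup X k K Q)
    (γ : ℝ≥0) {f : E → ℝ≥0∞} (hf : Measurable f) (μ : FinConf E) :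
    kernelResolvent H (β₁ + γ) (lin f) μ = lin (kernelResolvent Q γ f) μ := by
  have hm : ∀ x, Measurable fun t : ℝ => ∫⁻ y, f y ∂(Q t.toNNReal x) := fun x =>
    (hQ.measurable_lintegral hf).comp (measurable_real_toNNReal.prodMk measurable_const)
  unfold kernelResolvent
  rw [← lintegral_lin_comm _ fun x => by have := hm x; fun_prop]
  refine setLIntegral_congr_fun measurableSet_Ici fun t ht => ?_
  rw [lin_const_mul, ← h f hf, ← mul_assoc, ← ENNReal.ofReal_mul (Real.exp_pos _).le,
    ← Real.exp_add, Real.coe_toNNReal t ht]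
  congr 3
  push_cast
  ring

/-- The resolvent of `lin u` is `lin` of the resolvent of `u`; inequalities and limits pass through
the finite sum, and are recovered on Dirac configurations. -/
theorem isExcessive_lin_iff
    (h : ∀ f : E → ℝ≥0∞, Measurable f → ∀ (t : ℝ≥0) μ,
      ENNReal.ofReal (Real.exp (-((β₁ : ℝ) * t))) * ∫⁻ ν, lin f ν ∂(H t μ) =
        lin (fun x => ∫⁻ y, f y ∂(Q t x)) μ)
    {k : E → ℝ≥0} {K : (E → ℝ≥0∞) → E → ℝ≥0∞} (hQ : IsPerturbedSemigroup X k K Q)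
    {β : ℝ≥0} {u : E → ℝ≥0∞} (hu : Measurable u) :
    IsExcessive H (β₁ + β) (lin u) ↔ IsExcessive Q β u := by
  have key : ∀ (α : ℝ≥0) μ, (α : ℝ≥0∞) * kernelResolvent H (β₁ + β + α) (lin u) μ =
      lin (fun x => (α : ℝ≥0∞) * kernelResolvent Q (β + α) u x) μ := fun α μ => by
    rw [add_assoc, kernelResolvent_lin h hQ _ hu, lin_const_mul]
  constructor
  · intro hl
    refine ⟨hu, fun α hα x => ?_, fun x => ?_⟩
    · have := hl.2.1 α hα (dirac x)
      rwa [key, lin_dirac, lin_dirac] at this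
    · have := hl.2.2 (dirac x)
      simpa only [key, lin_dirac] using this
  · intro hl
    refine ⟨measurable_lin hu, fun α hα μ => ?_, fun μ => ?_⟩
    · rw [key]
      exact lin_mono (hl.2.1 α hα) μ
    · simp_rw [key]
      exact tendsto_lin hl.2.2 μ

/-- The linear function is a limit of the functions `1 - exp`. -/
theorem isExcessive_lin_of_one_sub_expNeg (hH : IsBranchingSemigroup X c B H)
    (h1 : ∀ t x, H t (dirac x) Set.univ = 1) {β : ℝ≥0} {u : E → ℝ≥0∞} (hu : Measurable u)
    (h : ∀ α : ℝ≥0, 0 < α → IsExcessive H β (fun μ => 1 - expNeg (lin (fun x => α * u x) μ))) :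
    IsExcessive H β (lin u) := by
  let F : ℕ → FinConf E → ℝ≥0∞ := fun n μ =>
    ((n : ℝ≥0∞) + 1) * (1 - expNeg (((n : ℝ≥0∞) + 1)⁻¹ * lin u μ))
  have hlin : ∀ (n : ℕ) μ, ((n : ℝ≥0∞) + 1)⁻¹ * lin u μ =
      lin (fun x => (((n : ℝ≥0) + 1)⁻¹ : ℝ≥0) * u x) μ := fun n μ => by
    rw [lin_const_mul, ENNReal.coe_inv (by positivity)]
    simp
  have hc : ∀ n : ℕ, (n : ℝ≥0∞) + 1 ≠ ∞ := fun n => by simp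
  have hexc : ∀ n : ℕ, IsExcessive H β fun μ => 1 - expNeg (((n : ℝ≥0∞) + 1)⁻¹ * lin u μ) :=
    fun n => by
      simp_rw [hlin]
      exact h _ (by positivity)
  have hF : ∀ n, Measurable (F n) := fun n => (hexc n).1.const_mul _
  have hFle : ∀ n μ, F n μ ≤ lin u μ := fun n μ => mul_one_sub_expNeg_le n _
  have hFlim : ∀ μ, Tendsto (fun n => F n μ) atTop (𝓝 (lin u μ)) := fun μ =>
    tendsto_mul_one_sub_expNeg _
  have hFres : ∀ (α γ : ℝ≥0) n μ, (α : ℝ≥0∞) * kernelResolvent H γ (F n) μ = ((n : ℝ≥0∞) + 1) *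
      (α * kernelResolvent H γ (fun μ => 1 - expNeg (((n : ℝ≥0∞) + 1)⁻¹ * lin u μ)) μ) :=
    fun α γ n μ => by
      simp only [F]
      rw [kernelResolvent_const_mul _ (hc n), mul_left_comm]
  -- Fatou in the time integral needs measurability in `t`, which for `H` is available through
  -- multiplicative functions.
  have hmeas : ∀ n μ, Measurable fun t : ℝ≥0 => ∫⁻ ν, F n ν ∂(H t μ) := fun n μ => by
    have hg : Measurable fun x => (((n : ℝ≥0) + 1)⁻¹ : ℝ≥0) * u x := hu.const_mul _
    have := fun t => (hH.branching t).isProbabilityMeasure (h1 t) μ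
    simp_rw [F, lintegral_const_mul' _ _ (hc n), hlin, lintegral_one_sub_expNeg_lin _ hg]
    exact (measurable_const.sub (hH.measurable_lintegral_mult h1 (measurable_expNeg.comp hg)
      (fun x => expNeg_le_one _) μ)).const_mul _
  have hfatou : ∀ (γ : ℝ≥0) μ, kernelResolvent H γ (lin u) μ ≤
      liminf (fun n => kernelResolvent H γ (F n) μ) atTop := fun γ μ => by
    calc kernelResolvent H γ (lin u) μ
        ≤ ∫⁻ t in Set.Ici (0 : ℝ), liminf (fun n => ENNReal.ofReal (Real.exp (-((γ : ℝ) * t))) *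
            ∫⁻ ν, F n ν ∂(H t.toNNReal μ)) atTop := by
          refine lintegral_mono fun t => ?_
          rw [ENNReal.liminf_const_mul_of_ne_top ENNReal.ofReal_ne_top]
          gcongr
          calc ∫⁻ ν, lin u ν ∂(H t.toNNReal μ)
              = ∫⁻ ν, liminf (fun n => F n ν) atTop ∂(H t.toNNReal μ) :=
                lintegral_congr fun ν => (hFlim ν).liminf_eq.symm
            _ ≤ _ := lintegral_liminf_le hF
      _ ≤ _ := lintegral_liminf_le fun n => by
          have := (hmeas n μ).comp measurable_real_toNNReal
          fun_prop
  have hsup : ∀ α : ℝ≥0, 0 < α → ∀ μ,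
      (α : ℝ≥0∞) * kernelResolvent H (β + α) (lin u) μ ≤ lin u μ := fun α hα μ => by
    calc (α : ℝ≥0∞) * kernelResolvent H (β + α) (lin u) μ
        ≤ α * liminf (fun n => kernelResolvent H (β + α) (F n) μ) atTop := by
          gcongr; exact hfatou _ _
      _ = liminf (fun n => α * kernelResolvent H (β + α) (F n) μ) atTop :=
          (ENNReal.liminf_const_mul_of_ne_top ENNReal.coe_ne_top).symm
      _ ≤ liminf (fun n => F n μ) atTop := by
          refine liminf_le_liminf (Eventually.of_forall fun n => ?_)
          rw [hFres]
          exact mul_le_mul_right ((hexc n).2.1 α hα μ) _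
      _ = lin u μ := (hFlim μ).liminf_eq
  refine ⟨measurable_lin hu, hsup, fun μ => tendsto_order.2 ⟨fun a ha => ?_, fun a ha => ?_⟩⟩
  -- A single `F n` already exceeds `a` at `μ`; it is a multiple of an excessive function lying
  -- below `lin u`, so its resolvents push those of `lin u` above `a`.
  · obtain ⟨n, hn⟩ := ((hFlim μ).eventually_const_lt ha).exists
    have : Tendsto (fun α : ℝ≥0 => (α : ℝ≥0∞) * kernelResolvent H (β + α) (F n) μ) atTop
        (𝓝 (F n μ)) := by
      simp_rw [hFres]
      exact ENNReal.Tendsto.const_mul ((hexc n).2.2 μ) (Or.inr (hc n))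
    filter_upwards [this.eventually_const_lt hn] with α hα
    exact hα.trans_le (mul_le_mul_right (kernelResolvent_mono _ (hFle n) μ) _)
  · filter_upwards [eventually_gt_atTop 0] with α hα
    exact (hsup α hα μ).trans_lt ha

omit [LusinSpace E] [MeasurableSpace E] [BorelSpace E] [Nonempty E] in
-- Jensen's inequality through the tangent of `1 - exp (-r)` at `r = lin v μ`, which must be finite.
-- The affine majorant is supermedian because the constants and `lin v` are, and it is sharp at `μ`.
theorem mul_kernelResolvent_one_sub_expNeg_le (h1 : ∀ t x, H t x Set.univ ≤ 1) {β : ℝ≥0}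
    {v : E → ℝ≥0∞} (hl : IsExcessive H β (lin v)) {α : ℝ≥0} (hα : 0 < α)
    {μ : FinConf E} (hμ : lin v μ ≠ ∞) :
    α * kernelResolvent H (β + α) (fun ν => 1 - expNeg (lin v ν)) μ ≤ 1 - expNeg (lin v μ) := by
  lift lin v μ to ℝ≥0 using hμ with l hlμ
  obtain ⟨a, b, hab, habl⟩ := exists_one_sub_expNeg_le l
  calc α * kernelResolvent H (β + α) (fun ν => 1 - expNeg (lin v ν)) μ
      ≤ α * ∫⁻ t in Set.Ici (0 : ℝ),
          (a * ENNReal.ofReal (Real.exp (-(((β + α : ℝ≥0) : ℝ) * t))) +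
            b * (ENNReal.ofReal (Real.exp (-(((β + α : ℝ≥0) : ℝ) * t))) *
              ∫⁻ ν, lin v ν ∂(H t.toNNReal μ))) := by
        refine mul_le_mul_right (lintegral_mono fun t => ?_) _
        rw [mul_comm (a : ℝ≥0∞), mul_left_comm, ← mul_add]
        refine mul_le_mul_right ?_ _
        calc ∫⁻ ν, (1 - expNeg (lin v ν)) ∂(H t.toNNReal μ)
            ≤ ∫⁻ ν, (a + b * lin v ν) ∂(H t.toNNReal μ) := lintegral_mono fun ν => hab _
          _ = a * H t.toNNReal μ Set.univ + b * ∫⁻ ν, lin v ν ∂(H t.toNNReal μ) := by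
              rw [lintegral_add_left measurable_const, lintegral_const,
                lintegral_const_mul' _ _ ENNReal.coe_ne_top]
          _ ≤ a + b * ∫⁻ ν, lin v ν ∂(H t.toNNReal μ) := by
              gcongr
              exact mul_le_of_le_one_right' (h1 _ _)
    _ = a * (α * ∫⁻ t in Set.Ici (0 : ℝ),
          ENNReal.ofReal (Real.exp (-(((β + α : ℝ≥0) : ℝ) * t)))) +
          b * (α * kernelResolvent H (β + α) (lin v) μ) := by
        rw [lintegral_add_left (by fun_prop), lintegral_const_mul' _ _ ENNReal.coe_ne_top,
          lintegral_const_mul' _ _ ENNReal.coe_ne_top, mul_add, kernelResolvent, mul_left_comm,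
          mul_left_comm (α : ℝ≥0∞)]
    _ ≤ a * 1 + b * l := by
        gcongr
        · exact mul_lintegral_Ici_exp_le_one β α
        · exact (hl.2.1 α hα μ).trans_eq hlμ.symm
    _ = 1 - expNeg l := by rw [← habl]; push_cast; ring

end Excessive

/-! ### Compact sets of configurations -/

open FinConf BorelRightProcess

/-- The set of the configurations of at most `n` points, all of them in `K`. -/
def FinConf.atMostIn {E : Type*} (K : Set E) (n : ℕ) : Set (FinConf E) :=
  {μ | Multiset.card (α := E) μ ≤ n ∧ ∀ a ∈ (show Multiset E from μ), a ∈ K}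

theorem FinConf.ofTuple_mem_atMostIn {E : Type*} {K : Set E} {n m : ℕ} {x : Fin m → E} :
    ofTuple m x ∈ atMostIn K n ↔ m ≤ n ∧ ∀ i, x i ∈ K := by
  change Multiset.card (List.ofFn x : Multiset E) ≤ n ∧
    (∀ a ∈ (List.ofFn x : Multiset E), a ∈ K) ↔ _
  simp

theorem FinConf.isClosed_atMostIn {E : Type*} [TopologicalSpace E] {K : Set E} (hK : IsClosed K)
    (n : ℕ) : IsClosed (atMostIn K n) := by
  rw [← isOpen_compl_iff, FinConf.isOpen_iff]
  intro m
  rw [Set.preimage_compl, isOpen_compl_iff]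
  have : ofTuple m ⁻¹' atMostIn K n = {x | m ≤ n ∧ ∀ i, x i ∈ K} :=
    Set.ext fun x => ofTuple_mem_atMostIn
  rw [this]
  by_cases h : m ≤ n
  · simp only [h, true_and, Set.ofPred_forall]
    exact isClosed_iInter fun i => hK.preimage (continuous_apply i)
  · simp [h]

/-- The finitely many powers of a compact set have compact images under the quotient maps. -/
theorem FinConf.isCompact_atMostIn {E : Type*} [TopologicalSpace E] {K : Set E} (hK : IsClosed K)
    (hK' : IsCompact K) (n : ℕ) : IsCompact (atMostIn K n) := by
  have : IsCompact (⋃ m ∈ Finset.range (n + 1),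
      ofTuple (E := E) m '' Set.univ.pi fun _ => K) :=
    (Finset.range (n + 1)).isCompact_biUnion fun m _ =>
      (isCompact_univ_pi fun _ => hK').image (continuous_ofTuple m)
  refine this.of_isClosed_subset (isClosed_atMostIn hK n) fun μ hμ => ?_
  obtain ⟨m, x, rfl⟩ := exists_ofTuple μ
  have h := ofTuple_mem_atMostIn.1 hμ
  exact Set.mem_biUnion (Finset.mem_coe.2 (Finset.mem_range.2 (Nat.lt_succ_of_le h.1)))
    ⟨x, fun i _ => h.2 i, rfl⟩

/-- The summand `1` bounds the number of points by `n`, and the summand `u` puts each point in the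
level set `[u ≤ n]`. -/
theorem FinConf.isCompact_closure_lin_le {E : Type*} [TopologicalSpace E] {u : E → ℝ≥0∞} (n : ℕ)
    (hu : IsCompact (closure {x | u x ≤ (n : ℝ≥0∞)})) :
    IsCompact (closure {μ | lin (fun x => 1 + u x) μ ≤ (n : ℝ≥0∞)}) := by
  refine (isCompact_atMostIn isClosed_closure hu n).of_isClosed_subset isClosed_closure
    (closure_minimal (fun μ hμ => ?_) (isClosed_atMostIn isClosed_closure n))
  obtain ⟨m, x, rfl⟩ := exists_ofTuple μ
  have hμ : lin (fun x => 1 + u x) (ofTuple m x) ≤ (n : ℝ≥0∞) := hμ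
  rw [lin_ofTuple, Finset.sum_add_distrib] at hμ
  have hm : (m : ℝ≥0∞) ≤ n := by
    refine le_trans ?_ hμ
    simp
  have hx : ∀ i, u (x i) ≤ n := fun i =>
    (Finset.single_le_sum (f := fun i => u (x i)) (fun _ _ => zero_le) (Finset.mem_univ i)).trans
      (le_add_self.trans hμ)
  have hm' : m ≤ n := by exact_mod_cast hm
  exact ofTuple_mem_atMostIn.2 ⟨hm', fun i => subset_closure (hx i)⟩

/-! ### From the perturbed semigroup to the base process and to exponentials -/

section Excessive

variable {E : Type*} [TopologicalSpace E] [LusinSpace E] [MeasurableSpace E] [BorelSpace E]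
  [Nonempty E] {Ω : Type*} [MeasurableSpace Ω] {X : BorelRightProcess E Ω} {c : E → ℝ≥0}
  {B : Kernel E (FinConf E)} {M β₁ : ℝ≥0}
  {H : ℝ≥0 → Kernel (FinConf E) (FinConf E)} {Q : ℝ≥0 → Kernel E E}

omit [LusinSpace E] [BorelSpace E] [Nonempty E] in
theorem IsPerturbedSemigroup.expNeg_mul_le
    (hQ : IsPerturbedSemigroup X (fun x => c x + β₁) (meanKernel c β₁ B) Q) (hM : ∀ x, c x ≤ M)
    {f : E → ℝ≥0∞} (hf : IsBoundedPosMeasurable f) (t : ℝ≥0) (x : E) :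
    expNeg (((M + β₁) * t : ℝ≥0) : ℝ≥0∞) * ∫⁻ y, f y ∂(X.T t x) ≤ ∫⁻ y, f y ∂(Q t x) := by
  rw [hQ.equation f hf]
  exact (expNeg_mul_le_killed (fun x => add_le_add_left (hM x) β₁) t hf.1 x).trans le_self_add

omit [LusinSpace E] [BorelSpace E] [Nonempty E] in
theorem IsPerturbedSemigroup.lintegral_le_of_bound {k : E → ℝ≥0} {K : (E → ℝ≥0∞) → E → ℝ≥0∞}
    (hQ : IsPerturbedSemigroup X k K Q) {f : E → ℝ≥0∞} {D : ℝ≥0∞} (hD : ∀ x, f x ≤ D) (t : ℝ≥0)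
    (x : E) : ∫⁻ y, f y ∂(Q t x) ≤ D := by
  calc ∫⁻ y, f y ∂(Q t x) ≤ ∫⁻ _, D ∂(Q t x) := lintegral_mono hD
    _ = D * Q t x Set.univ := lintegral_const _
    _ ≤ D := mul_le_of_le_one_right' (hQ.subMarkov t x)

omit [LusinSpace E] [BorelSpace E] [Nonempty E] in
-- On bounded functions `Q_t` stays within order `t` of `exp (-(M+β₁)t) T_t`. The term `(M+β₁) D`
-- pays for replacing the killing weight, and `M D β₁` bounds the source of the Duhamel integral.
theorem IsPerturbedSemigroup.lintegral_le_expNeg_mul_add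
    (hQ : IsPerturbedSemigroup X (fun x => c x + β₁) (meanKernel c β₁ B) Q) (hM : ∀ x, c x ≤ M)
    (hpos : 0 < β₁) (hβ₁ : ∀ x, ∫⁻ μ, lin (fun _ => 1) μ ∂(B x) ≤ β₁) {f : E → ℝ≥0∞}
    (hf : Measurable f) {D : ℝ≥0} (hD : ∀ x, f x ≤ D) (t : ℝ≥0) (x : E) :
    ∫⁻ y, f y ∂(Q t x) ≤ expNeg (((M + β₁) * t : ℝ≥0) : ℝ≥0∞) * ∫⁻ y, f y ∂(X.T t x) +
      (((M + β₁) * D + M * (D * β₁)) * t : ℝ≥0) := by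
  set e := expNeg (((M + β₁) * t : ℝ≥0) : ℝ≥0∞) with he
  have he1 : e ≤ 1 := expNeg_le_one _
  have hT : ∫⁻ y, f y ∂(X.T t x) ≤ D := by
    have := X.markov t
    calc ∫⁻ y, f y ∂(X.T t x) ≤ ∫⁻ _, D ∂(X.T t x) := lintegral_mono hD
      _ = D := by simp
  have h1 : X.killed (fun x => c x + β₁) t f x ≤
      e * ∫⁻ y, f y ∂(X.T t x) + (((M + β₁) * t : ℝ≥0) : ℝ≥0∞) * D := by
    calc X.killed (fun x => c x + β₁) t f x ≤ ∫⁻ y, f y ∂(X.T t x) := killed_le_lintegral _ t hf x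
      _ = e * ∫⁻ y, f y ∂(X.T t x) + (1 - e) * ∫⁻ y, f y ∂(X.T t x) := by
          rw [← add_mul, add_tsub_cancel_of_le he1, one_mul]
      _ ≤ _ := by
          gcongr
          exact one_sub_expNeg_le _
  have h2 : X.duhamel (fun x => c x + β₁) (fun s y => ((c y + β₁ : ℝ≥0) : ℝ≥0∞) *
      meanKernel c β₁ B (fun z => ∫⁻ w, f w ∂(Q s z)) y) t x ≤
        ((M * (D * β₁) * t : ℝ≥0) : ℝ≥0∞) := by
    refine duhamel_le _ (fun s y => ?_) t x
    rw [coe_mul_meanKernel hpos]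
    push_cast
    gcongr
    · exact hM y
    · calc ∫⁻ μ, lin (fun z => ∫⁻ w, f w ∂(Q s z)) μ ∂(B y)
          ≤ ∫⁻ μ, D * lin (fun _ => 1) μ ∂(B y) := by
            refine lintegral_mono fun μ => ?_
            rw [← lin_const_mul]
            exact lin_mono (fun z => by simpa using hQ.lintegral_le_of_bound hD s z) μ
        _ ≤ D * β₁ := by
            rw [lintegral_const_mul' _ _ ENNReal.coe_ne_top]
            gcongr
            exact hβ₁ y
  rw [hQ.equation f ⟨hf, D, hD⟩]
  refine (add_le_add h1 h2).trans_eq ?_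
  push_cast
  ring

omit [LusinSpace E] [BorelSpace E] [Nonempty E] in
/-- Bounded excessive functions of the perturbed semigroup are excessive for the base process. -/
theorem IsExcessive.of_isPerturbedSemigroup
    (hQ : IsPerturbedSemigroup X (fun x => c x + β₁) (meanKernel c β₁ B) Q) (hM : ∀ x, c x ≤ M)
    (hpos : 0 < β₁) (hβ₁ : ∀ x, ∫⁻ μ, lin (fun _ => 1) μ ∂(B x) ≤ β₁) {β : ℝ≥0} {u : E → ℝ≥0∞}
    (hu : IsExcessive Q β u) {D : ℝ≥0} (hD : ∀ x, u x ≤ D) :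
    IsExcessive X.T (β + (M + β₁)) u := by
  have hexp : ∀ t : ℝ≥0, ENNReal.ofReal (Real.exp (-(((M + β₁ : ℝ≥0) : ℝ) * t))) =
      expNeg (((M + β₁) * t : ℝ≥0) : ℝ≥0∞) := fun t => by
    rw [expNeg_coe, NNReal.coe_mul]
  -- The comparison semigroup is `exp (-(M+β₁)t) T_t`, which lies below `Q_t`; its exponential
  -- accounts for the raised level.
  refine hu.of_close (K := D) (D := (M + β₁) * D + M * (D * β₁))
    (hQ.lintegral_le_of_bound hD) (fun t x => ?_) fun t x => ?_
  · rw [hexp]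
    exact hQ.expNeg_mul_le hM ⟨hu.1, D, hD⟩ t x
  · rw [hexp]
    exact hQ.lintegral_le_expNeg_mul_add hM hpos hβ₁ hu.1 hD t x

omit [LusinSpace E] [BorelSpace E] [Nonempty E] in
-- `Q_t 1` lies between `exp (-(M+β₁)t)` and `1`.
theorem IsPerturbedSemigroup.isExcessive_one
    (hQ : IsPerturbedSemigroup X (fun x => c x + β₁) (meanKernel c β₁ B) Q) (hM : ∀ x, c x ≤ M)
    (β : ℝ≥0) : IsExcessive Q β fun _ => 1 := by
  have hf : IsBoundedPosMeasurable fun _ : E => (1 : ℝ≥0∞) :=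
    ⟨measurable_const, 1, fun _ => by simp⟩
  have hle : ∀ t x, ∫⁻ _, 1 ∂(Q t x) ≤ 1 := hQ.lintegral_le_of_bound fun _ => le_rfl
  refine ⟨measurable_const, fun α _ x => ?_, fun x => ?_⟩
  · refine le_trans (mul_le_mul_right (lintegral_mono fun t => ?_) _)
      (mul_lintegral_Ici_exp_le_one β α)
    exact mul_le_of_le_one_right' (hle _ _)
  · refine tendsto_mul_laplace β (K := 1)
      ((hQ.measurable _ hf).comp (measurable_id.prodMk measurable_const)) (fun t => hle t x) ?_
    refine tendsto_of_tendsto_of_tendsto_of_le_of_le (tendsto_expNeg_mul (M + β₁))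
      tendsto_const_nhds (fun t => ?_) fun t => hle t x
    have := X.markov t
    simpa using hQ.expNeg_mul_le hM hf t x

/-- If `u` is a bounded excessive function of the perturbed semigroup, then `1 - exp (-lin u)` is
excessive for the branching semigroup. -/
theorem isExcessive_one_sub_expNeg [IsMarkovKernel B] (hH : IsBranchingSemigroup X c B H)
    (h1 : ∀ t x, H t (dirac x) Set.univ = 1)
    (hQ : IsPerturbedSemigroup X (fun x => c x + β₁) (meanKernel c β₁ B) Q) (hM : ∀ x, c x ≤ M)
    (hpos : 0 < β₁) (hβ₁ : ∀ x, ∫⁻ μ, lin (fun _ => 1) μ ∂(B x) ≤ β₁) {β γ : ℝ≥0} {u : E → ℝ≥0∞}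
    (hu : IsExcessive Q β u) {D : ℝ≥0} (hD : ∀ x, u x ≤ D) (a : ℝ≥0)
    (hl : IsExcessive H γ (lin fun x => a * u x)) :
    IsExcessive H γ fun μ => 1 - expNeg (lin (fun x => a * u x) μ) := by
  have hv : Measurable fun x => a * u x := hu.1.const_mul _
  have hvD : ∀ x, a * u x ≤ ((a * D : ℝ≥0) : ℝ≥0∞) := fun x => by
    push_cast
    gcongr
    exact hD x
  have hφ : Measurable fun x => expNeg (a * u x) := measurable_expNeg.comp hv
  have hφ1 : ∀ x, expNeg (a * u x) ≤ 1 := fun x => expNeg_le_one _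
  have hint : ∀ t μ, ∫⁻ ν, (1 - expNeg (lin (fun x => a * u x) ν)) ∂(H t μ) =
      1 - ∫⁻ ν, mult (fun x => expNeg (a * u x)) ν ∂(H t μ) := fun t μ => by
    have := (hH.branching t).isProbabilityMeasure (h1 t) μ
    exact lintegral_one_sub_expNeg_lin _ hv
  refine ⟨measurable_const.sub (measurable_expNeg.comp (measurable_lin hv)), fun α hα μ => ?_,
    fun μ => ?_⟩
  · exact mul_kernelResolvent_one_sub_expNeg_le (fun t => (hH.branching t).1) hl hα
      (lin_ne_top_of_bound hvD μ)
  -- Being excessive for the base process makes `u`, and hence `exp (-au)`, right continuous along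
  -- trajectories; resolvent limits of `u` alone would not control this nonlinear function.
  · have hT : IsExcessive X.T (β + (M + β₁)) u := hu.of_isPerturbedSemigroup hQ hM hpos hβ₁ hD
    have hlim : Tendsto (fun t => ∫⁻ ν, mult (fun x => expNeg (a * u x)) ν ∂(H t μ)) (𝓝 0)
        (𝓝 (mult (fun x => expNeg (a * u x)) μ)) :=
      hH.tendsto_lintegral_mult h1 hM hφ hφ1 (fun x => tendsto_lintegral_excessive (by positivity)
        hT (F := fun r => expNeg (a * r))
        (continuous_expNeg.comp (ENNReal.continuous_const_mul ENNReal.coe_ne_top))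
        (fun r => expNeg_le_one _) x) μ
    have := tendsto_mul_laplace γ (K := 1)
      (g := fun t => ∫⁻ ν, (1 - expNeg (lin (fun x => a * u x) ν)) ∂(H t μ))
      (l := 1 - expNeg (lin (fun x => a * u x) μ))
      (by
        simp_rw [hint]
        exact measurable_const.sub (hH.measurable_lintegral_mult h1 hφ hφ1 μ))
      (fun t => by
        rw [hint]
        simp)
      (by
        simp_rw [hint]
        rw [← mult_expNeg]
        exact ENNReal.Tendsto.sub tendsto_const_nhds hlim (Or.inl ENNReal.one_ne_top))
    exact this

end Excessive

theorem IsExcessive.const_mul {S : Type*} [MeasurableSpace S] {P : ℝ≥0 → Kernel S S} {β : ℝ≥0}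
    {u : S → ℝ≥0∞} (hu : IsExcessive P β u) (a : ℝ≥0) :
    IsExcessive P β (fun x => a * u x) := by
  refine ⟨hu.1.const_mul _, fun α hα x => ?_, fun x => ?_⟩
  · rw [kernelResolvent_const_mul _ ENNReal.coe_ne_top, mul_left_comm]
    exact mul_le_mul_right (hu.2.1 α hα x) _
  · simp_rw [kernelResolvent_const_mul _ ENNReal.coe_ne_top, mul_left_comm _ (a : ℝ≥0∞)]
    exact ENNReal.Tendsto.const_mul (hu.2.2 x) (Or.inr ENNReal.coe_ne_top)

/-! ### The theorem -/

theorem proposition4p8 {E : Type*} [TopologicalSpace E] [LusinSpace E] [MeasurableSpace E]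
    [BorelSpace E] {Ω : Type*} [MeasurableSpace Ω] (X : BorelRightProcess E Ω)
    (B : Kernel E (FinConf E)) (hB : ∀ x, B x Set.univ = 1)
    (β₁ : ℝ≥0) (hβ₁ : (β₁ : ℝ≥0∞) = ⨆ x, ∫⁻ μ, FinConf.lin (fun _ => 1) μ ∂(B x))
    (one_lt : 1 < β₁)
    (c : E → ℝ≥0) (hc : Measurable c) (hc_lt : ∀ x, (c x : ℝ) < (β₁ : ℝ) / ((β₁ : ℝ) - 1)) :
    (∃ H : ℝ≥0 → Kernel (FinConf E) (FinConf E), IsBranchingSemigroup X c B H) ∧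
    (∃ Q : ℝ≥0 → Kernel E E,
      IsPerturbedSemigroup X (fun x => c x + β₁) (meanKernel c β₁ B) Q) ∧
    ∀ (H : ℝ≥0 → Kernel (FinConf E) (FinConf E)) (Q : ℝ≥0 → Kernel E E),
      IsBranchingSemigroup X c B H →
      IsPerturbedSemigroup X (fun x => c x + β₁) (meanKernel c β₁ B) Q →
      -- (i)
      (∀ f : E → ℝ≥0∞, IsBoundedPosMeasurable f → ∀ t : ℝ≥0, 0 < t → ∀ μ : FinConf E,
        ENNReal.ofReal (Real.exp (-((β₁ : ℝ) * t))) * ∫⁻ ν, FinConf.lin f ν ∂(H t μ) =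
          FinConf.lin (fun x => ∫⁻ y, f y ∂(Q t x)) μ) ∧
      -- (ii)
      (∀ β : ℝ≥0, 0 < β → ∀ u : E → ℝ≥0∞, IsBoundedPosMeasurable u →
        List.TFAE [IsExcessive Q β u,
          IsExcessive H (β₁ + β) (FinConf.lin u),
          ∀ α : ℝ≥0, 0 < α →
            IsExcessive H (β₁ + β) (fun μ => 1 - FinConf.expLin (fun x => (α : ℝ≥0∞) * u x) μ)]) ∧
      -- (iii)
      (∀ β : ℝ≥0, 0 < β → ∀ u : E → ℝ≥0∞, IsCompactLyapunov Q β u →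
        IsCompactLyapunov H (β₁ + β) (FinConf.lin (fun x => 1 + u x)) ∧
        ∀ μ : FinConf E, FinConf.lin u μ < ∞ → FinConf.lin (fun x => 1 + u x) μ < ∞) := by
  have hpos : 0 < β₁ := one_pos.trans one_lt
  -- On an empty space the supremum defining `β₁` would be `0`.
  have : Nonempty E := by
    by_contra h
    rw [not_nonempty_iff] at h
    rw [iSup_of_empty, bot_eq_zero, ENNReal.coe_eq_zero] at hβ₁
    exact hpos.ne' hβ₁
  have : IsMarkovKernel B := ⟨fun x => ⟨hB x⟩⟩
  have hB₁ : ∀ x, ∫⁻ μ, lin (fun _ => 1) μ ∂(B x) ≤ β₁ := fun x => by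
    rw [hβ₁]
    exact le_iSup (fun x => ∫⁻ μ, lin (fun _ => 1) μ ∂(B x)) x
  have hsub : (0 : ℝ) < (β₁ : ℝ) - 1 := sub_pos.2 (by exact_mod_cast one_lt)
  have hM : ∀ x, c x ≤ β₁ / (β₁ - 1) := fun x => by
    rw [← NNReal.coe_le_coe, NNReal.coe_div, NNReal.coe_sub one_lt.le, NNReal.coe_one]
    exact (hc_lt x).le
  -- The hypothesis on `c` with the denominator cleared; this is the form used to make `Q_t`
  -- sub-Markovian.
  have hcβ : ∀ x, c x * β₁ ≤ c x + β₁ := fun x => by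
    have := (lt_div_iff₀ hsub).1 (hc_lt x)
    rw [← NNReal.coe_le_coe]
    push_cast
    linarith
  obtain ⟨κ, hκ⟩ := X.exists_branching_limit hc B hM
  refine ⟨⟨_, isBranchingSemigroup_branchingFamily hc hM hκ⟩,
    ⟨_, isPerturbedSemigroup_momentFamily hc hM hpos hB₁ hcβ hκ⟩, fun H Q hH hQ => ?_⟩
  have hmom : ∀ f : E → ℝ≥0∞, Measurable f → ∀ (t : ℝ≥0) μ,
      ENNReal.ofReal (Real.exp (-((β₁ : ℝ) * t))) * ∫⁻ ν, lin f ν ∂(H t μ) =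
        lin (fun x => ∫⁻ y, f y ∂(Q t x)) μ :=
    fun f hf t μ => exp_mul_lintegral_lin hc hM hpos hB₁ hcβ hH hQ hf t μ
  have h1 : ∀ t x, H t (dirac x) Set.univ = 1 := hH.apply_dirac_univ hc hM hB₁
  refine ⟨fun f hf t _ μ => hmom f hf.1 t μ, fun β _ u hu => ?_, fun β _ u hu => ⟨⟨?_, ?_⟩, ?_⟩⟩
  · obtain ⟨hum, D, hD⟩ := hu
    tfae_have 1 ↔ 2 := (isExcessive_lin_iff hmom hQ hum).symm
    -- `expLin` is by definition `expNeg` composed with `lin`. The excessivity of `lin (α u)`,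
    -- needed for Jensen, comes from the intertwining.
    tfae_have 1 → 3 := fun h α _ => isExcessive_one_sub_expNeg hH h1 hQ hM hpos hB₁ h hD α
      ((isExcessive_lin_iff hmom hQ (hum.const_mul _)).2 (h.const_mul α))
    tfae_have 3 → 2 := fun h => isExcessive_lin_of_one_sub_expNeg hH h1 hum h
    tfae_finish
  · exact (isExcessive_lin_iff hmom hQ (measurable_const.add hu.1.1)).2
      ((hQ.isExcessive_one hM β).add hu.1 fun x =>
        (hQ.measurable_lintegral measurable_const).comp (measurable_id.prodMk measurable_const))
  · exact fun n => isCompact_closure_lin_le n (hu.2 n)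
  · intro μ hμ
    rw [lin_add_fun]
    exact ENNReal.add_lt_top.2 ⟨(lin_one_ne_top μ).lt_top, hμ⟩
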